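/- **Setting.** There are $W\ge1$ channels and messages $M=\{M_1,\dots,M_m\}$ with probabilities $p_i>0$, $\sum_i p_i=1$, and broadcast costs $0\le c_i\le\mathcal C$. A schedule $S$ broadcasts, in each slot $t=0,1,2,\dots$ (the time interval $[t,t+1)$) and on each channel, at most one message. For the first $n$ slots $S_n$ of $S$, $\mathrm{ERT}(S_n)$ is the expected waiting time of a request for a random message ($M_i$ with probability $p_i$) at a uniformly random real time in $[0,n]$, until the start of the next slot in which the message is broadcast, or until time $n$ if that comes first; $\mathrm{BC}(S_n)$ is the total cost of the messages broadcast in $S_n$, divided by $n$; and $\mathrm{COST}(S)=\limsup_n(\mathrm{ERT}(S_n)+\mathrm{BC}(S_n))$. $\mathrm{COST}(S,X)$ is the same quantity with only the messages of $X$ counted, and $\mathrm{OPT}(M)=\inf_S\mathrm{COST}(S)$. Let the messages be sorted into groups, where the group $G$ has $g_G$ messages, all of probability $p_G$ and cost $c_G$. For a set $X$ of groups put $$\mathrm{LB}_W(X,\alpha)=\min\Big\{\sum_{G\in X}\Big(\frac{p_Gg_G^2\tau_G}{2}+\frac{c_G}{\tau_G}\Big)\ :\ \tau_G>0,\ \sum_{G\in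 X}\frac1{\tau_G}\le\alpha W\Big\}.$$ Put $\bar{\mathcal C}=\max(\mathcal C,1)$, $T=\frac{40\ln(1+4/\epsilon)}{\epsilon^4(1-\epsilon/6)}\bar{\mathcal C}$, $\kappa=2WT/\epsilon$ and $N=\lceil10\bar{\mathcal C}/\epsilon\rceil$. For a set $A$ of groups let $|A|$ be its number of messages, $a=\max(|A|,1)$ and $L=\lfloor Ta^2\rfloor$. **The algorithm.** 1. *Round.* Let $j_i\ge1$ be the least $j$ with $(1+\epsilon)^{-j}<p_i$. Replace $p_i$ by $r(1+\epsilon)^{-j_i}$, where $r$ makes the sum equal to $1$, and replace $c_i$ by $k_i\epsilon/W$ with $k_i=\lfloor c_iW/\epsilon\rfloor$. Call the result $\dot M$; its groups are the sets of messages with equal $(j_i,k_i)$. *Partition* the groups into sets $A,B,C$ with $g_G\ge\kappa a^2$ for all $G\in B$ and $\mathrm{LB}_1(C,1/N)\le\frac{3\epsilon}{10}\mathrm{OPT}(\dot M)$. Steps 2 and 3 use the rounded values. 2. *Schedule $A\cup B$.* Among all periodic schedules of the messages of $A$ with some period $P\le L$ and density (fraction of the $WP$ positions of a period that are occupied) of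 the form $\alpha=x/(WL)$, $x\in\{0,1,\dots,WL-1\}$, choose $S_{\alpha_0}$, of density $\alpha_0$, so that $\mathrm{COST}(S_\alpha,A)+\mathrm{LB}_W(B,1-\alpha)$ is minimal. Let $\tau^*$ attain $\mathrm{LB}_W(B,1-\alpha_0)$. Process the empty positions of $S_{\alpha_0}$ in order; for each, independently draw $G\in B$ with probability $1/(\tau^*_G(1-\alpha_0)W)$, or a dummy with the remaining probability. If $G$ is drawn, broadcast the next message of $G$ in round robin order; if the dummy is drawn, stay idle. 3. *Insert $C$.* Let $\sigma^*$ attain $\mathrm{LB}_1(C,1/N)$. Draw $x$ uniformly from $\{0,\dots,N-2\}$, and insert a new slot, empty on all channels, just before the slots $x,x+(N-1),x+2(N-1),\dots$. In each new slot, use the first channel as follows: independently draw $G\in C$ with probability $N/\sigma^*_G$, or a dummy with the remaining probability; broadcast the next message of $G$ in round robin order, or stay idle if the dummy is drawn. **Proposition (PTRAS).** Let $0<\epsilon<1/7$, $W\ge1$ and $\mathcal C\ge0$. There is a constant $K=K(\epsilon,W,\mathcal C)$ such that for every message set $M$ as above a partition as required in step 1 exists with $|A|\le K$. For every partition as required in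 step 1, steps 2 and 3 can be carried out, and, whichever minimizers are chosen, $\mathrm{COST}(S)$ (with respect to the original $p_i$ and $c_i$) is a measurable function of the random draws and the random schedule $S$ satisfies $$\mathbb E[\mathrm{COST}(S)]\le(1+10\epsilon)\,\mathrm{OPT}(M).$$ -/

import Mathlib

open MeasureTheory Filter
open scoped ENNReal

noncomputable section

namespace DataBroadcast

/-! ## Schedules and their cost -/

/-- An infinite schedule of `m` messages on `W` channels: at time `t` and on channel `k` it
broadcasts the message `S t k`, or nothing if `S t k = none`. The slot `t` occupies the time
interval `[t, t + 1)`. -/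
abbrev Schedule (W m : ℕ) := ℕ → Fin W → Option (Fin m)

/-- For a request for message `i` issued during slot `t < n`: the start of the next slot in which
`i` is broadcast on some channel, or the end `n` of the schedule truncated to its first `n` slots,
whichever comes first. -/
def nextTime {W m : ℕ} (S : Schedule W m) (n : ℕ) (i : Fin m) (t : ℕ) : ℕ :=
  sInf (insert n {s : ℕ | t < s ∧ ∃ k, S s k = some i})

/-- Contribution of the messages of `X` to the expected response time of the first `n` slots of
`S`, for a request at a uniformly random real time of `[0, n]`. A request at time `t + u` with
`0 < u < 1` waits `nextTime - t - u`, which is `nextTime - t - 1 / 2` on average over the slot. -/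
def ert {W m : ℕ} (p : Fin m → ℝ) (X : Finset (Fin m)) (S : Schedule W m) (n : ℕ) : ℝ :=
  (∑ t ∈ Finset.range n, ∑ i ∈ X, p i * ((nextTime S n i t : ℝ) - t - 1 / 2)) / n

/-- Contribution of the messages of `X` to the broadcast cost of the first `n` slots of `S`. -/
def bc {W m : ℕ} (c : Fin m → ℝ) (X : Finset (Fin m)) (S : Schedule W m) (n : ℕ) : ℝ :=
  (∑ t ∈ Finset.range n, ∑ k : Fin W, ∑ i ∈ X, if S t k = some i then c i else 0) / n

/-- `COST(S, X)`: contribution of the messages of `X` to the cost of the infinite schedule `S`. -/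
def cost {W m : ℕ} (p c : Fin m → ℝ) (X : Finset (Fin m)) (S : Schedule W m) : ℝ≥0∞ :=
  limsup (fun n : ℕ => ENNReal.ofReal (ert p X S n + bc c X S n)) atTop

/-- `OPT(M)`: the infimum of the costs of all infinite schedules on `W` channels. -/
def opt (W : ℕ) {m : ℕ} (p c : Fin m → ℝ) : ℝ≥0∞ :=
  ⨅ S : Schedule W m, cost p c Finset.univ S

/-! ## Grouped messages and the relaxation -/

/-- Name `(j, k)` of the group of messages of probability `r / (1 + ε) ^ j` and cost `k ε / W`. -/
abbrev Label := ℕ × ℕ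

/-- Messages sorted into groups; all messages of a group share one probability and one cost. -/
structure Grouped (m : ℕ) where
  label : Fin m → Label
  prob : Label → ℝ
  cst : Label → ℝ

namespace Grouped

variable {m : ℕ} (D : Grouped m)

/-- Probability of a message. -/
def p (i : Fin m) : ℝ := D.prob (D.label i)

/-- Broadcast cost of a message. -/
def c (i : Fin m) : ℝ := D.cst (D.label i)

/-- The names of the (non-empty) groups. -/
def labels : Finset Label := Finset.univ.image D.label

/-- The messages of the group `G`. -/
def group (G : Label) : Finset (Fin m) := Finset.univ.filter fun i => D.label i = G

/-- The number of messages of the group `G`. -/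
def size (G : Label) : ℕ := (D.group G).card

/-- The messages of a set of groups. -/
def messages (Q : Finset Label) : Finset (Fin m) := Finset.univ.filter fun i => D.label i ∈ Q

/-- The `n`-th broadcast (`n = 0, 1, 2, …`) of the group `G` in round robin order. -/
def nth (G : Label) (n : ℕ) : Option (Fin m) :=
  ((D.group G).sort (· ≤ ·))[n % D.size G]?

/-- Objective function of the relaxation, for the groups of `Q`. -/
def lbValue (Q : Finset Label) (τ : Label → ℝ) : ℝ :=
  ∑ G ∈ Q, (D.prob G * (D.size G : ℝ) ^ 2 * τ G / 2 + D.cst G / τ G)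

end Grouped

/-- Constraints of the relaxation: positive periods, and total density at most `β`. -/
def Feasible (Q : Finset Label) (β : ℝ) (τ : Label → ℝ) : Prop :=
  (∀ G ∈ Q, 0 < τ G) ∧ ∑ G ∈ Q, 1 / τ G ≤ β

/-- `LB(Q, α)` for `W` channels. -/
def LB {m : ℕ} (D : Grouped m) (W : ℕ) (Q : Finset Label) (α : ℝ) : ℝ≥0∞ :=
  ⨅ (τ : Label → ℝ) (_ : Feasible Q (α * W) τ), ENNReal.ofReal (D.lbValue Q τ)

/-- `τ` attains the minimum in `LB(Q, α)` for `W` channels. -/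
def IsLBSolution {m : ℕ} (D : Grouped m) (W : ℕ) (Q : Finset Label) (α : ℝ)
    (τ : Label → ℝ) : Prop :=
  Feasible Q (α * W) τ ∧ ∀ τ', Feasible Q (α * W) τ' → D.lbValue Q τ ≤ D.lbValue Q τ'

/-! ## First step: rounding and partition -/

/-- The least `j` with `1 / (1 + ε) ^ j < x`; it is at least `1` for `0 < x ≤ 1`. -/
def probExp (ε x : ℝ) : ℕ := ⌊Real.logb (1 + ε) (1 / x)⌋₊ + 1

/-- The constant `r` for which the rounded probabilities `r / (1 + ε) ^ j` sum up to `1`. -/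
def normConst (ε : ℝ) {m : ℕ} (p : Fin m → ℝ) : ℝ :=
  (∑ i, 1 / (1 + ε) ^ probExp ε (p i))⁻¹

/-- The rounded message set: probabilities of the form `r / (1 + ε) ^ j`, and costs rounded down
to a multiple of `ε / W`. -/
def rounded (W : ℕ) (ε : ℝ) {m : ℕ} (p c : Fin m → ℝ) : Grouped m where
  label i := (probExp ε (p i), ⌊c i * W / ε⌋₊)
  prob G := normConst ε p / (1 + ε) ^ G.1
  cst G := G.2 * (ε / W)

/-- The constant `T(ε)`. -/
def periodConst (ε C : ℝ) : ℝ :=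
  40 * Real.log (1 + 4 / ε) / (ε ^ 4 * (1 - ε / 6)) * max C 1

/-- The constant `κ(ε)`. -/
def kappa (W : ℕ) (ε C : ℝ) : ℝ := 2 * W * periodConst ε C / ε

/-- One slot out of `insertPeriod` is reserved for the negligible messages: `10 C / ε`, rounded up
to an integer, where the bound `C` on the costs is replaced by `1` if it is smaller. -/
def insertPeriod (ε C : ℝ) : ℕ := ⌈10 * max C 1 / ε⌉₊

/-- The number of messages of a set `A` of groups, but at least `1`. -/
def size1 {m : ℕ} (D : Grouped m) (A : Finset Label) : ℕ := max (D.messages A).card 1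

/-- `A`, `B`, `Q` is a partition of the groups in which the groups of `B` are large and `Q` has
negligible contribution. -/
structure IsPartition {m : ℕ} (D : Grouped m) (W : ℕ) (ε C : ℝ) (A B Q : Finset Label) : Prop where
  cover : A ∪ B ∪ Q = D.labels
  disj_AB : Disjoint A B
  disj_AQ : Disjoint A Q
  disj_BQ : Disjoint B Q
  large : ∀ G ∈ B, kappa W ε C * (size1 D A : ℝ) ^ 2 ≤ D.size G
  negligible : LB D 1 Q (1 / insertPeriod ε C) ≤ ENNReal.ofReal (3 * ε / 10) * opt W D.p D.c

/-! ## Second step: scheduling `A` and `B` -/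

/-- The bound `T(ε) |A|²` on the period of the schedule of `A`. -/
def maxPeriod {m : ℕ} (D : Grouped m) (ε C : ℝ) (A : Finset Label) : ℕ :=
  ⌊periodConst ε C * (size1 D A : ℝ) ^ 2⌋₊

/-- The density `x / (W T(ε) |A|²)`. -/
def gridDensity {m : ℕ} (D : Grouped m) (W : ℕ) (ε C : ℝ) (A : Finset Label) (x : ℕ) : ℝ :=
  x / (W * maxPeriod D ε C A)

/-- `S` is a periodic schedule of the messages of `A`, with period at most `T(ε) |A|²`, whose
density is the `x`-th one of the grid and smaller than `1`. (The density `0` is met by the empty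
schedule only, whose cost is infinite unless `A` is empty.) -/
def Candidate {m : ℕ} (D : Grouped m) (W : ℕ) (ε C : ℝ) (A : Finset Label) (x : ℕ)
    (S : Schedule W m) : Prop :=
  x < W * maxPeriod D ε C A ∧
  (∀ t k i, S t k = some i → i ∈ D.messages A) ∧
  ∃ P : ℕ, 1 ≤ P ∧ P ≤ maxPeriod D ε C A ∧ (∀ t k, S (t + P) k = S t k) ∧
    (((Finset.range P ×ˢ (Finset.univ : Finset (Fin W))).filter
      fun s => S s.1 s.2 ≠ none).card : ℝ) / (W * P) = gridDensity D W ε C A x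

/-- `x` and `S` are the density index and the schedule of `A` selected by exhaustive search: they
minimize `COST(S_α, A) + LB(B, 1 - α)` over all candidates of all densities `α`. (In particular `S`
is optimal among the candidates of its own density.) -/
def IsBestCandidate {m : ℕ} (D : Grouped m) (W : ℕ) (ε C : ℝ) (A B : Finset Label) (x : ℕ)
    (S : Schedule W m) : Prop :=
  Candidate D W ε C A x S ∧
  ∀ x' S', Candidate D W ε C A x' S' →
    cost D.p D.c (D.messages A) S + LB D W B (1 - gridDensity D W ε C A x) ≤
      cost D.p D.c (D.messages A) S' + LB D W B (1 - gridDensity D W ε C A x')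

/-- The law of the draw of a group: `G ∈ Q` is drawn with probability `1 / τ G`, and the dummy group
`none` with the remaining probability. -/
def IsDrawLaw (Q : Finset Label) (τ : Label → ℝ) (q : PMF (Option Label)) : Prop :=
  ∀ G, q (some G) = if G ∈ Q then ENNReal.ofReal (1 / τ G) else 0

/-- Fill the empty slots `(t, k)` of `S`, from left to right: if the group `G` is drawn for the
slot, then the slot is given to the next message of `G` in round robin order; if the dummy group is
drawn, then the slot stays idle. -/
def fill {W m : ℕ} (D : Grouped m) (S : Schedule W m) (d : ℕ × Fin W → Option Label) :
    Schedule W m := fun t k =>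
  match S t k with
  | some i => some i
  | none =>
    match d (t, k) with
    | none => none
    | some G => D.nth G ((Finset.range (t + 1) ×ˢ (Finset.univ : Finset (Fin W))).filter fun s =>
        (s.1 < t ∨ s.1 = t ∧ s.2 < k) ∧ S s.1 s.2 = none ∧ d s = some G).card

/-! ## Third step: inserting the negligible messages -/

/-- The one-channel group round robin schedule with draws `d`. -/
def roundRobin {m : ℕ} (D : Grouped m) (d : ℕ → Option Label) : ℕ → Option (Fin m) := fun n =>
  match d n with
  | none => none
  | some G => D.nth G ((Finset.range n).filter fun l => d l = some G).card

/-- Insert a new slot, empty on all channels, just before each of the slots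
`x, x + (N - 1), x + 2 (N - 1), …` of `S`; the new slots are at times `x, x + N, x + 2 N, …`. Then
put the one-channel schedule `R` on the first channel of the new slots. -/
def insertSlots {W m : ℕ} (N x : ℕ) (S : Schedule W m) (R : ℕ → Option (Fin m)) :
    Schedule W m := fun t k =>
  if x ≤ t ∧ N ∣ (t - x) then (if k.val = 0 then R ((t - x) / N) else none)
  else S (t - (t - x + N - 1) / N) k

/-! ## The randomized algorithm -/

/-- The data computed by the algorithm before its random draws, from the partition `A`, `B`, `Q`:
the density index `x` and the schedule `S` of `A`, the minimizers `τB` of `LB(B, 1 - α₀)` and `τQ`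
of `LB(Q, 1 / N)` on one channel, and the laws of the draws for the empty slots of `S` and for the
slots inserted for `Q`. -/
structure IsPlan {m : ℕ} (D : Grouped m) (W : ℕ) (ε C : ℝ) (A B Q : Finset Label) (x : ℕ)
    (S : Schedule W m) (τB τQ : Label → ℝ) (qB qQ : PMF (Option Label)) : Prop where
  best : IsBestCandidate D W ε C A B x S
  solB : IsLBSolution D W B (1 - gridDensity D W ε C A x) τB
  solQ : IsLBSolution D 1 Q (1 / insertPeriod ε C) τQ
  lawB : IsDrawLaw B (fun G => τB G * (1 - gridDensity D W ε C A x) * W) qB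
  lawQ : IsDrawLaw Q (fun G => τQ G / insertPeriod ε C) qQ

instance : MeasurableSpace (Option Label) := ⊤

/-- The random choices of the algorithm: the starting point of the insertions, the draws for the
slots of the schedule of `A`, and the draws for the inserted slots. -/
abbrev Choices (W : ℕ) := ℕ × (ℕ × Fin W → Option Label) × (ℕ → Option Label)

/-- The law of the random choices: the starting point is uniform on `{0, …, N - 2}`, the draws have
laws `qB` and `qQ`, and all of them are independent. -/
def choiceLaw (W N : ℕ) (qB qQ : PMF (Option Label)) : Measure (Choices W) :=
  (ProbabilityTheory.uniformOn (Set.Iio (N - 1))).prod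
    ((Measure.infinitePi fun _ : ℕ × Fin W => qB.toMeasure).prod
      (Measure.infinitePi fun _ : ℕ => qQ.toMeasure))

/-- The schedule produced by the algorithm for the random choices `ω`. -/
def output {W m : ℕ} (D : Grouped m) (N : ℕ) (S : Schedule W m) (ω : Choices W) : Schedule W m :=
  insertSlots N ω.1 (fill D S ω.2.1) (roundRobin D ω.2.2)

end DataBroadcast

end

noncomputable section

namespace DataBroadcast

/-! ## An integrated form of the pointwise ergodic theorem -/

/-! Both halves of the estimate compare schedules with the relaxation `LB`. It is a lower bound by
Cauchy–Schwarz: `k` broadcasts of a message cut `n` slots into at most `k + 1` gaps, and a gap of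
length `x` contributes `x ^ 2 / 2` to the total waiting time (`sum_wait_Ico_ge`,
`exists_lbValue_le`). Conversely, random draws nearly attain it. If a group of `g` messages is drawn
with frequency `1 / τ` and served in round robin order, a request waits for the `j`-th next draw
with `j` uniform on `1, …, g`, which costs about `j τ`; the sum over the group is about `g ^ 2 τ /
2`. The uneven distribution of the empty positions of the schedule of `A` adds an error of at most
the number `E` of empty positions of a period to `j`, and this is harmless once `2 E ≤ ε g`
(`lintegral_countWait_emptyDraws_le`, `sum_lintegral_stretch_le`). The groups of `B` are that large.
The negligible groups are so cheap that even a factor `2` does not matter.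

Only the boundedly many messages of `A` need a search, and short periods suffice for it
(`IsInstance.exists_candidate_le`). A long finite part of any schedule of finite cost yields a
solution of the relaxation for `B`. For `A`, a few windows of that part are repeated periodically. A
slot is inserted after every `h = ⌈3 / ε⌉` slots; the first inserted slots of a window broadcast
every message of `A` once, so that a wait crossing a window boundary ends soon, and the other ones
are the reserve of density that pays for all errors. Few windows suffice because cost and density
are just two quantities: from a finite planar set two points can be mixed to match the averages of
both (`exists_selection`).

A partition exists by a pigeonhole argument on the weights `∑ √p`, since the square of the total
weight divided by `2 W` is a lower bound for the optimum (`sq_sum_sqrt_le_opt`,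
`exists_isPartition`).

The cost of the random output is an upper limit along a path, so it does not suffice to bound
expected costs of slots. The slot costs are dominated by functions of the independent draws that are
equivariant under a measure preserving shift (`slotBound_add`), and one inequality of the pointwise
ergodic theorem (`lintegral_limsup_birkhoff_le`) bounds the expected upper limit by the mean
expectation over one period. Averaging over the random offset of the inserted slots stretches a wait
that starts in an original slot by the factor `N / (N - 1)` only (`sum_newTime`). -/

lemma mul_le_sum_add_of_blocks {g : ℝ≥0∞} {R : ℕ} (k : ℕ) (a : ℕ → ℝ≥0∞)
    (h : ∀ p, ∃ n, 1 ≤ n ∧ n ≤ R ∧ n * g ≤ ∑ j ∈ Finset.range n, a (p + j)) :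
    k * g ≤ (∑ j ∈ Finset.range k, a j) + R * g := by
  induction k using Nat.strong_induction_on generalizing a with
  | _ k ih =>
    -- Greedy tiling: good blocks are cut off from the left until at most `R` terms remain; these
    -- are paid by the extra `R * g`.
    by_cases hk : k ≤ R
    · refine le_add_left ?_
      gcongr
    · push Not at hk
      obtain ⟨n, h1, h2, h3⟩ := h 0
      have hlt : k - n < k := by omega
      have h4 := ih (k - n) hlt (fun j => a (n + j)) (fun p => by
        obtain ⟨m, hm⟩ := h (n + p)
        exact ⟨m, by simpa [add_assoc] using hm⟩)
      have hkn : k = n + (k - n) := by omega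
      calc (k : ℝ≥0∞) * g = n * g + ((k - n : ℕ) : ℝ≥0∞) * g := by
            rw [← add_mul]; congr 1; exact_mod_cast hkn
        _ ≤ (∑ j ∈ Finset.range n, a j) +
              ((∑ j ∈ Finset.range (k - n), a (n + j)) + R * g) := by
            gcongr
            simpa using h3
        _ = (∑ j ∈ Finset.range k, a j) + R * g := by
            rw [← add_assoc, ← Finset.sum_range_add, ← hkn]

section Ergodic

variable {Ω : Type*} [MeasurableSpace Ω] {μ : Measure Ω} [IsProbabilityMeasure μ] {T : Ω → Ω}
  {F : Ω → ℝ≥0∞}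

/-- The tiling proof of the ergodic theorem. Let `E R` be the set of points without a good block of
length at most `R`; these sets decrease to the empty set. Raising `F` by `M` on `E R` makes every
point good with blocks of length at most `R`, and tiling an orbit segment of length `k` gives `k ∫ g
≤ k (∫ F + M μ (E R)) + R M`. Then `k → ∞`, and afterwards `R → ∞`. -/
lemma lintegral_le_of_le_birkhoffSum (hT : MeasurePreserving T μ μ) (hF : Measurable F)
    {g : Ω → ℝ≥0∞} (hg : Measurable g) {M : ℝ≥0∞} (hM : M ≠ ⊤) (hgM : ∀ ω, g ω ≤ M)
    (hgT : ∀ᵐ ω ∂μ, g ω ≤ g (T ω))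
    (hn : ∀ ω, ∃ n : ℕ, 1 ≤ n ∧ n * g ω ≤ ∑ j ∈ Finset.range n, F (T^[j] ω)) :
    ∫⁻ ω, g ω ∂μ ≤ ∫⁻ ω, F ω ∂μ := by
  have hTm : ∀ j, Measurable (T^[j]) := fun j => hT.measurable.iterate j
  set E : ℕ → Set Ω := fun R =>
    ⋂ n ∈ Finset.Icc 1 R, {ω | ∑ j ∈ Finset.range n, F (T^[j] ω) < n * g ω} with hE
  have hEm : ∀ R, MeasurableSet (E R) := fun R =>
    Finset.measurableSet_biInter _ fun n _ => measurableSet_lt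
      (Finset.measurable_sum _ fun j _ => hF.comp (hTm j)) (hg.const_mul _)
  have hanti : Antitone E := by
    intro R R' h
    refine Set.biInter_subset_biInter_left ?_
    intro n hn
    simp only [Finset.mem_coe, Finset.mem_Icc] at hn ⊢
    exact ⟨hn.1, hn.2.trans h⟩
  have hempty : ⋂ R, E R = ∅ := by
    rw [Set.eq_empty_iff_forall_notMem]
    intro ω hω
    obtain ⟨n, h1, h2⟩ := hn ω
    have := Set.mem_iInter₂.1 (Set.mem_iInter.1 hω n) n (Finset.mem_Icc.2 ⟨h1, le_rfl⟩)
    exact absurd h2 (not_le.2 this)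
  have hlim : Tendsto (fun R => μ (E R)) atTop (nhds 0) := by
    have := tendsto_measure_iInter_atTop (μ := μ) (fun R => (hEm R).nullMeasurableSet) hanti
      ⟨0, measure_ne_top _ _⟩
    rwa [hempty, measure_empty] at this
  have hmono : ∀ᵐ ω ∂μ, ∀ j, g ω ≤ g (T^[j] ω) := by
    have h1 : ∀ᵐ ω ∂μ, ∀ j, g (T^[j] ω) ≤ g (T^[j + 1] ω) := by
      refine ae_all_iff.2 fun j => ?_
      have := (hT.iterate j).quasiMeasurePreserving.ae hgT
      simpa [Function.iterate_succ_apply'] using this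
    filter_upwards [h1] with ω h j
    induction j with
    | zero => simp
    | succ j ih => exact ih.trans (h j)
  have key : ∀ R : ℕ, 1 ≤ R → ∀ k : ℕ,
      k * ∫⁻ ω, g ω ∂μ ≤ k * (∫⁻ ω, F ω ∂μ + M * μ (E R)) + R * M := by
    intro R hR k
    -- At a point of `E R` a block of length one is now good, because `g ≤ M`.
    set F' : Ω → ℝ≥0∞ := fun ω => F ω + (E R).indicator (fun _ => M) ω with hF'
    have hF'm : Measurable F' := hF.add (measurable_const.indicator (hEm R))
    have h1 : ∀ᵐ ω ∂μ, k * g ω ≤ (∑ j ∈ Finset.range k, F' (T^[j] ω)) + R * M := by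
      filter_upwards [hmono] with ω hω
      refine (mul_le_sum_add_of_blocks (R := R) k (fun j => F' (T^[j] ω)) ?_).trans ?_
      · intro p
        by_cases hp : T^[p] ω ∈ E R
        · refine ⟨1, le_rfl, hR, ?_⟩
          simp only [Nat.cast_one, one_mul, Finset.range_one, Finset.sum_singleton, add_zero, hF',
            Set.indicator_of_mem hp]
          exact le_add_left (hgM ω)
        · simp only [hE, Set.mem_iInter, not_forall, Set.mem_ofPred_eq, not_lt,
            Finset.mem_Icc] at hp
          obtain ⟨n, ⟨h1, h2⟩, h3⟩ := hp
          refine ⟨n, h1, h2, ?_⟩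
          calc (n : ℝ≥0∞) * g ω ≤ n * g (T^[p] ω) := by gcongr; exact hω p
            _ ≤ _ := h3
            _ ≤ _ := by
              refine Finset.sum_le_sum fun j _ => ?_
              rw [← Function.iterate_add_apply, add_comm j p]
              exact le_add_right le_rfl
      · gcongr
        exact hgM ω
    calc k * ∫⁻ ω, g ω ∂μ = ∫⁻ ω, k * g ω ∂μ := (lintegral_const_mul _ hg).symm
      _ ≤ ∫⁻ ω, ((∑ j ∈ Finset.range k, F' (T^[j] ω)) + R * M) ∂μ := lintegral_mono_ae h1
      _ = (∑ j ∈ Finset.range k, ∫⁻ ω, F' (T^[j] ω) ∂μ) + R * M := by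
          rw [lintegral_add_right _ measurable_const,
            lintegral_finsetSum (Finset.range k) (f := fun j ω => F' (T^[j] ω))
              fun j _ => hF'm.comp (hTm j)]
          simp
      _ = (∑ j ∈ Finset.range k, ∫⁻ ω, F' ω ∂μ) + R * M := by
          congr 1
          exact Finset.sum_congr rfl fun j _ => (hT.iterate j).lintegral_comp hF'm
      _ = _ := by
          rw [Finset.sum_const, Finset.card_range, nsmul_eq_mul, hF', lintegral_add_left hF,
            lintegral_indicator_const (hEm R)]
  have key2 : ∀ R : ℕ, 1 ≤ R → ∫⁻ ω, g ω ∂μ ≤ ∫⁻ ω, F ω ∂μ + M * μ (E R) := by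
    intro R hR
    have hlim2 : Tendsto (fun k : ℕ => (∫⁻ ω, F ω ∂μ + M * μ (E R)) + (R * M) / (k : ℝ≥0∞)) atTop
        (nhds ((∫⁻ ω, F ω ∂μ + M * μ (E R)) + 0)) := by
      refine tendsto_const_nhds.add ?_
      exact ENNReal.Tendsto.const_div ENNReal.tendsto_nat_nhds_top
        (Or.inr (ENNReal.mul_ne_top (ENNReal.natCast_ne_top R) hM)) |>.trans (by simp)
    rw [add_zero] at hlim2
    refine ge_of_tendsto hlim2 ?_
    filter_upwards [eventually_ge_atTop 1] with k hk
    have hk0 : (k : ℝ≥0∞) ≠ 0 := by exact_mod_cast (by omega : k ≠ 0)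
    have hkt : (k : ℝ≥0∞) ≠ ⊤ := ENNReal.natCast_ne_top k
    have := key R hR k
    rw [← ENNReal.mul_le_mul_iff_right hk0 hkt, mul_add, ENNReal.mul_div_cancel hk0 hkt]
    exact this
  have hlim3 : Tendsto (fun R => ∫⁻ ω, F ω ∂μ + M * μ (E R)) atTop
      (nhds (∫⁻ ω, F ω ∂μ + M * 0)) :=
    tendsto_const_nhds.add (ENNReal.Tendsto.const_mul hlim (Or.inr hM))
  rw [mul_zero, add_zero] at hlim3
  refine ge_of_tendsto hlim3 ?_
  filter_upwards [eventually_ge_atTop 1] with R hR using key2 R hR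

/-- The upper limits of the Birkhoff averages of a nonnegative function integrate to at most the
integral of the function. -/
theorem lintegral_limsup_birkhoff_le (hT : MeasurePreserving T μ μ) (hF : Measurable F) :
    ∫⁻ ω, limsup (fun k : ℕ => (∑ j ∈ Finset.range k, F (T^[j] ω)) / k) atTop ∂μ ≤
      ∫⁻ ω, F ω ∂μ := by
  by_cases hfin : ∫⁻ ω, F ω ∂μ = ⊤
  · rw [hfin]; exact le_top
  set f : Ω → ℝ≥0∞ := fun ω => limsup (fun k : ℕ => (∑ j ∈ Finset.range k, F (T^[j] ω)) / k) atTop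
    with hf
  have hTm : ∀ j, Measurable (T^[j]) := fun j => hT.measurable.iterate j
  have hfm : Measurable f := by
    refine Measurable.limsup fun k => ?_
    exact (Finset.measurable_sum _ fun j _ => hF.comp (hTm j)).div_const _
  -- Dropping the first term of the Birkhoff sum changes the average by `F ω / k`, which tends to
  -- `0` only where `F` is finite; hence the restriction to almost all points.
  have hinv : ∀ᵐ ω ∂μ, f ω ≤ f (T ω) := by
    filter_upwards [ae_lt_top hF hfin] with ω hω
    calc f ω = limsup (fun k : ℕ => (∑ j ∈ Finset.range (k + 1), F (T^[j] ω)) / ((k + 1 : ℕ) : ℝ≥0∞))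
          atTop := (limsup_nat_add (fun k : ℕ => (∑ j ∈ Finset.range k, F (T^[j] ω)) / (k : ℝ≥0∞)) 1).symm
      _ ≤ limsup (fun k : ℕ => F ω / (k : ℝ≥0∞) +
            (∑ j ∈ Finset.range k, F (T^[j] (T ω))) / (k : ℝ≥0∞)) atTop := by
          refine limsup_le_limsup (Eventually.of_forall fun k => ?_)
          beta_reduce
          rw [Finset.sum_range_succ', ← ENNReal.add_div, add_comm]
          simp only [Function.iterate_succ_apply, Function.iterate_zero, id_eq]
          gcongr
          simp
      _ = f (T ω) := by
          refine ENNReal.limsup_add_of_left_tendsto_zero ?_ _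
          exact (ENNReal.Tendsto.const_div ENNReal.tendsto_nat_nhds_top (Or.inr hω.ne)).trans
            (by simp)
  -- The cut at `M` gives the boundedness, and subtracting `δ` makes the value strictly smaller than
  -- the upper limit, so that some average exceeds it. Both modifications disappear in the limit.
  have hstep : ∀ (M : ℕ) (δ : NNReal), 0 < δ →
      ∫⁻ ω, min (f ω) M ∂μ ≤ ∫⁻ ω, F ω ∂μ + δ := by
    intro M δ hδ
    have hgm : Measurable fun ω => min (f ω) (M : ℝ≥0∞) - δ :=
      (hfm.min measurable_const).sub measurable_const
    have h1 := lintegral_le_of_le_birkhoffSum hT hF hgm (M := M) (ENNReal.natCast_ne_top M)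
      (fun ω => tsub_le_self.trans (min_le_right _ _))
      (by
        filter_upwards [hinv] with ω h
        gcongr)
      (by
        intro ω
        by_cases h0 : min (f ω) (M : ℝ≥0∞) = 0
        · exact ⟨1, le_rfl, by simp [h0]⟩
        · have hlt : min (f ω) (M : ℝ≥0∞) - δ < f ω := by
            refine (ENNReal.sub_lt_self ?_ h0 ?_).trans_le (min_le_left _ _)
            · exact (min_le_right _ _).trans_lt (ENNReal.natCast_lt_top M) |>.ne
            · exact_mod_cast hδ.ne'
          have hfr := frequently_lt_of_lt_limsup (by isBoundedDefault) hlt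
          obtain ⟨n, hn, hn1⟩ := (hfr.and_eventually (eventually_ge_atTop 1)).exists
          refine ⟨n, hn1, ?_⟩
          have hn0 : (n : ℝ≥0∞) ≠ 0 := by exact_mod_cast (by omega : n ≠ 0)
          rw [mul_comm]
          exact (ENNReal.le_div_iff_mul_le (Or.inl hn0) (Or.inl (ENNReal.natCast_ne_top n))).1 hn.le)
    calc ∫⁻ ω, min (f ω) M ∂μ ≤ ∫⁻ ω, ((min (f ω) M - δ) + δ) ∂μ :=
          lintegral_mono fun ω => le_tsub_add
      _ = ∫⁻ ω, (min (f ω) M - δ) ∂μ + δ := by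
          rw [lintegral_add_right _ measurable_const]; simp
      _ ≤ _ := by gcongr
  have hM : ∀ M : ℕ, ∫⁻ ω, min (f ω) M ∂μ ≤ ∫⁻ ω, F ω ∂μ := fun M =>
    ENNReal.le_of_forall_pos_le_add fun δ hδ _ => hstep M δ hδ
  have hsup : ∀ ω, f ω = ⨆ M : ℕ, min (f ω) (M : ℝ≥0∞) := by
    intro ω
    rw [← inf_iSup_eq, ENNReal.iSup_natCast, inf_top_eq]
  calc ∫⁻ ω, f ω ∂μ = ∫⁻ ω, ⨆ M : ℕ, min (f ω) (M : ℝ≥0∞) ∂μ := lintegral_congr hsup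
    _ = ⨆ M : ℕ, ∫⁻ ω, min (f ω) (M : ℝ≥0∞) ∂μ :=
        lintegral_iSup (fun M => hfm.min measurable_const) (fun a b h ω => by
          dsimp only
          gcongr)
    _ ≤ _ := iSup_le hM

end Ergodic

/-! ## Averages along blocks -/

lemma sum_range_mul_eq {M : Type*} [AddCommMonoid M] (y : ℕ → M) (k L : ℕ) :
    ∑ t ∈ Finset.range (k * L), y t =
      ∑ j ∈ Finset.range k, ∑ r ∈ Finset.range L, y (j * L + r) := by
  induction k with
  | zero => simp
  | succ k ih => rw [Nat.succ_mul, Finset.sum_range_add, ih, Finset.sum_range_succ]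

/-- The first `n` slots are covered by `n / L + 1` blocks, and this number divided by `n` is at most
`1 / L + 1 / n`. -/
lemma limsup_average_le_block (y : ℕ → ℝ≥0∞) {L : ℕ} (hL : 1 ≤ L) :
    limsup (fun n : ℕ => (∑ t ∈ Finset.range n, y t) / n) atTop ≤
      limsup (fun k : ℕ => (∑ j ∈ Finset.range k, ∑ r ∈ Finset.range L, y (j * L + r)) / k)
        atTop / L := by
  set B : ℕ → ℝ≥0∞ := fun k =>
    (∑ j ∈ Finset.range k, ∑ r ∈ Finset.range L, y (j * L + r)) / k with hB
  have hL0 : (L : ℝ≥0∞) ≠ 0 := by exact_mod_cast (by omega : L ≠ 0)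
  have hLt : (L : ℝ≥0∞) ≠ ⊤ := ENNReal.natCast_ne_top L
  have hbound : ∀ n : ℕ, 1 ≤ n → (∑ t ∈ Finset.range n, y t) / n ≤
      B (n / L + 1) * (1 / L + 1 / n) := by
    intro n hn
    have hn0 : (n : ℝ≥0∞) ≠ 0 := by exact_mod_cast (by omega : n ≠ 0)
    have h1 : ∑ t ∈ Finset.range n, y t ≤ B (n / L + 1) * ((n / L + 1 : ℕ) : ℝ≥0∞) := by
      rw [hB]
      dsimp only
      rw [ENNReal.div_mul_cancel (by simp) (ENNReal.natCast_ne_top _), ← sum_range_mul_eq]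
      refine Finset.sum_le_sum_of_subset (Finset.range_mono ?_)
      have := Nat.lt_div_mul_add (a := n) (b := L) (by omega)
      rw [Nat.succ_mul]; omega
    have h2 : ((n / L + 1 : ℕ) : ℝ≥0∞) / n ≤ 1 / L + 1 / n := by
      rw [Nat.cast_add, ENNReal.add_div, Nat.cast_one]
      refine add_le_add_left ?_ _
      rw [ENNReal.div_le_iff hn0 (ENNReal.natCast_ne_top n), one_div, mul_comm, ← div_eq_mul_inv,
        ENNReal.le_div_iff_mul_le (Or.inl hL0) (Or.inl hLt)]
      exact_mod_cast Nat.div_mul_le_self n L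
    calc (∑ t ∈ Finset.range n, y t) / n ≤ B (n / L + 1) * ((n / L + 1 : ℕ) : ℝ≥0∞) / n := by
          gcongr
      _ = B (n / L + 1) * (((n / L + 1 : ℕ) : ℝ≥0∞) / n) := by rw [mul_div_assoc]
      _ ≤ _ := by gcongr
  refine le_of_forall_gt fun c hc => ?_
  obtain ⟨c', hc1, hc2⟩ := exists_between hc
  have hlt : limsup B atTop < c' * L := by
    rwa [ENNReal.div_lt_iff (Or.inl hL0) (Or.inl hLt)] at hc1
  have hev : ∀ᶠ k in atTop, B k < c' * L := eventually_lt_of_limsup_lt hlt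
  have hdiv : Tendsto (fun n : ℕ => n / L + 1) atTop atTop :=
    (tendsto_add_atTop_nat 1).comp (Nat.tendsto_div_const_atTop (by omega : L ≠ 0))
  have hc't : c' ≠ ⊤ := (hc2.trans_le le_top).ne
  have hle : ∀ᶠ n : ℕ in atTop, (∑ t ∈ Finset.range n, y t) / n ≤ c' * L * (1 / L + 1 / n) := by
    filter_upwards [hdiv.eventually hev, eventually_ge_atTop 1] with n h1 h2
    exact (hbound n h2).trans (by gcongr)
  have hlim : Tendsto (fun n : ℕ => c' * L * (1 / L + 1 / (n : ℝ≥0∞))) atTop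
      (nhds (c' * L * (1 / L + 0))) := by
    refine ENNReal.Tendsto.const_mul (tendsto_const_nhds.add ?_)
      (Or.inr (ENNReal.mul_ne_top hc't hLt))
    simpa using ENNReal.tendsto_inv_nat_nhds_zero
  have heq : c' * L * (1 / L + 0) = c' := by
    rw [add_zero, mul_assoc, ENNReal.mul_div_cancel hL0 hLt, mul_one]
  rw [heq] at hlim
  exact ((limsup_le_limsup hle).trans_eq hlim.limsup_eq).trans_lt hc2

lemma limsup_average_le_of_periodic (y : ℕ → ℝ≥0∞) {L : ℕ} (hL : 1 ≤ L)
    (hy : ∀ t, y (t + L) = y t) :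
    limsup (fun n : ℕ => (∑ t ∈ Finset.range n, y t) / n) atTop ≤
      (∑ t ∈ Finset.range L, y t) / L := by
  refine (limsup_average_le_block y hL).trans ?_
  gcongr
  have hper : ∀ j r, y (j * L + r) = y r := by
    intro j r
    induction j with
    | zero => simp
    | succ j ih => rw [Nat.succ_mul, add_right_comm, hy, ih]
  refine limsup_le_of_le (h := ?_)
  filter_upwards with k
  simp only [hper, Finset.sum_const, Finset.card_range, nsmul_eq_mul]
  exact ENNReal.div_le_of_le_mul' le_rfl

/-- The form in which the ergodic inequality is used: `y` need not be stationary, it suffices that a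
time shift by one period `L` acts as a measure preserving map. The Birkhoff sums are those of a
whole period. Ergodicity is not needed for an upper bound of the expectation. -/
theorem lintegral_limsup_average_le {Ω : Type*} [MeasurableSpace Ω] {μ : Measure Ω}
    [IsProbabilityMeasure μ] {T : Ω → Ω} (hT : MeasurePreserving T μ μ) {L : ℕ} (hL : 1 ≤ L)
    (y : ℕ → Ω → ℝ≥0∞) (hy : ∀ t, Measurable (y t)) (hyT : ∀ t ω, y (t + L) ω = y t (T ω)) :
    ∫⁻ ω, limsup (fun n : ℕ => (∑ t ∈ Finset.range n, y t ω) / n) atTop ∂μ ≤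
      (∑ t ∈ Finset.range L, ∫⁻ ω, y t ω ∂μ) / L := by
  have hper : ∀ j r ω, y (j * L + r) ω = y r (T^[j] ω) := by
    intro j r
    induction j with
    | zero => simp
    | succ j ih =>
      intro ω
      rw [Nat.succ_mul, add_right_comm, hyT, ih, Function.iterate_succ_apply]
  have hm : Measurable fun ω => ∑ r ∈ Finset.range L, y r ω :=
    Finset.measurable_sum _ fun r _ => hy r
  calc _ ≤ ∫⁻ ω, limsup (fun k : ℕ => (∑ j ∈ Finset.range k,
        ∑ r ∈ Finset.range L, y r (T^[j] ω)) / k) atTop / L ∂μ := by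
        refine lintegral_mono fun ω => ?_
        simpa only [hper] using limsup_average_le_block (fun t => y t ω) hL
    _ = (∫⁻ ω, limsup (fun k : ℕ => (∑ j ∈ Finset.range k,
        ∑ r ∈ Finset.range L, y r (T^[j] ω)) / k) atTop ∂μ) / L := by
        simp only [div_eq_mul_inv _ (L : ℝ≥0∞)]
        rw [lintegral_mul_const']
        exact ENNReal.inv_ne_top.2 (by exact_mod_cast (by omega : L ≠ 0))
    _ ≤ (∫⁻ ω, ∑ r ∈ Finset.range L, y r ω ∂μ) / L := by
        exact ENNReal.div_le_div_right (lintegral_limsup_birkhoff_le hT hm) _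
    _ = _ := by rw [lintegral_finsetSum _ fun r _ => hy r]

/-! ## Choosing few points with a good average -/

/-- From finitely many points `(d i, f i)` of the plane, `Z` points can be chosen whose average is
no larger in the second coordinate and almost no larger in the first. -/
lemma exists_selection {ι : Type*} (I : Finset ι) (hI : I.Nonempty) (d f : ι → ℝ) {M : ℝ}
    (hd0 : ∀ i ∈ I, 0 ≤ d i) (hdM : ∀ i ∈ I, d i ≤ M) (Z : ℕ) :
    ∃ u : ℕ → ι, (∀ j, u j ∈ I) ∧
      ∑ j ∈ Finset.range Z, f (u j) ≤ Z * ((∑ i ∈ I, f i) / I.card) ∧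
      ∑ j ∈ Finset.range Z, d (u j) ≤ Z * ((∑ i ∈ I, d i) / I.card) + M := by
  classical
  have hcard : (0 : ℝ) < I.card := by exact_mod_cast hI.card_pos
  set fa := (∑ i ∈ I, f i) / I.card with hfa
  set da := (∑ i ∈ I, d i) / I.card with hda
  have hM : 0 ≤ M := by
    obtain ⟨i, hi⟩ := hI
    exact (hd0 i hi).trans (hdM i hi)
  have hf0 : ∑ i ∈ I, (f i - fa) = 0 := by
    rw [Finset.sum_sub_distrib, Finset.sum_const, nsmul_eq_mul, hfa]; field_simp; ring
  have hdd0 : ∑ i ∈ I, (d i - da) = 0 := by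
    rw [Finset.sum_sub_distrib, Finset.sum_const, nsmul_eq_mul, hda]; field_simp; ring
  by_cases hlow : ∃ i ∈ I, d i ≤ da ∧ f i ≤ fa
  · obtain ⟨i, hi, h1, h2⟩ := hlow
    refine ⟨fun _ => i, fun _ => hi, ?_, ?_⟩
    · simp only [Finset.sum_const, Finset.card_range, nsmul_eq_mul]; gcongr
    · simp only [Finset.sum_const, Finset.card_range, nsmul_eq_mul]
      have : (Z : ℝ) * d i ≤ Z * da := by gcongr
      linarith
  push Not at hlow
  set Lo := I.filter fun i => d i ≤ da with hLo
  set Hi := I.filter fun i => ¬ d i ≤ da with hHi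
  have hsf : ∑ i ∈ Lo, (f i - fa) + ∑ i ∈ Hi, (f i - fa) = 0 := by
    rw [hLo, hHi, Finset.sum_filter_add_sum_filter_not, hf0]
  have hsd : ∑ i ∈ Lo, (d i - da) + ∑ i ∈ Hi, (d i - da) = 0 := by
    rw [hLo, hHi, Finset.sum_filter_add_sum_filter_not, hdd0]
  -- The determinants of all pairs of a low and a high point, relative to the mean, sum up to zero.
  -- So for some pair the connecting segment passes through or below the mean point.
  obtain ⟨l, hl, k, hk, hlk⟩ : ∃ l ∈ Lo, ∃ k ∈ Hi,
      (f l - fa) * (d k - da) - (f k - fa) * (d l - da) ≤ 0 := by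
    by_contra hcon
    push Not at hcon
    have hLne : Lo.Nonempty := by
      by_contra h
      rw [Finset.not_nonempty_iff_eq_empty] at h
      rw [h, Finset.sum_empty, zero_add] at hsd
      have hHI : Hi = I := by
        have h2 := Finset.filter_union_filter_not_eq (s := I) (fun i => d i ≤ da)
        rw [← hLo, ← hHi, h, Finset.empty_union] at h2
        exact h2
      have : 0 < ∑ i ∈ Hi, (d i - da) := Finset.sum_pos (fun i hi => by
        have := (Finset.mem_filter.1 hi).2
        push Not at this; linarith) (hHI ▸ hI)
      linarith
    have hHne : Hi.Nonempty := by
      by_contra h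
      rw [Finset.not_nonempty_iff_eq_empty] at h
      rw [h, Finset.sum_empty, add_zero] at hsf
      have : 0 < ∑ i ∈ Lo, (f i - fa) := Finset.sum_pos (fun i hi => by
        have := Finset.mem_filter.1 hi
        linarith [hlow i this.1 this.2]) hLne
      linarith
    have hpos : 0 < ∑ l ∈ Lo, ∑ k ∈ Hi, ((f l - fa) * (d k - da) - (f k - fa) * (d l - da)) :=
      Finset.sum_pos (fun l hl => Finset.sum_pos (fun k hk => hcon l hl k hk) hHne) hLne
    have hzero : ∑ l ∈ Lo, ∑ k ∈ Hi, ((f l - fa) * (d k - da) - (f k - fa) * (d l - da)) =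
        (∑ l ∈ Lo, (f l - fa)) * (∑ k ∈ Hi, (d k - da)) -
          (∑ k ∈ Hi, (f k - fa)) * (∑ l ∈ Lo, (d l - da)) := by
      rw [Finset.sum_mul_sum, mul_comm (∑ k ∈ Hi, (f k - fa)), Finset.sum_mul_sum,
        ← Finset.sum_sub_distrib]
      refine Finset.sum_congr rfl fun l _ => ?_
      rw [← Finset.sum_sub_distrib]
      exact Finset.sum_congr rfl fun k _ => by ring
    have e1 : ∑ k ∈ Hi, (f k - fa) = -∑ l ∈ Lo, (f l - fa) := by linarith
    have e2 : ∑ l ∈ Lo, (d l - da) = -∑ k ∈ Hi, (d k - da) := by linarith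
    rw [hzero, e1, e2] at hpos
    nlinarith
  obtain ⟨hlI, hld⟩ := Finset.mem_filter.1 hl
  obtain ⟨hkI, hkd⟩ := Finset.mem_filter.1 hk
  push Not at hkd
  have hlf : fa < f l := hlow l hlI hld
  have hden : 0 < d k - d l := by linarith
  set lam := (d k - da) / (d k - d l) with hlam
  have hlam0 : 0 ≤ lam := div_nonneg (by linarith) hden.le
  have hlam1 : lam ≤ 1 := (div_le_one hden).2 (by linarith)
  have hlamd : lam * (d k - d l) = d k - da := by rw [hlam]; field_simp
  have hkf : f k ≤ fa := by
    by_contra h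
    push Not at h
    nlinarith [mul_pos (sub_pos.2 hlf) (sub_pos.2 hkd)]
  have hmix : lam * (f l - fa) + (1 - lam) * (f k - fa) ≤ 0 := by
    have : (lam * (f l - fa) + (1 - lam) * (f k - fa)) * (d k - d l) ≤ 0 := by
      have e : (lam * (f l - fa) + (1 - lam) * (f k - fa)) * (d k - d l) =
          (lam * (d k - d l)) * (f l - fa) +
            ((d k - d l) - lam * (d k - d l)) * (f k - fa) := by ring
      rw [e, hlamd]; nlinarith
    by_contra h
    push Not at h
    nlinarith
  -- Rounding `lam * Z` down favours the high point `k`. This can only lower the sum of `f`, as `f k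
  -- ≤ fa < f l`, and it raises the sum of `d` by at most `d k - d l ≤ M`.
  set x := ⌊lam * Z⌋₊ with hx
  have hx1 : (x : ℝ) ≤ lam * Z := Nat.floor_le (by positivity)
  have hx2 : lam * Z < x + 1 := Nat.lt_floor_add_one _
  have hxZ : x ≤ Z := by
    have : (x : ℝ) ≤ Z := hx1.trans (by nlinarith [(Nat.cast_nonneg Z : (0 : ℝ) ≤ Z)])
    exact_mod_cast this
  have hsum : ∀ g : ι → ℝ, ∑ j ∈ Finset.range Z, g (if j < x then l else k) =
      x * g l + (Z - x) * g k := by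
    intro g
    have hZ : Z = x + (Z - x) := by omega
    rw [hZ, Finset.sum_range_add, Finset.sum_congr rfl (g := fun _ => g l), Finset.sum_congr rfl
      (g := fun _ => g k) (s₁ := Finset.range (Z - x))]
    · simp only [Finset.sum_const, Finset.card_range, nsmul_eq_mul]
      rw [← hZ, Nat.cast_sub hxZ]
    · intro j _; simp
    · intro j hj; simp [Finset.mem_range.1 hj]
  refine ⟨fun j => if j < x then l else k, fun j => by beta_reduce; split_ifs <;> assumption, ?_, ?_⟩
  · rw [hsum f]
    have hZ0 : (0 : ℝ) ≤ Z := Nat.cast_nonneg Z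
    nlinarith [mul_le_mul_of_nonneg_left hmix hZ0,
      mul_nonneg (sub_nonneg.2 hx1) (by linarith : (0 : ℝ) ≤ f l - f k)]
  · rw [hsum d]
    have h1 := hdM k hkI
    have h2 := hd0 l hlI
    nlinarith [mul_nonneg (by linarith : (0 : ℝ) ≤ x + 1 - lam * Z) hden.le]

/-! ## Waiting for the `j`-th event -/

/-- The time to wait, from the slot `t` on, until `j` events have occurred, where `c s` is the
number of the events in the slot `s`. -/
def countWait (c : ℕ → ℕ) (j t : ℕ) : ℝ≥0∞ :=
  ⨅ (y : ℕ) (_ : j + ∑ s ∈ Finset.range (t + 1), c s ≤ ∑ s ∈ Finset.range (y + 1), c s),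
    ((y - t : ℕ) : ℝ≥0∞)

section CountWait

variable {c : ℕ → ℕ} {j t : ℕ}

lemma prefix_mono (c : ℕ → ℕ) : Monotone fun n => ∑ s ∈ Finset.range n, c s :=
  fun _ _ h => Finset.sum_le_sum_of_subset (Finset.range_mono h)

lemma lt_of_prefix_le {y : ℕ} (hj : 1 ≤ j)
    (h : j + ∑ s ∈ Finset.range (t + 1), c s ≤ ∑ s ∈ Finset.range (y + 1), c s) : t < y := by
  by_contra hcon
  have := prefix_mono c (by omega : y + 1 ≤ t + 1)
  dsimp only at this
  omega

lemma countWait_le {y : ℕ}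
    (h : j + ∑ s ∈ Finset.range (t + 1), c s ≤ ∑ s ∈ Finset.range (y + 1), c s) :
    countWait c j t ≤ ((y - t : ℕ) : ℝ≥0∞) := iInf₂_le y h

lemma exists_countWait_eq (h : countWait c j t ≠ ⊤) :
    ∃ y, j + ∑ s ∈ Finset.range (t + 1), c s ≤ ∑ s ∈ Finset.range (y + 1), c s ∧
      countWait c j t = ((y - t : ℕ) : ℝ≥0∞) := by
  classical
  have hex : ∃ y, j + ∑ s ∈ Finset.range (t + 1), c s ≤ ∑ s ∈ Finset.range (y + 1), c s := by
    by_contra hcon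
    push Not at hcon
    refine h ?_
    rw [countWait, iInf₂_eq_top]
    intro y hy
    exact absurd hy (not_le.2 (hcon y))
  refine ⟨Nat.find hex, Nat.find_spec hex, le_antisymm (countWait_le (Nat.find_spec hex)) ?_⟩
  refine le_iInf₂ fun y hy => ?_
  have := Nat.find_min' hex hy
  exact_mod_cast Nat.sub_le_sub_right this t

lemma sum_range_shift (c : ℕ → ℕ) (L n : ℕ) :
    ∑ s ∈ Finset.range (n + L), c s =
      ∑ s ∈ Finset.range L, c s + ∑ s ∈ Finset.range n, c (s + L) := by
  rw [add_comm n L, Finset.sum_range_add]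
  simp only [add_comm L]

lemma countWait_shift (hj : 1 ≤ j) (L : ℕ) :
    countWait c j (t + L) = countWait (fun s => c (s + L)) j t := by
  refine le_antisymm ?_ ?_
  · refine le_iInf₂ fun y hy => ?_
    refine (countWait_le (y := y + L) ?_).trans ?_
    · rw [add_right_comm t, add_right_comm y, sum_range_shift c L (t + 1),
        sum_range_shift c L (y + 1)]
      dsimp only at hy
      omega
    · rw [Nat.add_sub_add_right]
  · refine le_iInf₂ fun y hy => ?_
    have hlt := lt_of_prefix_le hj hy
    obtain ⟨z, rfl⟩ : ∃ z, y = z + L := ⟨y - L, by omega⟩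
    refine (countWait_le (y := z) ?_).trans ?_
    · rw [add_right_comm t, add_right_comm z, sum_range_shift c L (t + 1),
        sum_range_shift c L (z + 1)] at hy
      omega
    · rw [Nat.add_sub_add_right]

/-- Cuts time into chunks of `P` slots: the wait is at most `P` times the number of chunk starts at
which the `j`-th event has not yet occurred. If it never occurs, both sides are infinite. This
reduces waiting times to tail events of counts. -/
lemma countWait_le_tsum {P : ℕ} (hP : 1 ≤ P) :
    countWait c j t ≤ P * ∑' κ : ℕ,
      if ∑ s ∈ Finset.range (t + κ * P + 1), c s < j + ∑ s ∈ Finset.range (t + 1), c s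
        then (1 : ℝ≥0∞) else 0 := by
  classical
  by_cases hex : ∃ κ : ℕ, j + ∑ s ∈ Finset.range (t + 1), c s ≤
      ∑ s ∈ Finset.range (t + κ * P + 1), c s
  · refine (countWait_le (Nat.find_spec hex)).trans ?_
    rw [Nat.add_sub_cancel_left, mul_comm, Nat.cast_mul]
    gcongr
    calc ((Nat.find hex : ℕ) : ℝ≥0∞) = ∑ κ ∈ Finset.range (Nat.find hex), 1 := by simp
      _ ≤ ∑ κ ∈ Finset.range (Nat.find hex), (if ∑ s ∈ Finset.range (t + κ * P + 1), c s <
            j + ∑ s ∈ Finset.range (t + 1), c s then (1 : ℝ≥0∞) else 0) := by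
          refine Finset.sum_le_sum fun κ hκ => ?_
          rw [if_pos (not_le.1 (Nat.find_min hex (Finset.mem_range.1 hκ)))]
      _ ≤ _ := ENNReal.sum_le_tsum _
  · push Not at hex
    simp only [hex, if_true]
    rw [ENNReal.tsum_const_eq_top_of_ne_zero one_ne_zero,
      ENNReal.mul_top (by exact_mod_cast (by omega : P ≠ 0))]
    exact le_top

lemma measurable_countWait {Ω : Type*} [MeasurableSpace Ω] {c : Ω → ℕ → ℕ}
    (hc : ∀ s, Measurable fun ω => c ω s) (j t : ℕ) :
    Measurable fun ω => countWait (c ω) j t := by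
  classical
  refine Measurable.iInf fun y => ?_
  have hset : MeasurableSet {ω | j + ∑ s ∈ Finset.range (t + 1), c ω s ≤
      ∑ s ∈ Finset.range (y + 1), c ω s} :=
    measurableSet_le ((Finset.measurable_sum _ fun s _ => hc s).const_add j)
      (Finset.measurable_sum _ fun s _ => hc s)
  have : (fun ω => ⨅ (_ : j + ∑ s ∈ Finset.range (t + 1), c ω s ≤
      ∑ s ∈ Finset.range (y + 1), c ω s), ((y - t : ℕ) : ℝ≥0∞)) =
      fun ω => if ω ∈ {ω | j + ∑ s ∈ Finset.range (t + 1), c ω s ≤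
        ∑ s ∈ Finset.range (y + 1), c ω s} then ((y - t : ℕ) : ℝ≥0∞) else ⊤ := by
    funext ω
    split_ifs with h
    · exact iInf_pos h
    · exact iInf_neg h
  rw [this]
  exact Measurable.ite hset measurable_const measurable_const

end CountWait

/-! ## Insertion of slots -/

/-- The number of original slots among the first `s` slots, after the insertion of new slots at the
times `x, x + N, x + 2 N, …`. -/
def origIndex (N x s : ℕ) : ℕ := s - (s - x + N - 1) / N

/-- The time of the original slot `v` after the insertion of new slots at the times
`x, x + N, x + 2 N, …`. -/
def newTime (N x v : ℕ) : ℕ := v + (v + (N - 1) - x) / (N - 1)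

/-- The numbers of events per slot after the insertion of slots without events. -/
def stretch (N x : ℕ) (c : ℕ → ℕ) (t : ℕ) : ℕ :=
  if x ≤ t ∧ N ∣ t - x then 0 else c (origIndex N x t)

section Insert

variable {N x : ℕ}

lemma origIndex_of_le {s : ℕ} (hN : 1 ≤ N) (h : s ≤ x) : origIndex N x s = s := by
  rw [origIndex, Nat.sub_eq_zero_of_le h, Nat.div_eq_of_lt (by omega), Nat.sub_zero]

lemma origIndex_add {k r : ℕ} (hN : 1 ≤ N) (h1 : 1 ≤ r) (h2 : r ≤ N) :
    origIndex N x (x + k * N + r) = x + k * (N - 1) + (r - 1) := by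
  have h3 : (x + k * N + r - x + N - 1) / N = k + 1 := by
    rw [show x + k * N + r - x + N - 1 = (r - 1) + (k + 1) * N by rw [Nat.succ_mul]; omega,
      Nat.add_mul_div_right _ _ (by omega), Nat.div_eq_of_lt (by omega), zero_add]
  have h4 : k * (N - 1) + k = k * N := by
    obtain ⟨M, rfl⟩ : ∃ M, N = M + 1 := ⟨N - 1, by omega⟩
    simp [Nat.mul_succ]
  rw [origIndex, h3]
  omega

lemma slot_cases (hN : 1 ≤ N) (s : ℕ) :
    s < x ∨ (∃ k, s = x + k * N) ∨ ∃ k r, 1 ≤ r ∧ r < N ∧ s = x + k * N + r := by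
  rcases lt_or_ge s x with h | h
  · exact Or.inl h
  · refine Or.inr ?_
    have h1 := Nat.div_add_mod' (s - x) N
    have h2 := Nat.mod_lt (s - x) (by omega : 0 < N)
    rcases Nat.eq_zero_or_pos ((s - x) % N) with h3 | h3
    · exact Or.inl ⟨(s - x) / N, by omega⟩
    · exact Or.inr ⟨(s - x) / N, (s - x) % N, h3, h2, by omega⟩

lemma inserted_add (k : ℕ) : x ≤ x + k * N ∧ N ∣ x + k * N - x :=
  ⟨by omega, by rw [Nat.add_sub_cancel_left]; exact Dvd.intro_left k rfl⟩

lemma not_inserted_of_lt {s : ℕ} (h : s < x) : ¬ (x ≤ s ∧ N ∣ s - x) := fun h' => by omega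

lemma not_inserted_add {k r : ℕ} (h1 : 1 ≤ r) (h2 : r < N) :
    ¬ (x ≤ x + k * N + r ∧ N ∣ x + k * N + r - x) := by
  rintro ⟨-, h⟩
  rw [show x + k * N + r - x = k * N + r by omega, Nat.dvd_add_right (Dvd.intro_left k rfl)] at h
  exact absurd (Nat.le_of_dvd (by omega) h) (by omega)

lemma origIndex_succ_of_inserted (hN : 1 ≤ N) {s : ℕ} (h : x ≤ s ∧ N ∣ s - x) :
    origIndex N x (s + 1) = origIndex N x s := by
  rcases slot_cases (x := x) hN s with h1 | ⟨k, rfl⟩ | ⟨k, r, h1, h2, rfl⟩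
  · omega
  · rw [origIndex_add hN le_rfl hN]
    rcases k with _ | k
    · rw [origIndex_of_le hN (by omega)]; omega
    · rw [show x + (k + 1) * N = x + k * N + N by rw [Nat.succ_mul]; omega,
        origIndex_add hN hN le_rfl, Nat.succ_mul]
      omega
  · exact absurd h (not_inserted_add h1 h2)

lemma origIndex_succ_of_not_inserted (hN : 1 ≤ N) {s : ℕ} (h : ¬ (x ≤ s ∧ N ∣ s - x)) :
    origIndex N x (s + 1) = origIndex N x s + 1 := by
  rcases slot_cases (x := x) hN s with h1 | ⟨k, rfl⟩ | ⟨k, r, h1, h2, rfl⟩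
  · rw [origIndex_of_le hN h1, origIndex_of_le hN h1.le]
  · exact absurd (inserted_add k) h
  · rw [add_assoc _ r 1, origIndex_add hN (by omega) h2, origIndex_add hN h1 h2.le]
    omega

lemma sum_stretch (hN : 1 ≤ N) (c : ℕ → ℕ) (s : ℕ) :
    ∑ t ∈ Finset.range s, stretch N x c t = ∑ t ∈ Finset.range (origIndex N x s), c t := by
  induction s with
  | zero => simp [origIndex]
  | succ s ih =>
    rw [Finset.sum_range_succ, ih, stretch]
    split_ifs with h
    · rw [origIndex_succ_of_inserted hN h, add_zero]
    · rw [origIndex_succ_of_not_inserted hN h, Finset.sum_range_succ]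

lemma origIndex_add_period (hN : 1 ≤ N) (hx : x < N) (t P : ℕ) :
    origIndex N x (t + N * P) = origIndex N x t + (N - 1) * P := by
  induction P with
  | zero => simp
  | succ P ih =>
    rw [Nat.mul_succ, Nat.mul_succ, ← add_assoc, ← add_assoc, ← ih]
    generalize t + N * P = s
    rcases slot_cases (x := x) hN s with h1 | ⟨k, rfl⟩ | ⟨k, r, h1, h2, rfl⟩
    · rw [origIndex_of_le hN h1.le]
      rw [show s + N = x + 0 * N + (s + N - x) by omega, origIndex_add hN (by omega) (by omega)]
      omega
    · rw [origIndex_add hN hN le_rfl]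
      rcases k with _ | k
      · rw [origIndex_of_le hN (by omega)]; omega
      · rw [show x + (k + 1) * N = x + k * N + N by rw [Nat.succ_mul]; omega,
          origIndex_add hN hN le_rfl, Nat.succ_mul]
        omega
    · rw [show x + k * N + r + N = x + (k + 1) * N + r by rw [Nat.succ_mul]; omega,
        origIndex_add hN h1 h2.le, origIndex_add hN h1 h2.le, Nat.succ_mul]
      omega

lemma inserted_add_period (hx : x < N) (t P : ℕ) :
    (x ≤ t + N * P ∧ N ∣ t + N * P - x) ↔ (x ≤ t ∧ N ∣ t - x) := by
  rcases slot_cases (x := x) (by omega : 1 ≤ N) t with h1 | ⟨k, rfl⟩ | ⟨k, r, h1, h2, rfl⟩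
  · refine ⟨fun h => ?_, fun h => by omega⟩
    rcases P with _ | P
    · exact absurd h (not_inserted_of_lt h1)
    · rw [show t + N * (P + 1) = x + P * N + (t + N - x) by rw [Nat.mul_succ, mul_comm]; omega] at h
      exact absurd h (not_inserted_add (by omega) (by omega))
  · rw [show x + k * N + N * P = x + (k + P) * N by ring]
    exact ⟨fun _ => inserted_add k, fun _ => inserted_add _⟩
  · rw [show x + k * N + r + N * P = x + (k + P) * N + r by ring]
    exact ⟨fun h => absurd h (not_inserted_add h1 h2), fun h => absurd h (not_inserted_add h1 h2)⟩

lemma stretch_add_period (hx : x < N) (c : ℕ → ℕ) (t P : ℕ) :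
    stretch N x c (t + N * P) = stretch N x (fun s => c (s + (N - 1) * P)) t := by
  rw [stretch, stretch, origIndex_add_period (by omega) hx, if_congr (inserted_add_period hx t P) rfl rfl]

lemma newTime_cases (hx : x < N - 1) (v : ℕ) :
    (v < x ∧ newTime N x v = v) ∨
      ∃ k r, r < N - 1 ∧ v = x + k * (N - 1) + r ∧ newTime N x v = x + k * N + (r + 1) := by
  have hM : 0 < N - 1 := by omega
  rcases slot_cases (x := x) (N := N - 1) hM v with h | ⟨k, rfl⟩ | ⟨k, r, h1, h2, rfl⟩
  · refine Or.inl ⟨h, ?_⟩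
    rw [newTime, Nat.div_eq_of_lt (by omega), add_zero]
  · refine Or.inr ⟨k, 0, hM, rfl, ?_⟩
    rw [newTime, show x + k * (N - 1) + (N - 1) - x = (k + 1) * (N - 1) by rw [Nat.succ_mul]; omega,
      Nat.mul_div_cancel _ hM]
    obtain ⟨M, rfl⟩ : ∃ M, N = M + 1 := ⟨N - 1, by omega⟩
    simp only [Nat.add_sub_cancel]; ring
  · refine Or.inr ⟨k, r, h2, rfl, ?_⟩
    rw [newTime, show x + k * (N - 1) + r + (N - 1) - x = r + (k + 1) * (N - 1) by
        rw [Nat.succ_mul]; omega,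
      Nat.add_mul_div_right _ _ hM, Nat.div_eq_of_lt h2]
    obtain ⟨M, rfl⟩ : ∃ M, N = M + 1 := ⟨N - 1, by omega⟩
    simp only [Nat.add_sub_cancel]; ring

lemma not_inserted_newTime (hx : x < N - 1) (v : ℕ) :
    ¬ (x ≤ newTime N x v ∧ N ∣ newTime N x v - x) := by
  rcases newTime_cases hx v with ⟨h1, h2⟩ | ⟨k, r, h1, h2, h3⟩
  · rw [h2]; exact not_inserted_of_lt h1
  · rw [h3]; exact not_inserted_add (by omega) (by omega)

lemma origIndex_newTime (hx : x < N - 1) (v : ℕ) : origIndex N x (newTime N x v) = v := by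
  rcases newTime_cases hx v with ⟨h1, h2⟩ | ⟨k, r, h1, h2, h3⟩
  · rw [h2]; exact origIndex_of_le (by omega) h1.le
  · rw [h3, origIndex_add (by omega) (by omega) (by omega), h2]; omega

lemma origIndex_newTime_succ (hx : x < N - 1) (v : ℕ) :
    origIndex N x (newTime N x v + 1) = v + 1 := by
  rw [origIndex_succ_of_not_inserted (by omega) (not_inserted_newTime hx v), origIndex_newTime hx]

lemma origIndex_inserted (hx : x < N - 1) (k : ℕ) :
    origIndex N x (x + k * N) = x + k * (N - 1) := by
  rw [← origIndex_succ_of_inserted (by omega) (inserted_add k),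
    origIndex_add (by omega) le_rfl (by omega)]
  omega

lemma newTime_mono : Monotone (newTime N x) := fun a b h =>
  Nat.add_le_add h (Nat.div_le_div_right (by omega))

lemma newTime_sub_le {u y : ℕ} (hN : 2 ≤ N) (h : u ≤ y) :
    newTime N x y - newTime N x u ≤ 2 * (y - u) := by
  have : (y + (N - 1) - x) / (N - 1) ≤ (u + (N - 1) - x) / (N - 1) + (y - u) := by
    rw [← Nat.add_mul_div_right _ _ (by omega : 0 < N - 1)]
    refine Nat.div_le_div_right ?_
    have : y - u ≤ (y - u) * (N - 1) := Nat.le_mul_of_pos_right _ (by omega)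
    omega
  simp only [newTime]
  omega

lemma newTime_period (hx : x < N - 1) (P r : ℕ) :
    newTime N x (P * (N - 1) + r) = P * N + newTime N x r := by
  rw [newTime, newTime, show P * (N - 1) + r + (N - 1) - x = (r + (N - 1) - x) + P * (N - 1) by omega,
    Nat.add_mul_div_right _ _ (by omega)]
  obtain ⟨M, rfl⟩ : ∃ M, N = M + 1 := ⟨N - 1, by omega⟩
  simp only [Nat.add_sub_cancel]; ring

lemma sum_slots {α : Type*} [AddCommMonoid α] (hx : x < N - 1) (g : ℕ → α) (P : ℕ) :
    ∑ t ∈ Finset.range (P * N), g t = ∑ u ∈ Finset.range (P * (N - 1)), g (newTime N x u) +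
      ∑ k ∈ Finset.range P, g (x + k * N) := by
  have hblock : ∀ g : ℕ → α, ∑ r ∈ Finset.range N, g r =
      ∑ r ∈ Finset.range (N - 1), g (newTime N x r) + g x := by
    intro g
    rw [show N = x + (1 + (N - 1 - x)) by omega, Finset.sum_range_add, Finset.sum_range_add,
      show x + (1 + (N - 1 - x)) - 1 = x + (N - 1 - x) by omega, Finset.sum_range_add]
    rw [show x + (1 + (N - 1 - x)) = N by omega]
    have e1 : ∀ r ∈ Finset.range x, g (newTime N x r) = g r := by
      intro r hr
      rw [Finset.mem_range] at hr
      rw [newTime, Nat.div_eq_of_lt (by omega), add_zero]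
    have e2 : ∀ r ∈ Finset.range (N - 1 - x), g (newTime N x (x + r)) = g (x + (1 + r)) := by
      intro r hr
      rw [Finset.mem_range] at hr
      congr 1
      rw [newTime, show x + r + (N - 1) - x = r + 1 * (N - 1) by omega,
        Nat.add_mul_div_right _ _ (by omega), Nat.div_eq_of_lt (by omega)]
      omega
    rw [Finset.sum_congr rfl e1, Finset.sum_congr rfl e2]
    simp only [Finset.sum_range_one, add_zero]
    abel
  rw [sum_range_mul_eq, sum_range_mul_eq, ← Finset.sum_add_distrib]
  refine Finset.sum_congr rfl fun j _ => ?_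
  rw [hblock fun r => g (j * N + r)]
  simp only [newTime_period hx]
  rw [add_comm x]

/-- A special case of Hermite's identity. -/
lemma sum_add_div {M : ℕ} (hM : 1 ≤ M) (y : ℕ) : ∑ i ∈ Finset.range M, (y + i) / M = y := by
  induction y with
  | zero =>
    refine Finset.sum_eq_zero fun i hi => ?_
    rw [zero_add]
    exact Nat.div_eq_of_lt (Finset.mem_range.1 hi)
  | succ y ih =>
    have h1 := Finset.sum_range_succ (fun i => (y + i) / M) M
    have h2 := Finset.sum_range_succ' (fun i => (y + i) / M) M
    rw [h1, ih, Nat.add_div_right _ (by omega), add_zero] at h2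
    have h3 : ∀ i, (y + 1 + i) / M = (y + (i + 1)) / M := fun i => by congr 1; omega
    simp only [h3]
    omega

/-- Exact linearity in `y` is the point: by Hermite's identity the floors average out over the
offsets, so a gap `y - u` is stretched by exactly `N / (N - 1)` in the mean. -/
lemma sum_newTime (hN : 2 ≤ N) (y : ℕ) :
    ∑ x ∈ Finset.range (N - 1), newTime N x y = N * y + 1 := by
  simp only [newTime]
  rw [Finset.sum_add_distrib, Finset.sum_const, Finset.card_range, smul_eq_mul,
    ← Finset.sum_range_reflect]
  have h : ∀ i ∈ Finset.range (N - 1), (y + (N - 1) - (N - 1 - 1 - i)) / (N - 1) =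
      (y + 1 + i) / (N - 1) := by
    intro i hi
    rw [Finset.mem_range] at hi
    congr 1; omega
  rw [Finset.sum_congr rfl h, sum_add_div (by omega)]
  obtain ⟨M, rfl⟩ : ∃ M, N = M + 1 := ⟨N - 1, by omega⟩
  simp only [Nat.add_sub_cancel]; ring

lemma prefix_stretch_newTime (hx : x < N - 1) (c : ℕ → ℕ) (v : ℕ) :
    ∑ s ∈ Finset.range (newTime N x v + 1), stretch N x c s = ∑ s ∈ Finset.range (v + 1), c s := by
  rw [sum_stretch (by omega), origIndex_newTime_succ hx]

lemma sum_countWait_stretch_newTime_le (hN : 2 ≤ N) (c : ℕ → ℕ) (j u : ℕ) (hj : 1 ≤ j) :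
    ∑ x ∈ Finset.range (N - 1), countWait (stretch N x c) j (newTime N x u) ≤
      N * countWait c j u := by
  by_cases h : countWait c j u = ⊤
  · rw [h, ENNReal.mul_top (by exact_mod_cast (by omega : N ≠ 0))]; exact le_top
  · obtain ⟨y, hy, he⟩ := exists_countWait_eq h
    have hlt := lt_of_prefix_le hj hy
    calc _ ≤ ∑ x ∈ Finset.range (N - 1), ((newTime N x y - newTime N x u : ℕ) : ℝ≥0∞) := by
          refine Finset.sum_le_sum fun x hx => countWait_le ?_
          rw [Finset.mem_range] at hx
          rwa [prefix_stretch_newTime hx, prefix_stretch_newTime hx]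
      _ = N * ((y - u : ℕ) : ℝ≥0∞) := by
          rw [← Nat.cast_sum, ← Nat.cast_mul]
          congr 1
          rw [Finset.sum_tsub_distrib _ fun x _ => newTime_mono hlt.le, sum_newTime hN,
            sum_newTime hN, Nat.add_sub_add_right, Nat.mul_sub]
      _ = _ := by rw [he]

/-- A request in an inserted slot is compared with one in the next original slot `u`, which starts
one slot later; no gap more than doubles by the insertion. The crude factor is affordable because
only one slot in `N` is inserted. -/
lemma countWait_stretch_inserted_le (hx : x < N - 1) (c : ℕ → ℕ) (j k : ℕ) (hj : 1 ≤ j) :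
    countWait (stretch N x c) j (x + k * N) ≤ 2 * countWait c j (k * (N - 1) + x) + 1 := by
  set u := k * (N - 1) + x with hu
  by_cases h : countWait c j u = ⊤
  · rw [h, ENNReal.mul_top two_ne_zero]; exact le_top
  · obtain ⟨y, hy, he⟩ := exists_countWait_eq h
    have hlt := lt_of_prefix_le hj hy
    have hnew : newTime N x u = x + k * N + 1 := by
      rw [newTime, show u + (N - 1) - x = (k + 1) * (N - 1) by rw [hu, Nat.succ_mul]; omega,
        Nat.mul_div_cancel _ (by omega), hu]
      obtain ⟨M, rfl⟩ : ∃ M, N = M + 1 := ⟨N - 1, by omega⟩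
      simp only [Nat.add_sub_cancel]; ring
    have hmono : newTime N x u ≤ newTime N x y := newTime_mono hlt.le
    refine (countWait_le (y := newTime N x y) ?_).trans ?_
    · rw [prefix_stretch_newTime hx]
      refine le_trans ?_ hy
      rw [sum_stretch (by omega), origIndex_succ_of_inserted (by omega) (inserted_add k),
        origIndex_inserted hx]
      have := prefix_mono c (by omega : x + k * (N - 1) ≤ u + 1)
      dsimp only at this
      omega
    · rw [he]
      have := newTime_sub_le (x := x) (by omega : 2 ≤ N) hlt.le
      exact_mod_cast (by omega : newTime N x y - (x + k * N) ≤ 2 * (y - u) + 1)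

/-- The total waiting time over a period, summed over all positions of the inserted slots. -/
lemma sum_countWait_stretch_le (hN : 2 ≤ N) (c : ℕ → ℕ) (j P : ℕ) (hj : 1 ≤ j) :
    ∑ x ∈ Finset.range (N - 1), ∑ t ∈ Finset.range (P * N), countWait (stretch N x c) j t ≤
      ∑ u ∈ Finset.range (P * (N - 1)), ((N + 2) * countWait c j u + 1) := by
  calc _ = ∑ x ∈ Finset.range (N - 1),
        (∑ u ∈ Finset.range (P * (N - 1)), countWait (stretch N x c) j (newTime N x u) +
          ∑ k ∈ Finset.range P, countWait (stretch N x c) j (x + k * N)) :=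
        Finset.sum_congr rfl fun x hx => sum_slots (Finset.mem_range.1 hx) _ P
    _ = ∑ u ∈ Finset.range (P * (N - 1)),
          ∑ x ∈ Finset.range (N - 1), countWait (stretch N x c) j (newTime N x u) +
        ∑ k ∈ Finset.range P,
          ∑ x ∈ Finset.range (N - 1), countWait (stretch N x c) j (x + k * N) := by
        rw [Finset.sum_add_distrib, Finset.sum_comm]
        congr 1
        exact Finset.sum_comm
    _ ≤ ∑ u ∈ Finset.range (P * (N - 1)), N * countWait c j u +
        ∑ k ∈ Finset.range P,
          ∑ x ∈ Finset.range (N - 1), (2 * countWait c j (k * (N - 1) + x) + 1) := by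
        refine add_le_add (Finset.sum_le_sum fun u _ => sum_countWait_stretch_newTime_le hN c j u hj)
          (Finset.sum_le_sum fun k _ => Finset.sum_le_sum fun x hx =>
            countWait_stretch_inserted_le (Finset.mem_range.1 hx) c j k hj)
    _ = _ := by
        rw [← sum_range_mul_eq (fun u => 2 * countWait c j u + 1), ← Finset.sum_add_distrib]
        refine Finset.sum_congr rfl fun u _ => ?_
        ring

end Insert

/-! ## Costs as averages over the slots -/

section Costs

variable {W m : ℕ} {S : Schedule W m} {i : Fin m} {n t : ℕ}

lemma nextTime_le_end : nextTime S n i t ≤ n := Nat.sInf_le (Set.mem_insert _ _)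

lemma nextTime_le_of_broadcast {s : ℕ} (h : t < s) (hs : ∃ k, S s k = some i) :
    nextTime S n i t ≤ s := Nat.sInf_le (Set.mem_insert_of_mem _ ⟨h, hs⟩)

lemma nextTime_eq_end_or : nextTime S n i t = n ∨
    t < nextTime S n i t ∧ ∃ k, S (nextTime S n i t) k = some i := by
  have := Nat.sInf_mem (s := insert n {s : ℕ | t < s ∧ ∃ k, S s k = some i})
    ⟨n, Set.mem_insert _ _⟩
  simpa [nextTime] using this

lemma lt_nextTime (h : t < n) : t < nextTime S n i t := by
  rcases nextTime_eq_end_or (S := S) (n := n) (i := i) (t := t) with h1 | h1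
  · rwa [h1]
  · exact h1.1

/-- The indicator of the slots in which a message is broadcast. -/
def airs (S : Schedule W m) (i : Fin m) (s : ℕ) : ℕ :=
  open scoped Classical in if ∃ k, S s k = some i then 1 else 0

lemma nextTime_sub_le_countWait :
    ((nextTime S n i t - t : ℕ) : ℝ≥0∞) ≤ countWait (airs S i) 1 t := by
  refine le_iInf₂ fun y hy => ?_
  have hlt := lt_of_prefix_le le_rfl hy
  obtain ⟨s, hs, hs'⟩ : ∃ s, (t < s ∧ s ≤ y) ∧ ∃ k, S s k = some i := by
    by_contra hcon
    push Not at hcon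
    have h0 : ∑ s ∈ Finset.range (y + 1), airs S i s = ∑ s ∈ Finset.range (t + 1), airs S i s := by
      refine (Finset.sum_subset (Finset.range_mono (by omega)) fun s h1 h2 => ?_).symm
      rw [Finset.mem_range] at h1 h2
      rw [airs, if_neg]
      rintro ⟨k, hk⟩
      exact hcon s ⟨by omega, by omega⟩ k hk
    omega
  have := nextTime_le_of_broadcast (n := n) hs.1 hs'
  exact_mod_cast (by omega : nextTime S n i t - t ≤ y - t)

lemma countWait_airs_le {s : ℕ} (h : t < s) (hs : ∃ k, S s k = some i) :
    countWait (airs S i) 1 t ≤ ((s - t : ℕ) : ℝ≥0∞) := by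
  refine countWait_le ?_
  rw [Finset.sum_range_succ _ s, airs, if_pos hs, add_comm]
  gcongr
  omega

lemma min_countWait_le_nextTime_sub {M : ℕ} (h : t + M ≤ n) (ht : t < n) :
    min (countWait (airs S i) 1 t) M ≤ ((nextTime S n i t - t : ℕ) : ℝ≥0∞) := by
  rcases nextTime_eq_end_or (S := S) (n := n) (i := i) (t := t) with h1 | h1
  · rw [h1]
    exact (min_le_right _ _).trans (by exact_mod_cast (by omega : M ≤ n - t))
  · exact (min_le_left _ _).trans (countWait_airs_le h1.1 h1.2)

/-- Cost of the broadcasts of the messages of `X` in the slot `t`. -/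
def slotBc (c : Fin m → ℝ) (X : Finset (Fin m)) (S : Schedule W m) (t : ℕ) : ℝ≥0∞ :=
  ∑ k : Fin W, ∑ i ∈ X, if S t k = some i then ENNReal.ofReal (c i) else 0

/-- Contribution of the slot `t` to the cost of the first `n` slots, with the waiting time counted
from the beginning of the slot. -/
def slotCost (p c : Fin m → ℝ) (X : Finset (Fin m)) (S : Schedule W m) (n t : ℕ) : ℝ≥0∞ :=
  (∑ i ∈ X, ENNReal.ofReal (p i) * ((nextTime S n i t - t : ℕ) : ℝ≥0∞)) + slotBc c X S t

variable {p c : Fin m → ℝ} {X : Finset (Fin m)}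

lemma slotBc_eq_ofReal (hc : ∀ i, 0 ≤ c i) : slotBc c X S t =
    ENNReal.ofReal (∑ k : Fin W, ∑ i ∈ X, if S t k = some i then c i else 0) := by
  have h0 : ∀ (k : Fin W) (i : Fin m), 0 ≤ (if S t k = some i then c i else 0) := fun k i => by
    split_ifs; exacts [hc i, le_rfl]
  rw [ENNReal.ofReal_sum_of_nonneg fun k _ => Finset.sum_nonneg fun i _ => h0 k i, slotBc]
  refine Finset.sum_congr rfl fun k _ => ?_
  rw [ENNReal.ofReal_sum_of_nonneg fun i _ => h0 k i]
  refine Finset.sum_congr rfl fun i _ => ?_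
  split_ifs <;> simp

lemma slotCost_eq_ofReal (hp : ∀ i, 0 ≤ p i) (hc : ∀ i, 0 ≤ c i) (ht : t < n) :
    slotCost p c X S n t = ENNReal.ofReal (∑ i ∈ X, p i * ((nextTime S n i t : ℝ) - t) +
      ∑ k : Fin W, ∑ i ∈ X, if S t k = some i then c i else 0) := by
  have h1 : ∀ i, ((nextTime S n i t - t : ℕ) : ℝ) = (nextTime S n i t : ℝ) - t := fun i =>
    Nat.cast_sub (lt_nextTime ht).le
  have h2 : ∀ i, 0 ≤ p i * ((nextTime S n i t : ℝ) - t) := fun i => by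
    rw [← h1]; exact mul_nonneg (hp i) (Nat.cast_nonneg _)
  have h0 : ∀ (k : Fin W) (i : Fin m), 0 ≤ (if S t k = some i then c i else 0) := fun k i => by
    split_ifs; exacts [hc i, le_rfl]
  rw [ENNReal.ofReal_add (Finset.sum_nonneg fun i _ => h2 i)
    (Finset.sum_nonneg fun k _ => Finset.sum_nonneg fun i _ => h0 k i), slotCost,
    slotBc_eq_ofReal hc, ENNReal.ofReal_sum_of_nonneg fun i _ => h2 i]
  congr 1
  refine Finset.sum_congr rfl fun i _ => ?_
  rw [ENNReal.ofReal_mul (hp i), ← h1, ENNReal.ofReal_natCast]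

lemma ert_nonneg (hp : ∀ i, 0 ≤ p i) : 0 ≤ ert p X S n := by
  refine div_nonneg (Finset.sum_nonneg fun t ht => Finset.sum_nonneg fun i _ =>
    mul_nonneg (hp i) ?_) (Nat.cast_nonneg _)
  have : t + 1 ≤ nextTime S n i t := lt_nextTime (Finset.mem_range.1 ht)
  have : (t : ℝ) + 1 ≤ nextTime S n i t := by exact_mod_cast this
  linarith

lemma bc_nonneg (hc : ∀ i, 0 ≤ c i) : 0 ≤ bc c X S n :=
  div_nonneg (Finset.sum_nonneg fun t _ => Finset.sum_nonneg fun k _ => Finset.sum_nonneg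
    fun i _ => by split_ifs; exacts [hc i, le_rfl]) (Nat.cast_nonneg _)

lemma ofReal_ert_add_bc (hp : ∀ i, 0 ≤ p i) (hc : ∀ i, 0 ≤ c i) (hn : 1 ≤ n) :
    ENNReal.ofReal (ert p X S n + bc c X S n) + ENNReal.ofReal ((∑ i ∈ X, p i) / 2) =
      (∑ t ∈ Finset.range n, slotCost p c X S n t) / n := by
  have hn0 : (0 : ℝ) < n := by exact_mod_cast hn
  have hterm : ∀ t ∈ Finset.range n, 0 ≤ ∑ i ∈ X, p i * ((nextTime S n i t : ℝ) - t) +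
      ∑ k : Fin W, ∑ i ∈ X, if S t k = some i then c i else 0 := by
    intro t ht
    refine add_nonneg (Finset.sum_nonneg fun i _ => mul_nonneg (hp i) ?_)
      (Finset.sum_nonneg fun k _ => Finset.sum_nonneg fun i _ => by
        split_ifs; exacts [hc i, le_rfl])
    rw [sub_nonneg]
    exact_mod_cast (lt_nextTime (Finset.mem_range.1 ht)).le
  rw [← ENNReal.ofReal_add (add_nonneg (ert_nonneg hp) (bc_nonneg hc))
    (div_nonneg (Finset.sum_nonneg fun i _ => hp i) zero_le_two),
    Finset.sum_congr rfl fun t ht => slotCost_eq_ofReal hp hc (Finset.mem_range.1 ht),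
    ← ENNReal.ofReal_sum_of_nonneg hterm, ← ENNReal.ofReal_natCast n,
    ← ENNReal.ofReal_div_of_pos hn0]
  congr 1
  rw [ert, bc, Finset.sum_add_distrib]
  have h : ∑ t ∈ Finset.range n, ∑ i ∈ X, p i * ((nextTime S n i t : ℝ) - t - 1 / 2) =
      ∑ t ∈ Finset.range n, ∑ i ∈ X, p i * ((nextTime S n i t : ℝ) - t) -
        n * ((∑ i ∈ X, p i) / 2) := by
    rw [← nsmul_eq_mul, ← Finset.card_range n, ← Finset.sum_const, Finset.card_range,
      ← Finset.sum_sub_distrib]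
    refine Finset.sum_congr rfl fun t _ => ?_
    rw [Finset.sum_div, ← Finset.sum_sub_distrib]
    exact Finset.sum_congr rfl fun i _ => by ring
  rw [h]
  field_simp
  ring

/-- Counting the wait from the beginning of the slot instead of a random point in it adds half a
slot per request, and makes the waiting times natural numbers. -/
lemma cost_add_half (hp : ∀ i, 0 ≤ p i) (hc : ∀ i, 0 ≤ c i) :
    cost p c X S + ENNReal.ofReal ((∑ i ∈ X, p i) / 2) =
      limsup (fun n : ℕ => (∑ t ∈ Finset.range n, slotCost p c X S n t) / n) atTop := by
  rw [cost, ← limsup_add_const _ _ _ (by isBoundedDefault) (by isBoundedDefault)]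
  refine limsup_congr ?_
  filter_upwards [eventually_ge_atTop 1] with n hn using ofReal_ert_add_bc hp hc hn

lemma cost_add_half_le (hp : ∀ i, 0 ≤ p i) (hc : ∀ i, 0 ≤ c i) {y : ℕ → ℝ≥0∞}
    (h : ∀ n t, t < n → slotCost p c X S n t ≤ y t) :
    cost p c X S + ENNReal.ofReal ((∑ i ∈ X, p i) / 2) ≤
      limsup (fun n : ℕ => (∑ t ∈ Finset.range n, y t) / n) atTop := by
  rw [cost_add_half hp hc]
  refine limsup_le_limsup (Eventually.of_forall fun n => ?_)
  exact ENNReal.div_le_div_right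
    (Finset.sum_le_sum fun t ht => h n t (Finset.mem_range.1 ht)) _

/-- Contribution of the slot `t` to the cost of an infinite schedule, with the waiting time counted
from the beginning of the slot. -/
def slotCostInf (p c : Fin m → ℝ) (X : Finset (Fin m)) (S : Schedule W m) (t : ℕ) : ℝ≥0∞ :=
  (∑ i ∈ X, ENNReal.ofReal (p i) * countWait (airs S i) 1 t) + slotBc c X S t

/-- The truncation at time `n` could make the finite costs too small, but among `k + M + 1` periods
the requests of the first `k` are at least `M * P` slots away from the end, so their waits are at
least `min (countWait _ _ _) (M * P)`. The ratio `k / (k + M + 1)` tends to `1`, and then `M → ∞`.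
-/
lemma slotCostInf_average_le (hp : ∀ i, 0 ≤ p i) (hc : ∀ i, 0 ≤ c i) {P : ℕ} (hP : 1 ≤ P)
    (hS : ∀ t k, S (t + P) k = S t k) :
    (∑ u ∈ Finset.range P, slotCostInf p c X S u) / P ≤
      cost p c X S + ENNReal.ofReal ((∑ i ∈ X, p i) / 2) := by
  rw [cost_add_half hp hc]
  have hP0 : (P : ℝ≥0∞) ≠ 0 := by exact_mod_cast (by omega : P ≠ 0)
  have hPt : (P : ℝ≥0∞) ≠ ⊤ := ENNReal.natCast_ne_top P
  have hSk : ∀ k t, S (t + k * P) = S t := by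
    intro k t
    induction k with
    | zero => simp
    | succ k ih =>
      rw [Nat.succ_mul, ← add_assoc, ← ih]
      funext x
      exact hS _ x
  have hairs : ∀ i k, (fun s => airs S i (s + k * P)) = airs S i := by
    intro i k
    funext s
    rw [airs, airs, hSk]
  have hwait : ∀ i k t, countWait (airs S i) 1 (k * P + t) = countWait (airs S i) 1 t := by
    intro i k t
    rw [add_comm, countWait_shift le_rfl, hairs]
  have hbc : ∀ k t, slotBc c X S (k * P + t) = slotBc c X S t := by
    intro k t
    rw [add_comm, slotBc, slotBc, hSk]
  set F : ℕ → ℝ≥0∞ := fun M => ∑ u ∈ Finset.range P,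
    ((∑ i ∈ X, ENNReal.ofReal (p i) * min (countWait (airs S i) 1 u) ((M * P : ℕ) : ℝ≥0∞)) +
      slotBc c X S u) with hF
  have hFlim : Tendsto (fun M => F M / P) atTop
      (nhds ((∑ u ∈ Finset.range P, slotCostInf p c X S u) / P)) := by
    refine ENNReal.Tendsto.div_const ?_ (Or.inr hP0)
    refine tendsto_finsetSum _ fun u _ => Tendsto.add ?_ tendsto_const_nhds
    refine tendsto_finsetSum _ fun i _ => ?_
    refine ENNReal.Tendsto.const_mul ?_ (Or.inr ENNReal.ofReal_ne_top)
    have h1 : Tendsto (fun M : ℕ => ((M * P : ℕ) : ℝ≥0∞)) atTop (nhds ⊤) :=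
      ENNReal.tendsto_nat_nhds_top.comp (tendsto_id.atTop_mul_const' (by omega))
    simpa using (tendsto_const_nhds (x := countWait (airs S i) 1 u)).min h1
  refine le_of_tendsto' hFlim fun M => ?_
  have hFt : F M ≠ ⊤ := by
    refine ENNReal.sum_ne_top.2 fun u _ => ENNReal.add_ne_top.2 ⟨ENNReal.sum_ne_top.2 fun i _ => ?_,
      ENNReal.sum_ne_top.2 fun k _ => ENNReal.sum_ne_top.2 fun i _ => ?_⟩
    · exact ENNReal.mul_ne_top ENNReal.ofReal_ne_top
        ((min_le_right _ _).trans_lt (ENNReal.natCast_lt_top _)).ne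
    · split_ifs
      exacts [ENNReal.ofReal_ne_top, ENNReal.zero_ne_top]
  have hlow : ∀ k : ℕ, k * F M ≤
      ∑ t ∈ Finset.range ((k + M + 1) * P), slotCost p c X S ((k + M + 1) * P) t := by
    intro k
    calc (k : ℝ≥0∞) * F M = ∑ j ∈ Finset.range k, F M := by simp
      _ ≤ ∑ j ∈ Finset.range k, ∑ r ∈ Finset.range P,
            slotCost p c X S ((k + M + 1) * P) (j * P + r) := by
          refine Finset.sum_le_sum fun j hj => Finset.sum_le_sum fun r hr => ?_
          rw [Finset.mem_range] at hj hr
          rw [slotCost, hbc]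
          have hb : j * P + r + M * P ≤ (k + M + 1) * P := by
            have : (j + 1) * P ≤ k * P := Nat.mul_le_mul_right _ hj
            have e1 : (k + M + 1) * P = k * P + M * P + P := by ring
            have e2 : (j + 1) * P = j * P + P := by ring
            omega
          gcongr with i hi
          rw [← hwait i j r]
          refine min_countWait_le_nextTime_sub hb ?_
          have : (j + 1) * P ≤ k * P := Nat.mul_le_mul_right _ hj
          have e1 : (k + M + 1) * P = k * P + M * P + P := by ring
          have e2 : (j + 1) * P = j * P + P := by ring
          omega
      _ = ∑ t ∈ Finset.range (k * P), slotCost p c X S ((k + M + 1) * P) t :=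
          (sum_range_mul_eq _ k P).symm
      _ ≤ _ := Finset.sum_le_sum_of_subset
          (Finset.range_mono (Nat.mul_le_mul_right _ (by omega)))
  refine le_of_forall_lt fun b hb => ?_
  obtain ⟨b', hb1, hb2⟩ := exists_between hb
  refine hb1.trans_le (le_limsup_of_frequently_le ?_ (by isBoundedDefault))
  have hratio : Tendsto (fun k : ℕ => F M / P * ((k : ℝ≥0∞) / ((k + M + 1 : ℕ) : ℝ≥0∞))) atTop
      (nhds (F M / P * 1)) := by
    refine ENNReal.Tendsto.const_mul ?_ (Or.inr (ENNReal.div_ne_top hFt hP0))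
    have hreal : Tendsto (fun k : ℕ => ENNReal.ofReal ((k : ℝ) / ((k : ℝ) + (M + 1)))) atTop
        (nhds (ENNReal.ofReal 1)) :=
      ENNReal.tendsto_ofReal (tendsto_natCast_div_add_atTop (M + 1 : ℝ))
    rw [ENNReal.ofReal_one] at hreal
    refine hreal.congr fun k => ?_
    rw [ENNReal.ofReal_div_of_pos (by positivity), ENNReal.ofReal_natCast]
    congr 1
    rw [← ENNReal.ofReal_natCast]
    push_cast
    rw [add_assoc]
  rw [mul_one] at hratio
  have hev := hratio.eventually (lt_mem_nhds hb2)
  have htop : Tendsto (fun k : ℕ => (k + M + 1) * P) atTop atTop :=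
    (tendsto_atTop_mono (fun k => by
      have : k ≤ (k + M + 1) * P := by nlinarith
      exact this) tendsto_id)
  refine htop.frequently (hev.frequently.mono fun k hk => hk.le.trans ?_)
  rw [ENNReal.le_div_iff_mul_le (Or.inl (by
    have : (k + M + 1) * P ≠ 0 := Nat.mul_ne_zero (by omega) (by omega)
    exact_mod_cast this)) (Or.inl (ENNReal.natCast_ne_top _))]
  refine le_trans (le_of_eq ?_) (hlow k)
  have hk0 : ((k + M + 1 : ℕ) : ℝ≥0∞) ≠ 0 := by exact_mod_cast (by omega : k + M + 1 ≠ 0)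
  rw [Nat.cast_mul, div_eq_mul_inv, div_eq_mul_inv]
  calc F M * (P : ℝ≥0∞)⁻¹ * (k * ((k + M + 1 : ℕ) : ℝ≥0∞)⁻¹) * (((k + M + 1 : ℕ) : ℝ≥0∞) * P)
      = F M * k * ((P : ℝ≥0∞)⁻¹ * P) *
          (((k + M + 1 : ℕ) : ℝ≥0∞)⁻¹ * ((k + M + 1 : ℕ) : ℝ≥0∞)) := by ring
    _ = _ := by
        rw [ENNReal.inv_mul_cancel hP0 hPt, ENNReal.inv_mul_cancel hk0 (ENNReal.natCast_ne_top _)]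
        ring

/-! ## The least possible waiting time for a given number of broadcasts -/

open scoped Classical in
-- A gap of length `x` contributes `x ^ 2 / 2`, and `K` broadcasts leave at most `K + 1` gaps of
-- total length `d`. The induction splits off the first gap.
lemma sum_wait_Ico_ge (S : Schedule W m) (i : Fin m) (n : ℕ) : ∀ d t : ℕ, t + d = n →
    ((d : ℝ)) ^ 2 ≤ (∑ s ∈ Finset.Ico t n, ((nextTime S n i s : ℝ) - s - 1 / 2)) *
      (2 * (((Finset.Ioo t n).filter fun s => ∃ k, S s k = some i).card + 1)) := by
  intro d
  induction d using Nat.strong_induction_on with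
  | _ d ih =>
    intro t htn
    rcases Nat.eq_zero_or_pos d with rfl | hd
    · simp [show t = n by omega]
    have htlt : t < n := by omega
    set e := nextTime S n i t with he
    have hte : t < e := lt_nextTime htlt
    have hen : e ≤ n := nextTime_le_end
    have hsame : ∀ s ∈ Finset.Ico t e, nextTime S n i s = e := by
      intro s hs
      rw [Finset.mem_Ico] at hs
      refine le_antisymm ?_ ?_
      · rcases nextTime_eq_end_or (S := S) (n := n) (i := i) (t := t) with h | h
        · rw [he, h]; exact nextTime_le_end
        · exact nextTime_le_of_broadcast hs.2 h.2
      · rcases nextTime_eq_end_or (S := S) (n := n) (i := i) (t := s) with h | h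
        · rw [h]; exact hen
        · exact nextTime_le_of_broadcast (hs.1.trans_lt h.1) h.2
    have hfirst : ∑ s ∈ Finset.Ico t e, ((nextTime S n i s : ℝ) - s - 1 / 2) =
        ((e : ℝ) - t) ^ 2 / 2 := by
      rw [Finset.sum_congr rfl fun s hs => by rw [hsame s hs]]
      have : ∀ a : ℕ, ∑ s ∈ Finset.Ico t (t + a), (((t + a : ℕ) : ℝ) - s - 1 / 2) =
          (a : ℝ) ^ 2 / 2 := by
        intro a
        rw [Finset.sum_Ico_eq_sum_range, Nat.add_sub_cancel_left]
        have h : ∀ b : ℝ, ∑ k ∈ Finset.range a, (b - ((k : ℕ) : ℝ)) =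
            a * b - a * (a - 1) / 2 := by
          intro b
          induction a with
          | zero => simp
          | succ a ih' => rw [Finset.sum_range_succ, ih']; push_cast; ring
        have := h ((a : ℝ) - 1 / 2)
        refine Eq.trans (Finset.sum_congr rfl fun k _ => ?_) (this.trans (by ring))
        push_cast; ring
      obtain ⟨a, ha⟩ : ∃ a, e = t + a := ⟨e - t, by omega⟩
      rw [ha, this a]; push_cast; ring
    rw [← Finset.sum_Ico_consecutive _ hte.le hen, hfirst]
    have hdR : (d : ℝ) = (n : ℝ) - t := by
      have : (t : ℝ) + d = n := by exact_mod_cast htn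
      linarith
    rcases nextTime_eq_end_or (S := S) (n := n) (i := i) (t := t) with h | h
    · have hen' : e = n := h
      rw [hen', Finset.Ico_self, Finset.sum_empty, add_zero, hdR]
      have : (0 : ℝ) ≤ ((Finset.Ioo t n).filter fun s => ∃ k, S s k = some i).card :=
        Nat.cast_nonneg _
      nlinarith [sq_nonneg ((n : ℝ) - t)]
    · rcases hen.eq_or_lt with hen' | hen'
      · rw [hen', Finset.Ico_self, Finset.sum_empty, add_zero, hdR]
        have : (0 : ℝ) ≤ ((Finset.Ioo t n).filter fun s => ∃ k, S s k = some i).card :=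
          Nat.cast_nonneg _
        nlinarith [sq_nonneg ((n : ℝ) - t)]
      have h2 := ih (n - e) (by omega) e (by omega)
      set V := ∑ s ∈ Finset.Ico e n, ((nextTime S n i s : ℝ) - s - 1 / 2)
      have hk : (((Finset.Ioo e n).filter fun s => ∃ k, S s k = some i).card : ℝ) + 1 ≤
          ((Finset.Ioo t n).filter fun s => ∃ k, S s k = some i).card := by
        norm_cast
        rw [← Finset.card_insert_of_notMem (a := e) (by simp)]
        refine Finset.card_le_card fun s hs => ?_
        rw [Finset.mem_insert, Finset.mem_filter, Finset.mem_Ioo] at hs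
        rw [Finset.mem_filter, Finset.mem_Ioo]
        rcases hs with rfl | hs
        · exact ⟨⟨hte, hen'⟩, h.2⟩
        · exact ⟨⟨hte.trans hs.1.1, hs.1.2⟩, hs.2⟩
      set k' : ℝ := (((Finset.Ioo e n).filter fun s => ∃ k, S s k = some i).card : ℝ) + 1
      set K : ℝ := (((Finset.Ioo t n).filter fun s => ∃ k, S s k = some i).card : ℝ)
      have hk1 : 1 ≤ k' := by
        have : (0 : ℝ) ≤ (((Finset.Ioo e n).filter fun s => ∃ k, S s k = some i).card : ℝ) :=
          Nat.cast_nonneg _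
        simp only [k']; linarith
      have hcast : ((n - e : ℕ) : ℝ) = (n : ℝ) - e := Nat.cast_sub hen
      rw [hcast] at h2
      rw [hdR]
      set x := (e : ℝ) - t
      set y := (n : ℝ) - e
      have hxy : (n : ℝ) - t = x + y := by simp only [x, y]; ring
      rw [hxy]
      have hV : y ^ 2 / (2 * k') ≤ V := by
        rw [div_le_iff₀ (by positivity)]; linarith
      have hV0 : 0 ≤ V := le_trans (by positivity) hV
      -- The inductive step of Cauchy–Schwarz; the deficit is the square `(k' * x - y) ^ 2 / k'`.
      have h3 : (x + y) ^ 2 ≤ (x ^ 2 / 2 + y ^ 2 / (2 * k')) * (2 * (k' + 1)) := by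
        have e : (x ^ 2 / 2 + y ^ 2 / (2 * k')) * (2 * (k' + 1)) - (x + y) ^ 2 =
            (k' * x - y) ^ 2 / k' := by field_simp; ring
        have : 0 ≤ (k' * x - y) ^ 2 / k' := by positivity
        linarith
      exact h3.trans (mul_le_mul (add_le_add le_rfl hV) (by linarith) (by linarith)
        (add_nonneg (by positivity) hV0))

end Costs

/-! ## The relaxation -/

section Relaxation

variable {m W : ℕ} {D : Grouped m} {Q : Finset Label}

lemma lbValue_nonneg (hp : ∀ G, 0 ≤ D.prob G) (hc : ∀ G, 0 ≤ D.cst G) {τ : Label → ℝ}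
    (hτ : ∀ G ∈ Q, 0 < τ G) : 0 ≤ D.lbValue Q τ :=
  Finset.sum_nonneg fun G hG => add_nonneg
    (div_nonneg (mul_nonneg (mul_nonneg (hp G) (sq_nonneg _)) (hτ G hG).le) zero_le_two)
    (div_nonneg (hc G) (hτ G hG).le)

lemma lbValue_congr {τ τ' : Label → ℝ} (h : ∀ G ∈ Q, τ G = τ' G) :
    D.lbValue Q τ = D.lbValue Q τ' :=
  Finset.sum_congr rfl fun G hG => by rw [h G hG]

lemma IsLBSolution.LB_eq {α : ℝ} {τ : Label → ℝ} (h : IsLBSolution D W Q α τ) :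
    LB D W Q α = ENNReal.ofReal (D.lbValue Q τ) :=
  le_antisymm (iInf₂_le τ h.1) (le_iInf₂ fun τ' hτ' => ENNReal.ofReal_le_ofReal (h.2 τ' hτ'))

/-- In the variables `x = 1 / τ` the problem becomes one on a compact set: a solution not worse than
the constant one of value `V` satisfies `a G * τ G ≤ V`, so `x G` is bounded away from `0`, and the
density constraint bounds it from above. -/
theorem exists_isLBSolution {α : ℝ} (hα : 0 < α * W) (hp : ∀ G, 0 < D.prob G)
    (hc : ∀ G, 0 ≤ D.cst G) (hs : ∀ G ∈ Q, 1 ≤ D.size G) : ∃ τ, IsLBSolution D W Q α τ := by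
  classical
  rcases Q.eq_empty_or_nonempty with rfl | hQ
  · exact ⟨fun _ => 1, ⟨by simp, by simpa using hα.le⟩, fun τ' _ => by simp [Grouped.lbValue]⟩
  set β := α * W with hβ
  have hcard : (0 : ℝ) < Q.card := by exact_mod_cast hQ.card_pos
  set a : Label → ℝ := fun G => D.prob G * (D.size G : ℝ) ^ 2 / 2 with ha
  have ha0 : ∀ G ∈ Q, 0 < a G := by
    intro G hG
    have : (0 : ℝ) < D.size G := by exact_mod_cast hs G hG
    have := hp G
    simp only [ha]; positivity
  set τ0 : Label → ℝ := fun _ => Q.card / β with hτ0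
  have hτ0pos : ∀ G ∈ Q, 0 < τ0 G := fun G _ => by simp only [hτ0]; positivity
  have hterm : ∀ τ : Label → ℝ, (∀ G ∈ Q, 0 < τ G) → ∀ G ∈ Q, a G * τ G ≤ D.lbValue Q τ := by
    intro τ hτ G hG
    have h0 : ∀ H ∈ Q, 0 ≤ D.prob H * (D.size H : ℝ) ^ 2 * τ H / 2 + D.cst H / τ H := fun H hH =>
      add_nonneg (div_nonneg (mul_nonneg (mul_nonneg (hp H).le (sq_nonneg _)) (hτ H hH).le)
        zero_le_two) (div_nonneg (hc H) (hτ H hH).le)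
    refine le_trans ?_ (Finset.single_le_sum h0 hG)
    have := div_nonneg (hc G) (hτ G hG).le
    simp only [ha]
    linarith
  set V := D.lbValue Q τ0 with hV
  have hV0 : 0 < V := by
    obtain ⟨G, hG⟩ := hQ
    exact (mul_pos (ha0 G hG) (hτ0pos G hG)).trans_le (hterm τ0 hτ0pos G hG)
  set box : Set (Label → ℝ) :=
    Set.pi Set.univ fun G => if G ∈ Q then Set.Icc (a G / V) β else {0} with hbox
  have hboxc : IsCompact box := by
    refine isCompact_univ_pi fun G => ?_
    split_ifs
    exacts [isCompact_Icc, isCompact_singleton]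
  set K := box ∩ {x : Label → ℝ | ∑ G ∈ Q, x G ≤ β} with hK
  have hKc : IsCompact K := hboxc.inter_right (isClosed_le (by fun_prop) continuous_const)
  have hKmem : ∀ x ∈ K, ∀ G ∈ Q, a G / V ≤ x G ∧ x G ≤ β := by
    intro x hx G hG
    have := hx.1 G (Set.mem_univ _)
    simpa [hG] using this
  have hKpos : ∀ x ∈ K, ∀ G ∈ Q, 0 < x G := fun x hx G hG =>
    (div_pos (ha0 G hG) hV0).trans_le (hKmem x hx G hG).1
  have hmemK : ∀ τ, Feasible Q β τ → D.lbValue Q τ ≤ V →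
      (fun G => if G ∈ Q then 1 / τ G else 0) ∈ K := by
    intro τ hτ hle
    refine ⟨fun G _ => ?_, ?_⟩
    · by_cases hG : G ∈ Q
      · simp only [hG, if_true, Set.mem_Icc]
        have h1 := hτ.1 G hG
        refine ⟨?_, ?_⟩
        · rw [div_le_div_iff₀ hV0 h1]
          linarith [hterm τ hτ.1 G hG]
        · refine le_trans ?_ hτ.2
          exact Finset.single_le_sum (f := fun G => 1 / τ G)
            (fun H hH => (one_div_pos.2 (hτ.1 H hH)).le) hG
      · simp [hG]
    · change ∑ G ∈ Q, (if G ∈ Q then 1 / τ G else 0) ≤ β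
      refine le_trans (le_of_eq ?_) hτ.2
      exact Finset.sum_congr rfl fun G hG => if_pos hG
  have hτ0f : Feasible Q β τ0 := by
    refine ⟨hτ0pos, ?_⟩
    simp only [hτ0, one_div, inv_div, Finset.sum_const, nsmul_eq_mul]
    rw [mul_div_cancel₀ _ hcard.ne']
  have hval : ∀ τ : Label → ℝ, D.lbValue Q τ =
      D.lbValue Q fun G => 1 / (if G ∈ Q then 1 / τ G else 0) := fun τ =>
    lbValue_congr fun G hG => by rw [if_pos hG, one_div_one_div]
  have hcont : ContinuousOn (fun x : Label → ℝ => D.lbValue Q fun G => 1 / x G) K := by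
    refine continuousOn_finsetSum _ fun G hG => ?_
    have hxG : ContinuousOn (fun x : Label → ℝ => x G) K := (continuous_apply G).continuousOn
    have hinv : ContinuousOn (fun x : Label → ℝ => 1 / x G) K :=
      continuousOn_const.div hxG fun x hx => (hKpos x hx G hG).ne'
    refine ContinuousOn.add ((continuousOn_const.mul hinv).div_const 2)
      (continuousOn_const.div hinv fun x hx => ?_)
    exact (one_div_pos.2 (hKpos x hx G hG)).ne'
  obtain ⟨x, hxK, hmin⟩ := hKc.exists_isMinOn ⟨_, hmemK τ0 hτ0f le_rfl⟩ hcont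
  refine ⟨fun G => 1 / x G, ⟨fun G hG => one_div_pos.2 (hKpos x hxK G hG), ?_⟩, ?_⟩
  · simp only [one_div_one_div]
    exact hxK.2
  · intro τ' hτ'
    by_cases hle : D.lbValue Q τ' ≤ V
    · rw [hval τ']
      exact hmin (hmemK τ' hτ' hle)
    · refine le_trans ?_ (not_le.1 hle).le
      rw [hV, hval τ0]
      exact hmin (hmemK τ0 hτ0f le_rfl)

/-- Slowing down all groups by the factor `1 / lam` frees density; the waiting terms grow by this
factor and the broadcast costs shrink. -/
lemma lbValue_div_le {lam : ℝ} (h0 : 0 < lam) (h1 : lam ≤ 1) (hc : ∀ G, 0 ≤ D.cst G)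
    {τ : Label → ℝ} (hτ : ∀ G ∈ Q, 0 < τ G) :
    D.lbValue Q (fun G => τ G / lam) ≤ 1 / lam * D.lbValue Q τ := by
  rw [Grouped.lbValue, Grouped.lbValue, Finset.mul_sum]
  refine Finset.sum_le_sum fun G hG => ?_
  have h2 := hτ G hG
  have h3 : D.cst G / (τ G / lam) ≤ 1 / lam * (D.cst G / τ G) := by
    have h5 : lam ≤ 1 / lam := by
      rw [le_div_iff₀ h0]; nlinarith
    calc D.cst G / (τ G / lam) = lam * (D.cst G / τ G) := by
          rw [div_div_eq_mul_div]; ring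
      _ ≤ _ := mul_le_mul_of_nonneg_right h5 (div_nonneg (hc G) h2.le)
  have h4 : D.prob G * (D.size G : ℝ) ^ 2 * (τ G / lam) / 2 =
      1 / lam * (D.prob G * (D.size G : ℝ) ^ 2 * τ G / 2) := by ring
  rw [mul_add, h4]
  linarith

end Relaxation

/-! ## Lower bounds for finite schedules -/

section LowerBound

variable {m W : ℕ} {n : ℕ}

/-- The number of slots, among the first `n`, in which the message `i` is broadcast. -/
def airCount (S : Schedule W m) (n : ℕ) (i : Fin m) : ℕ :=
  open scoped Classical in ((Finset.range n).filter fun s => ∃ k, S s k = some i).card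

/-- The number of broadcasts of messages of `X` in the slot `t`. -/
def occupied (S : Schedule W m) (X : Finset (Fin m)) (t : ℕ) : ℕ :=
  ∑ k : Fin W, ∑ i ∈ X, if S t k = some i then 1 else 0

lemma sum_broadcast_le {α : Type*} [AddCommMonoid α] [PartialOrder α] [IsOrderedAddMonoid α]
    (X : Finset (Fin m)) (o : Option (Fin m))
    {b : α} (hb : 0 ≤ b) (f : Fin m → α) (hf : ∀ i, f i ≤ b) :
    (∑ i ∈ X, if o = some i then f i else 0) ≤ b := by
  rcases o with _ | i
  · simpa using hb
  · rw [Finset.sum_congr rfl (g := fun j => if i = j then f j else 0) (fun j _ => by simp),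
      Finset.sum_ite_eq]
    split_ifs
    exacts [hf i, hb]

lemma occupied_le (S : Schedule W m) (X : Finset (Fin m)) (t : ℕ) : occupied S X t ≤ W := by
  calc occupied S X t ≤ ∑ k : Fin W, 1 :=
        Finset.sum_le_sum fun k _ => sum_broadcast_le X (S t k) zero_le_one _ fun _ => le_rfl
    _ = W := by simp

lemma occupied_union (S : Schedule W m) {X Y : Finset (Fin m)} (h : Disjoint X Y) (t : ℕ) :
    occupied S (X ∪ Y) t = occupied S X t + occupied S Y t := by
  simp only [occupied, Finset.sum_union h, Finset.sum_add_distrib]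

lemma sum_airCount_le (S : Schedule W m) (X : Finset (Fin m)) (n : ℕ) :
    ∑ i ∈ X, airCount S n i ≤ ∑ t ∈ Finset.range n, occupied S X t := by
  classical
  have h : ∑ t ∈ Finset.range n, occupied S X t =
      ∑ i ∈ X, ∑ t ∈ Finset.range n, ∑ k : Fin W, if S t k = some i then 1 else 0 := by
    simp only [occupied]
    rw [Finset.sum_comm (s := X)]
    refine Finset.sum_congr rfl fun t _ => Finset.sum_comm
  rw [h]
  refine Finset.sum_le_sum fun i _ => ?_
  rw [airCount, Finset.card_filter]
  refine Finset.sum_le_sum fun t _ => ?_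
  split_ifs with hk
  · obtain ⟨k, hk⟩ := hk
    calc 1 = if S t k = some i then 1 else 0 := by rw [if_pos hk]
      _ ≤ _ := Finset.single_le_sum (f := fun k => if S t k = some i then 1 else 0)
          (fun _ _ => Nat.zero_le _) (Finset.mem_univ k)
  · exact Nat.zero_le _

lemma sum_wait_ge (S : Schedule W m) (i : Fin m) (n : ℕ) :
    (n : ℝ) ^ 2 / (2 * (airCount S n i + 1)) ≤
      ∑ t ∈ Finset.range n, ((nextTime S n i t : ℝ) - t - 1 / 2) := by
  classical
  have h := sum_wait_Ico_ge S i n n 0 (zero_add n)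
  rw [← Finset.range_eq_Ico] at h
  have hk : (((Finset.Ioo 0 n).filter fun s => ∃ k, S s k = some i).card : ℝ) ≤ airCount S n i := by
    rw [airCount]
    norm_cast
    refine Finset.card_le_card fun s hs => ?_
    rw [Finset.mem_filter, Finset.mem_Ioo] at hs
    rw [Finset.mem_filter, Finset.mem_range]
    exact ⟨hs.1.2, hs.2⟩
  rw [div_le_iff₀ (by positivity)]
  refine h.trans ?_
  have h0 : 0 ≤ ∑ t ∈ Finset.range n, ((nextTime S n i t : ℝ) - t - 1 / 2) := by
    refine Finset.sum_nonneg fun t ht => ?_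
    have : t + 1 ≤ nextTime S n i t := lt_nextTime (Finset.mem_range.1 ht)
    have : (t : ℝ) + 1 ≤ nextTime S n i t := by exact_mod_cast this
    linarith
  gcongr

lemma ert_ge {p : Fin m → ℝ} (hp : ∀ i, 0 ≤ p i) (X : Finset (Fin m)) (S : Schedule W m)
    (hn : 1 ≤ n) :
    ∑ i ∈ X, p i * (n / (2 * (airCount S n i + 1))) ≤ ert p X S n := by
  have hn0 : (0 : ℝ) < n := by exact_mod_cast hn
  rw [ert, le_div_iff₀ hn0, Finset.sum_mul, Finset.sum_comm]
  refine Finset.sum_le_sum fun i _ => ?_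
  rw [← Finset.mul_sum, mul_assoc]
  refine mul_le_mul_of_nonneg_left (le_trans (le_of_eq ?_) (sum_wait_ge S i n)) (hp i)
  ring

lemma bc_ge {c : Fin m → ℝ} (hc : ∀ i, 0 ≤ c i) (X : Finset (Fin m)) (S : Schedule W m) :
    ∑ i ∈ X, c i * (airCount S n i / n) ≤ bc c X S n := by
  classical
  rw [bc]
  have h : ∑ t ∈ Finset.range n, ∑ k : Fin W, ∑ i ∈ X, (if S t k = some i then c i else 0) =
      ∑ i ∈ X, ∑ t ∈ Finset.range n, ∑ k : Fin W, if S t k = some i then c i else 0 := by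
    rw [Finset.sum_comm (s := X)]
    refine Finset.sum_congr rfl fun t _ => Finset.sum_comm
  rw [h, Finset.sum_div]
  refine Finset.sum_le_sum fun i _ => ?_
  rw [← mul_div_assoc]
  refine div_le_div_of_nonneg_right ?_ (Nat.cast_nonneg _)
  rw [airCount, Finset.card_filter, Nat.cast_sum, Finset.mul_sum]
  refine Finset.sum_le_sum fun t _ => ?_
  split_ifs with hk
  · obtain ⟨k, hk⟩ := hk
    rw [Nat.cast_one, mul_one]
    calc c i = if S t k = some i then c i else 0 := by rw [if_pos hk]
      _ ≤ _ := Finset.single_le_sum (f := fun k => if S t k = some i then c i else 0)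
          (fun k _ => by split_ifs; exacts [hc i, le_rfl]) (Finset.mem_univ k)
  · rw [Nat.cast_zero, mul_zero]
    exact Finset.sum_nonneg fun k _ => by split_ifs; exacts [hc i, le_rfl]

variable {D : Grouped m} {Q : Finset Label}

lemma sum_messages {α : Type*} [AddCommMonoid α] (D : Grouped m) (Q : Finset Label)
    (f : Fin m → α) : ∑ i ∈ D.messages Q, f i = ∑ G ∈ Q, ∑ i ∈ D.group G, f i := by
  rw [Grouped.messages, ← Finset.sum_fiberwise_of_maps_to (t := Q) (g := D.label)
    (fun i hi => (Finset.mem_filter.1 hi).2)]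
  refine Finset.sum_congr rfl fun G hG => Finset.sum_congr ?_ fun _ _ => rfl
  ext i
  simp only [Finset.mem_filter, Finset.mem_univ, true_and, Grouped.group]
  exact ⟨fun h => h.2, fun h => ⟨h ▸ hG, h⟩⟩

lemma sum_group_p {α : Type*} [AddCommMonoid α] (D : Grouped m) (G : Label) (f : ℝ → ℝ → Fin m → α) :
    ∑ i ∈ D.group G, f (D.p i) (D.c i) i = ∑ i ∈ D.group G, f (D.prob G) (D.cst G) i := by
  refine Finset.sum_congr rfl fun i hi => ?_
  have : D.label i = G := (Finset.mem_filter.1 hi).2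
  rw [Grouped.p, Grouped.c, this]

/-- The first `n` slots of a schedule yield a feasible solution of the relaxation. -/
theorem exists_lbValue_le (hp : ∀ G, 0 ≤ D.prob G) (hc : ∀ G, 0 ≤ D.cst G)
    (hs : ∀ G ∈ Q, 1 ≤ D.size G) (S : Schedule W m) (hn : 1 ≤ n) :
    ∃ τ : Label → ℝ, (∀ G ∈ Q, 0 < τ G) ∧
      ∑ G ∈ Q, 1 / τ G ≤ ((∑ t ∈ Finset.range n, occupied S (D.messages Q) t : ℕ) + m : ℝ) / n ∧
      D.lbValue Q τ ≤ ert D.p (D.messages Q) S n + bc D.c (D.messages Q) S n +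
        (∑ i, D.c i) / n := by
  have hn0 : (0 : ℝ) < n := by exact_mod_cast hn
  -- The increment by one per message counts gaps instead of broadcasts and avoids division by zero.
  -- It costs at most `m / n` in density and `(∑ c) / n` in value, both negligible for large `n`.
  -- Cauchy–Schwarz within a group shows that equal spacing of its messages is best.
  set K : Label → ℝ := fun G => ∑ i ∈ D.group G, ((airCount S n i : ℝ) + 1) with hK
  have hKpos : ∀ G ∈ Q, 0 < K G := by
    intro G hG
    refine Finset.sum_pos (fun i _ => by positivity) ?_
    exact Finset.card_pos.1 (hs G hG)
  refine ⟨fun G => n / K G, fun G hG => div_pos hn0 (hKpos G hG), ?_, ?_⟩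
  · simp only [one_div_div]
    rw [← Finset.sum_div, ← sum_messages]
    refine div_le_div_of_nonneg_right ?_ hn0.le
    rw [Finset.sum_add_distrib]
    refine add_le_add ?_ ?_
    · exact_mod_cast sum_airCount_le S (D.messages Q) n
    · rw [Finset.sum_const, nsmul_eq_mul, mul_one]
      exact_mod_cast (Finset.card_le_univ _).trans_eq (Fintype.card_fin m)
  · have h1 := ert_ge (fun i => hp (D.label i)) (D.messages Q) S hn (p := D.p)
    have h2 := bc_ge (n := n) (fun i => hc (D.label i)) (D.messages Q) S (c := D.c)
    have h3 : ∑ i ∈ D.messages Q, D.c i ≤ ∑ i, D.c i :=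
      Finset.sum_le_univ_sum_of_nonneg fun i => hc (D.label i)
    have h4 : D.lbValue Q (fun G => n / K G) ≤
        ∑ i ∈ D.messages Q, D.p i * (n / (2 * (airCount S n i + 1))) +
          ∑ i ∈ D.messages Q, D.c i * ((airCount S n i + 1) / n) := by
      rw [sum_messages, sum_messages, Grouped.lbValue, ← Finset.sum_add_distrib]
      refine Finset.sum_le_sum fun G hG => add_le_add ?_ ?_
      · rw [sum_group_p D G fun x _ i => x * (n / (2 * (airCount S n i + 1)))]
        have hcs := Finset.sq_sum_div_le_sum_sq_div (D.group G) (fun _ => (1 : ℝ))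
          (g := fun i => (airCount S n i : ℝ) + 1) (fun i _ => by positivity)
        simp only [Finset.sum_const, nsmul_eq_mul, mul_one, one_pow] at hcs
        calc D.prob G * (D.size G : ℝ) ^ 2 * (n / K G) / 2 =
              (D.prob G * n / 2) * ((D.size G : ℝ) ^ 2 / K G) := by ring
          _ ≤ (D.prob G * n / 2) * ∑ i ∈ D.group G, 1 / ((airCount S n i : ℝ) + 1) := by
              refine mul_le_mul_of_nonneg_left hcs ?_
              have := hp G
              positivity
          _ = _ := by
              rw [Finset.mul_sum]
              refine Finset.sum_congr rfl fun i _ => ?_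
              have : (airCount S n i : ℝ) + 1 ≠ 0 := by positivity
              field_simp
      · rw [sum_group_p D G fun _ x i => x * ((airCount S n i + 1) / n), ← Finset.mul_sum,
          ← Finset.sum_div, div_div_eq_mul_div, mul_div_assoc]
    have h5 : ∑ i ∈ D.messages Q, D.c i * (((airCount S n i : ℝ) + 1) / n) =
        ∑ i ∈ D.messages Q, D.c i * (airCount S n i / n) + (∑ i ∈ D.messages Q, D.c i) / n := by
      rw [Finset.sum_div, ← Finset.sum_add_distrib]
      refine Finset.sum_congr rfl fun i _ => by ring
    have h6 : (∑ i ∈ D.messages Q, D.c i) / n ≤ (∑ i, D.c i) / n := by gcongr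
    linarith

end LowerBound

/-! ## Rounding -/

section Rounding

variable {ε : ℝ}

/-- Thus `(1 + ε) ^ (-j)` lies in `[x / (1 + ε), x)`, and the normalization lies in `[1, 1 + ε]`;
together the rounded probabilities are within a factor `1 + ε` of the original ones, in both
directions. -/
lemma probExp_spec (hε : 0 < ε) {x : ℝ} (hx : 0 < x) (hx1 : x ≤ 1) :
    1 < x * (1 + ε) ^ probExp ε x ∧ x * (1 + ε) ^ probExp ε x ≤ 1 + ε := by
  have hb : 1 < 1 + ε := by linarith
  have hb0 : 0 < 1 + ε := by linarith
  have hlog : 0 ≤ Real.logb (1 + ε) (1 / x) :=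
    Real.logb_nonneg hb ((one_le_div hx).2 hx1)
  have hkey : (1 + ε) ^ Real.logb (1 + ε) (1 / x) = 1 / x :=
    Real.rpow_logb hb0 hb.ne' (one_div_pos.2 hx)
  set j := ⌊Real.logb (1 + ε) (1 / x)⌋₊ with hj
  have h1 : (j : ℝ) ≤ Real.logb (1 + ε) (1 / x) := Nat.floor_le hlog
  have h2 : Real.logb (1 + ε) (1 / x) < j + 1 := Nat.lt_floor_add_one _
  constructor
  · have h3 : (1 + ε) ^ Real.logb (1 + ε) (1 / x) < (1 + ε) ^ ((j : ℝ) + 1) :=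
      Real.rpow_lt_rpow_of_exponent_lt hb h2
    rw [hkey] at h3
    have h4 : (1 + ε) ^ ((j : ℝ) + 1) = (1 + ε) ^ (j + 1) := by
      rw [← Real.rpow_natCast]; push_cast; rfl
    rw [h4, div_lt_iff₀ hx] at h3
    rw [probExp, mul_comm]
    exact h3
  · have h3 : (1 + ε) ^ (j : ℝ) ≤ (1 + ε) ^ Real.logb (1 + ε) (1 / x) :=
      Real.rpow_le_rpow_of_exponent_le hb.le h1
    rw [hkey, Real.rpow_natCast, le_div_iff₀ hx] at h3
    rw [probExp, pow_succ]
    nlinarith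

variable {W m : ℕ} {p c : Fin m → ℝ}

lemma sum_inv_pow_bounds (hε : 0 < ε) (hp : ∀ i, 0 < p i) (hp1 : ∑ i, p i = 1) :
    1 / (1 + ε) ≤ ∑ i, 1 / (1 + ε) ^ probExp ε (p i) ∧
      ∑ i, 1 / (1 + ε) ^ probExp ε (p i) ≤ 1 := by
  have hle : ∀ i, p i ≤ 1 := fun i => by
    rw [← hp1]
    exact Finset.single_le_sum (fun j _ => (hp j).le) (Finset.mem_univ i)
  have hb0 : 0 < 1 + ε := by linarith
  constructor
  · calc 1 / (1 + ε) = ∑ i, p i / (1 + ε) := by rw [← Finset.sum_div, hp1]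
      _ ≤ _ := ?_
    refine Finset.sum_le_sum fun i _ => ?_
    rw [div_le_div_iff₀ hb0 (by positivity)]
    linarith [(probExp_spec hε (hp i) (hle i)).2]
  · refine le_trans (Finset.sum_le_sum fun i _ => ?_) hp1.le
    rw [div_le_iff₀ (by positivity)]
    exact (probExp_spec hε (hp i) (hle i)).1.le

lemma normConst_bounds (hε : 0 < ε) (hp : ∀ i, 0 < p i) (hp1 : ∑ i, p i = 1) :
    1 ≤ normConst ε p ∧ normConst ε p ≤ 1 + ε := by
  obtain ⟨h1, h2⟩ := sum_inv_pow_bounds hε hp hp1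
  have hb0 : 0 < 1 + ε := by linarith
  have h3 : 0 < ∑ i, 1 / (1 + ε) ^ probExp ε (p i) := (by positivity : 0 < 1 / (1 + ε)).trans_le h1
  constructor
  · exact (one_le_inv₀ h3).2 h2
  · rw [normConst, inv_le_comm₀ h3 hb0, ← one_div]; exact h1

/-- The hypotheses on the messages of the problem. -/
structure IsInstance (W : ℕ) (ε C : ℝ) (p c : Fin m → ℝ) : Prop where
  W_pos : 1 ≤ W
  eps_pos : 0 < ε
  p_pos : ∀ i, 0 < p i
  p_sum : ∑ i, p i = 1
  c_nonneg : ∀ i, 0 ≤ c i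
  c_le : ∀ i, c i ≤ C

namespace IsInstance

variable {C : ℝ} (h : IsInstance W ε C p c)
include h

lemma p_le_one (i : Fin m) : p i ≤ 1 := by
  rw [← h.p_sum]
  exact Finset.single_le_sum (fun j _ => (h.p_pos j).le) (Finset.mem_univ i)

lemma prob_pos (G : Label) : 0 < (rounded W ε p c).prob G := by
  have := (normConst_bounds h.eps_pos h.p_pos h.p_sum).1
  have := h.eps_pos
  change 0 < normConst ε p / (1 + ε) ^ G.1
  positivity

lemma cst_nonneg (G : Label) : 0 ≤ (rounded W ε p c).cst G := by
  have := h.eps_pos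
  change (0 : ℝ) ≤ G.2 * (ε / W)
  positivity

lemma rounded_p_sum : ∑ i, (rounded W ε p c).p i = 1 := by
  have h1 := (sum_inv_pow_bounds h.eps_pos h.p_pos h.p_sum).1
  have h2 : 0 < 1 / (1 + ε) := one_div_pos.2 (by linarith [h.eps_pos])
  have h3 : ∀ i, (rounded W ε p c).p i = normConst ε p * (1 / (1 + ε) ^ probExp ε (p i)) :=
    fun i => by rw [mul_one_div]; rfl
  simp only [h3]
  rw [← Finset.mul_sum, normConst, inv_mul_cancel₀ (h2.trans_le h1).ne']

lemma rounded_p_le (i : Fin m) : (rounded W ε p c).p i ≤ (1 + ε) * p i := by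
  have h1 := (normConst_bounds h.eps_pos h.p_pos h.p_sum).2
  have h2 := (probExp_spec h.eps_pos (h.p_pos i) (h.p_le_one i)).1
  have := h.eps_pos
  change normConst ε p / (1 + ε) ^ probExp ε (p i) ≤ _
  rw [div_le_iff₀ (by positivity)]
  nlinarith

lemma p_le_rounded (i : Fin m) : p i ≤ (1 + ε) * (rounded W ε p c).p i := by
  have h1 := (normConst_bounds h.eps_pos h.p_pos h.p_sum).1
  have h2 := (probExp_spec h.eps_pos (h.p_pos i) (h.p_le_one i)).2
  have := h.eps_pos
  change _ ≤ (1 + ε) * (normConst ε p / (1 + ε) ^ probExp ε (p i))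
  rw [← mul_div_assoc, le_div_iff₀ (by positivity)]
  nlinarith

lemma unit_pos : 0 < ε / W := div_pos h.eps_pos (by exact_mod_cast h.W_pos)

lemma rounded_c_le (i : Fin m) : (rounded W ε p c).c i ≤ c i := by
  have hW : (0 : ℝ) < W := by exact_mod_cast h.W_pos
  have := h.eps_pos
  have h1 : (⌊c i * W / ε⌋₊ : ℝ) ≤ c i * W / ε :=
    Nat.floor_le (div_nonneg (mul_nonneg (h.c_nonneg i) hW.le) this.le)
  change (⌊c i * W / ε⌋₊ : ℝ) * (ε / W) ≤ c i
  calc (⌊c i * W / ε⌋₊ : ℝ) * (ε / W) ≤ c i * W / ε * (ε / W) :=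
        mul_le_mul_of_nonneg_right h1 h.unit_pos.le
    _ = c i := by field_simp

lemma c_le_rounded (i : Fin m) : c i ≤ (rounded W ε p c).c i + ε / W := by
  have hW : (0 : ℝ) < W := by exact_mod_cast h.W_pos
  have := h.eps_pos
  have h1 : c i * W / ε < (⌊c i * W / ε⌋₊ : ℝ) + 1 := Nat.lt_floor_add_one _
  change c i ≤ (⌊c i * W / ε⌋₊ : ℝ) * (ε / W) + ε / W
  calc c i = c i * W / ε * (ε / W) := by field_simp
    _ ≤ ((⌊c i * W / ε⌋₊ : ℝ) + 1) * (ε / W) := mul_le_mul_of_nonneg_right h1.le h.unit_pos.le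
    _ = _ := by ring

lemma rounded_p_pos (i : Fin m) : 0 < (rounded W ε p c).p i := h.prob_pos _

lemma rounded_c_nonneg (i : Fin m) : 0 ≤ (rounded W ε p c).c i := h.cst_nonneg _

lemma cst_le {G : Label} (hG : G ∈ (rounded W ε p c).labels) : (rounded W ε p c).cst G ≤ C := by
  obtain ⟨i, -, rfl⟩ := Finset.mem_image.1 hG
  exact (h.rounded_c_le i).trans (h.c_le i)

end IsInstance

lemma wait_nonneg {S : Schedule W m} {n t : ℕ} {i : Fin m} (ht : t ∈ Finset.range n) :
    0 ≤ (nextTime S n i t : ℝ) - t - 1 / 2 := by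
  have : t + 1 ≤ nextTime S n i t := lt_nextTime (Finset.mem_range.1 ht)
  have : (t : ℝ) + 1 ≤ nextTime S n i t := by exact_mod_cast this
  linarith

lemma ert_le_mul {p q : Fin m → ℝ} {a : ℝ} (hpq : ∀ i, p i ≤ a * q i) (X : Finset (Fin m))
    (S : Schedule W m) (n : ℕ) : ert p X S n ≤ a * ert q X S n := by
  rw [ert, ert, ← mul_div_assoc, Finset.mul_sum]
  refine div_le_div_of_nonneg_right (Finset.sum_le_sum fun t ht => ?_) (Nat.cast_nonneg _)
  rw [Finset.mul_sum]
  refine Finset.sum_le_sum fun i _ => ?_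
  rw [← mul_assoc]
  exact mul_le_mul_of_nonneg_right (hpq i) (wait_nonneg ht)

lemma bc_mono {c d : Fin m → ℝ} (hcd : ∀ i, c i ≤ d i) (X : Finset (Fin m))
    (S : Schedule W m) (n : ℕ) : bc c X S n ≤ bc d X S n := by
  refine div_le_div_of_nonneg_right ?_ (Nat.cast_nonneg _)
  gcongr with t _ k _ i _
  split_ifs
  exacts [hcd i, le_rfl]

/-- A slot has at most `W` broadcasts, so the rounding unit `ε / W` of the costs leads to a total
error of at most `ε`. -/
lemma bc_le_add {c d : Fin m → ℝ} {δ : ℝ} (hδ : 0 ≤ δ) (hcd : ∀ i, c i ≤ d i + δ)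
    (X : Finset (Fin m)) (S : Schedule W m) (n : ℕ) : bc c X S n ≤ bc d X S n + W * δ := by
  rcases Nat.eq_zero_or_pos n with rfl | hn
  · simp only [bc, Finset.range_zero, Finset.sum_empty, zero_div, zero_add]; positivity
  have hn0 : (0 : ℝ) < n := by exact_mod_cast hn
  rw [bc, bc, div_add' _ _ _ hn0.ne']
  refine div_le_div_of_nonneg_right ?_ hn0.le
  have h1 : W * δ * n = ∑ t ∈ Finset.range n, ∑ k : Fin W, δ := by
    simp only [Finset.sum_const, Finset.card_range, Finset.card_univ, Fintype.card_fin,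
      nsmul_eq_mul]; ring
  rw [h1, ← Finset.sum_add_distrib]
  refine Finset.sum_le_sum fun t _ => ?_
  rw [← Finset.sum_add_distrib]
  refine Finset.sum_le_sum fun k _ => ?_
  have h2 := sum_broadcast_le X (S t k) hδ (fun i => c i - d i) fun i => by linarith [hcd i]
  have h3 : ∑ i ∈ X, (if S t k = some i then c i - d i else 0) =
      ∑ i ∈ X, (if S t k = some i then c i else 0) - ∑ i ∈ X, if S t k = some i then d i else 0 := by
    rw [← Finset.sum_sub_distrib]
    refine Finset.sum_congr rfl fun i _ => ?_
    split_ifs <;> ring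
  rw [h3] at h2
  linarith

namespace IsInstance

variable {C : ℝ} (h : IsInstance W ε C p c)
include h

lemma cost_le_rounded (S : Schedule W m) :
    cost p c Finset.univ S ≤ ENNReal.ofReal (1 + ε) *
      cost (rounded W ε p c).p (rounded W ε p c).c Finset.univ S + ENNReal.ofReal ε := by
  have hε := h.eps_pos
  have hW : (0 : ℝ) < W := by exact_mod_cast h.W_pos
  rw [cost, cost, ← ENNReal.limsup_const_mul_of_ne_top ENNReal.ofReal_ne_top,
    ← limsup_add_const _ _ _ (by isBoundedDefault) (by isBoundedDefault)]
  refine limsup_le_limsup (Eventually.of_forall fun n => ?_)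
  have h1 := ert_le_mul h.p_le_rounded Finset.univ S n
  have h2 := bc_le_add h.unit_pos.le h.c_le_rounded Finset.univ S n
  have h3 : (0 : ℝ) ≤ ert (rounded W ε p c).p Finset.univ S n :=
    ert_nonneg fun i => (h.rounded_p_pos i).le
  have h4 : (0 : ℝ) ≤ bc (rounded W ε p c).c Finset.univ S n := bc_nonneg h.rounded_c_nonneg
  beta_reduce
  rw [← ENNReal.ofReal_mul (by linarith), ← ENNReal.ofReal_add (by positivity) hε.le]
  refine ENNReal.ofReal_le_ofReal ?_
  have h5 : (W : ℝ) * (ε / W) = ε := by field_simp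
  rw [h5] at h2
  nlinarith

lemma rounded_cost_le (S : Schedule W m) :
    cost (rounded W ε p c).p (rounded W ε p c).c Finset.univ S ≤
      ENNReal.ofReal (1 + ε) * cost p c Finset.univ S := by
  have hε := h.eps_pos
  rw [cost, cost, ← ENNReal.limsup_const_mul_of_ne_top ENNReal.ofReal_ne_top]
  refine limsup_le_limsup (Eventually.of_forall fun n => ?_)
  have h1 := ert_le_mul h.rounded_p_le Finset.univ S n
  have h2 := bc_mono h.rounded_c_le Finset.univ S n
  have h4 : (0 : ℝ) ≤ bc c Finset.univ S n := bc_nonneg h.c_nonneg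
  beta_reduce
  rw [← ENNReal.ofReal_mul (by linarith)]
  refine ENNReal.ofReal_le_ofReal ?_
  nlinarith

lemma rounded_opt_le : opt W (rounded W ε p c).p (rounded W ε p c).c ≤
    ENNReal.ofReal (1 + ε) * opt W p c := by
  have hε := h.eps_pos
  rw [opt, opt, ENNReal.mul_iInf_of_ne (by simp; linarith) ENNReal.ofReal_ne_top]
  exact iInf_mono h.rounded_cost_le

end IsInstance

/-- Every request waits half a slot on average before the next slot can start. This bound absorbs
all additive errors into multiples of the optimum. -/
lemma half_le_opt {q d : Fin m → ℝ} (hq : ∀ i, 0 ≤ q i) (hq1 : ∑ i, q i = 1) (hd : ∀ i, 0 ≤ d i) :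
    ENNReal.ofReal (1 / 2) ≤ opt W q d := by
  refine le_iInf fun S => ?_
  refine le_limsup_of_frequently_le (Eventually.frequently ?_) (by isBoundedDefault)
  filter_upwards [eventually_ge_atTop 1] with n hn
  have hn0 : (0 : ℝ) < n := by exact_mod_cast hn
  refine ENNReal.ofReal_le_ofReal (le_add_of_le_of_nonneg ?_ (bc_nonneg hd))
  rw [ert, le_div_iff₀ hn0]
  calc (1 : ℝ) / 2 * n = ∑ t ∈ Finset.range n, ∑ i, q i * (1 / 2) := by
        rw [← Finset.sum_mul, hq1]; simp; ring
    _ ≤ _ := by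
        gcongr with t ht i _
        · exact hq i
        · have : t + 1 ≤ nextTime S n i t := lt_nextTime (Finset.mem_range.1 ht)
          have : (t : ℝ) + 1 ≤ nextTime S n i t := by exact_mod_cast this
          linarith

end Rounding

/-! ## Existence of a partition -/

section Partition

variable {W m : ℕ}

/-- Cauchy–Schwarz across all messages: the waiting part is at least `n / 2 * ∑ q i / K i`, where
the `K i` sum up to at most `n * W + m`. -/
lemma sq_sum_sqrt_le_opt {q d : Fin m → ℝ} (hW : 1 ≤ W) (hq : ∀ i, 0 ≤ q i) (hd : ∀ i, 0 ≤ d i) :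
    ENNReal.ofReal ((∑ i, √(q i)) ^ 2 / (2 * W)) ≤ opt W q d := by
  refine le_iInf fun S => ?_
  have hW0 : (0 : ℝ) < W := by exact_mod_cast hW
  set V := ∑ i, √(q i) with hV
  have hlim : Tendsto (fun n : ℕ => ENNReal.ofReal (V ^ 2 / (2 * W) * ((n : ℝ) / (n + m / W))))
      atTop (nhds (ENNReal.ofReal (V ^ 2 / (2 * W) * 1))) :=
    ENNReal.tendsto_ofReal ((tendsto_natCast_div_add_atTop (m / W : ℝ)).const_mul _)
  rw [mul_one] at hlim
  rw [← hlim.limsup_eq, cost]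
  refine limsup_le_limsup ?_
  filter_upwards [eventually_ge_atTop 1] with n hn
  have hn0 : (0 : ℝ) < n := by exact_mod_cast hn
  refine ENNReal.ofReal_le_ofReal (le_add_of_le_of_nonneg ?_ (bc_nonneg hd))
  refine le_trans ?_ (ert_ge hq Finset.univ S hn)
  have hK : (∑ i, ((airCount S n i : ℝ) + 1)) ≤ n * W + m := by
    rw [Finset.sum_add_distrib]
    refine add_le_add ?_ (by simp)
    have h1 := sum_airCount_le S Finset.univ n
    have h2 : ∑ t ∈ Finset.range n, occupied S Finset.univ t ≤ n * W := by
      refine (Finset.sum_le_sum fun t _ => occupied_le S Finset.univ t).trans_eq ?_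
      simp
    exact_mod_cast h1.trans h2
  have hcs := Finset.sq_sum_div_le_sum_sq_div Finset.univ (fun i => √(q i))
    (g := fun i => (airCount S n i : ℝ) + 1) (fun i _ => by positivity)
  simp only [Real.sq_sqrt (hq _)] at hcs
  calc V ^ 2 / (2 * W) * ((n : ℝ) / (n + m / W)) = n / 2 * (V ^ 2 / (n * W + m)) := by
        have : (0 : ℝ) < n * W + m := by positivity
        field_simp
    _ ≤ n / 2 * (V ^ 2 / ∑ i, ((airCount S n i : ℝ) + 1)) := by
        rcases isEmpty_or_nonempty (Fin m) with he | he
        · simp [hV]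
        have : 0 < ∑ i, ((airCount S n i : ℝ) + 1) :=
          Finset.sum_pos (fun i _ => by positivity) Finset.univ_nonempty
        gcongr
    _ ≤ n / 2 * ∑ i, q i / ((airCount S n i : ℝ) + 1) := by gcongr
    _ = _ := by
        rw [Finset.mul_sum]
        refine Finset.sum_congr rfl fun i _ => ?_
        have : (airCount S n i : ℝ) + 1 ≠ 0 := by positivity
        field_simp

namespace Grouped

/-- The sum of the square roots of the probabilities of the messages of a group. -/
def weight (D : Grouped m) (G : Label) : ℝ := √(D.prob G) * D.size G

lemma weight_nonneg (D : Grouped m) (G : Label) : 0 ≤ D.weight G := by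
  unfold weight; positivity

lemma sum_weight (D : Grouped m) : ∑ G ∈ D.labels, D.weight G = ∑ i, √(D.p i) := by
  have h := sum_messages D D.labels fun i => √(D.p i)
  have hu : D.messages D.labels = Finset.univ := by
    ext i; simp [messages, labels]
  rw [hu] at h
  rw [h]
  refine Finset.sum_congr rfl fun G _ => ?_
  rw [sum_group_p D G fun x _ _ => √x, Finset.sum_const, nsmul_eq_mul, weight, mul_comm, size]

lemma size_pos {D : Grouped m} {G : Label} (hG : G ∈ D.labels) : 1 ≤ D.size G := by
  obtain ⟨i, -, rfl⟩ := Finset.mem_image.1 hG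
  exact Finset.card_pos.2 ⟨i, by simp [group]⟩

lemma card_messages (D : Grouped m) (Q : Finset Label) :
    (D.messages Q).card = ∑ G ∈ Q, D.size G := by
  have := sum_messages D Q fun _ => 1
  simpa [size] using this

end Grouped

/-- The frequencies are chosen proportional to the weights, which is optimal without broadcast
costs; the costs add at most `C` times the density `1 / N`. -/
lemma LB_le_of_weights {D : Grouped m} {Q : Finset Label} {N : ℕ} {C : ℝ} (hN : 1 ≤ N) (hC : 0 ≤ C)
    (hp : ∀ G, 0 < D.prob G) (hs : ∀ G ∈ Q, 1 ≤ D.size G) (hc : ∀ G ∈ Q, D.cst G ≤ C) :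
    LB D 1 Q (1 / N) ≤ ENNReal.ofReal (N * (∑ G ∈ Q, D.weight G) ^ 2 / 2 + C / N) := by
  have hN0 : (0 : ℝ) < N := by exact_mod_cast hN
  set V := ∑ G ∈ Q, D.weight G with hV
  have hw : ∀ G ∈ Q, 0 < D.weight G := fun G hG => by
    have h1 := Real.sqrt_pos.2 (hp G)
    have h2 : (0 : ℝ) < D.size G := by exact_mod_cast hs G hG
    exact mul_pos h1 h2
  have hV0 : ∀ G ∈ Q, 0 < V := fun G hG => Finset.sum_pos hw ⟨G, hG⟩
  have hsum : ∑ G ∈ Q, D.weight G / (N * V) ≤ 1 / N := by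
    rw [← Finset.sum_div, ← hV]
    rcases eq_or_ne V 0 with h0 | h0
    · rw [h0]; simp
    · refine le_of_eq ?_
      field_simp
  have hf : Feasible Q (1 / N * (1 : ℕ)) (fun G => N * V / D.weight G) := by
    refine ⟨fun G hG => ?_, ?_⟩
    · have := hw G hG
      have := hV0 G hG
      positivity
    · simpa only [one_div_div, Nat.cast_one, mul_one] using hsum
  refine (iInf₂_le _ hf).trans (ENNReal.ofReal_le_ofReal ?_)
  · have h1 : ∀ G ∈ Q, D.prob G * (D.size G : ℝ) ^ 2 * (N * V / D.weight G) / 2 +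
        D.cst G / (N * V / D.weight G) ≤ N * V / 2 * D.weight G + C * (D.weight G / (N * V)) := by
      intro G hG
      have h2 := hw G hG
      have h3 := hV0 G hG
      refine add_le_add (le_of_eq ?_) ?_
      · have h4 : D.prob G * (D.size G : ℝ) ^ 2 = D.weight G ^ 2 := by
          rw [Grouped.weight, mul_pow, Real.sq_sqrt (hp G).le]
        rw [h4]
        field_simp
      · rw [div_div_eq_mul_div, mul_div_assoc]
        exact mul_le_mul_of_nonneg_right (hc G hG) (by positivity)
    refine (Finset.sum_le_sum h1).trans ?_
    rw [Finset.sum_add_distrib, ← Finset.mul_sum, ← Finset.mul_sum, ← hV]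
    have : C * ∑ G ∈ Q, D.weight G / (N * V) ≤ C * (1 / N) := mul_le_mul_of_nonneg_left hsum hC
    rw [mul_one_div] at this
    refine add_le_add (le_of_eq ?_) this
    ring

section Constants

variable {ε C : ℝ}

lemma three_le_log (hε : 0 < ε) (hε7 : ε < 1 / 7) : 3 ≤ Real.log (1 + 4 / ε) := by
  have h1 : (28 : ℝ) ≤ 4 / ε := by rw [le_div_iff₀ hε]; linarith
  rw [Real.le_log_iff_exp_le (by linarith)]
  have h2 : Real.exp 3 = Real.exp 1 ^ 3 := by rw [← Real.exp_nat_mul]; norm_num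
  have h3 := Real.exp_one_lt_d9
  have h4 : Real.exp 1 ^ 3 ≤ 2.7182818286 ^ 3 := pow_le_pow_left₀ (Real.exp_pos 1).le h3.le 3
  rw [h2]
  refine h4.trans ?_
  norm_num
  linarith

lemma le_periodConst (hε : 0 < ε) (hε7 : ε < 1 / 7) :
    120 * max C 1 / ε ^ 4 ≤ periodConst ε C := by
  have h1 := three_le_log hε hε7
  have h2 : 0 < 1 - ε / 6 := by linarith
  have h3 : 1 - ε / 6 ≤ 1 := by linarith
  have h5 : (1 : ℝ) ≤ max C 1 := le_max_right _ _
  rw [periodConst, div_mul_eq_mul_div]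
  calc 120 * max C 1 / ε ^ 4 ≤ 40 * Real.log (1 + 4 / ε) * max C 1 / ε ^ 4 := by
        gcongr; linarith
    _ ≤ _ := div_le_div_of_nonneg_left
        (mul_nonneg (by linarith : 0 ≤ 40 * Real.log (1 + 4 / ε)) (by linarith))
        (mul_pos (pow_pos hε 4) h2) (by nlinarith [pow_pos hε 4])

lemma periodConst_pos (hε : 0 < ε) (hε7 : ε < 1 / 7) : 1 ≤ periodConst ε C := by
  refine le_trans ?_ (le_periodConst hε hε7)
  have h5 : (1 : ℝ) ≤ max C 1 := le_max_right _ _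
  rw [le_div_iff₀ (pow_pos hε 4)]
  have : ε ^ 4 ≤ 1 := pow_le_one₀ hε.le (by linarith)
  linarith

lemma kappa_pos (hW : 1 ≤ W) (hε : 0 < ε) (hε7 : ε < 1 / 7) : 0 < kappa W ε C := by
  have h1 := periodConst_pos (C := C) hε hε7
  have h2 : (0 : ℝ) < W := by exact_mod_cast hW
  unfold kappa
  positivity

lemma insertPeriod_ge (ε C : ℝ) : 10 * max C 1 / ε ≤ insertPeriod ε C := Nat.le_ceil _

lemma ten_div_le_insertPeriod (hε : 0 < ε) : 10 / ε ≤ insertPeriod ε C := by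
  refine le_trans ?_ (insertPeriod_ge ε C)
  have h5 : (1 : ℝ) ≤ max C 1 := le_max_right _ _
  gcongr
  linarith

lemma two_le_insertPeriod (hε : 0 < ε) (hε7 : ε < 1 / 7) : 2 ≤ insertPeriod ε C := by
  have h1 := ten_div_le_insertPeriod (C := C) hε
  have h2 : (2 : ℝ) ≤ 10 / ε := by rw [le_div_iff₀ hε]; linarith
  exact_mod_cast h2.trans h1

end Constants

lemma sum_pow_le_of_labels {T : Finset Label} {b : ℝ} (hb0 : 0 ≤ b) (hb1 : b < 1) {j q : ℕ}
    (hT : ∀ G ∈ T, j ≤ G.1 ∧ G.2 < q) : ∑ G ∈ T, b ^ G.1 ≤ q * (b ^ j / (1 - b)) := by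
  set M := T.sup Prod.fst + 1 with hM
  have hsub : T ⊆ Finset.Ico j (j + M) ×ˢ Finset.range q := by
    intro G hG
    have h1 : G.1 ≤ T.sup Prod.fst := Finset.le_sup (f := Prod.fst) hG
    have h2 := hT G hG
    simp only [Finset.mem_product, Finset.mem_Ico, Finset.mem_range]
    omega
  refine (Finset.sum_le_sum_of_subset_of_nonneg hsub fun G _ _ => pow_nonneg hb0 _).trans ?_
  rw [Finset.sum_product]
  simp only [Finset.sum_const, Finset.card_range, nsmul_eq_mul]
  rw [← Finset.mul_sum, Finset.sum_Ico_eq_sum_range, Nat.add_sub_cancel_left]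
  simp only [pow_add]
  rw [← Finset.mul_sum]
  have h1 : ∑ i ∈ Finset.range M, b ^ i ≤ 1 / (1 - b) := by
    rw [le_div_iff₀ (by linarith), geom_sum_mul_neg]
    linarith [pow_nonneg hb0 M]
  have : b ^ j * ∑ i ∈ Finset.range M, b ^ i ≤ b ^ j / (1 - b) := by
    rw [div_eq_mul_one_div]
    exact mul_le_mul_of_nonneg_left h1 (pow_nonneg hb0 j)
  gcongr

variable {ε C : ℝ}

/-- The waiting term is at most `ε / 10` times the square root bound `V ^ 2 / (2 * W)` for the
optimum, and `C / N ≤ ε / 10` is at most `ε / 5` of the optimum because the optimum is at least `1 /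
2`. -/
lemma IsInstance.negligible {p c : Fin m → ℝ} (h : IsInstance W ε C p c) (hε7 : ε < 1 / 7)
    (hC : 0 ≤ C) {Q : Finset Label} (hQ : Q ⊆ (rounded W ε p c).labels)
    (hw : (∑ G ∈ Q, (rounded W ε p c).weight G) ^ 2 ≤ ε / (10 * insertPeriod ε C * W) *
      (∑ G ∈ (rounded W ε p c).labels, (rounded W ε p c).weight G) ^ 2) :
    LB (rounded W ε p c) 1 Q (1 / insertPeriod ε C) ≤ ENNReal.ofReal (3 * ε / 10) *
      opt W (rounded W ε p c).p (rounded W ε p c).c := by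
  set D := rounded W ε p c with hD
  set N := insertPeriod ε C with hNdef
  set V := ∑ G ∈ D.labels, D.weight G with hV
  have hε := h.eps_pos
  have hN2 : 2 ≤ N := two_le_insertPeriod hε hε7
  have hN0 : (0 : ℝ) < N := by exact_mod_cast (by omega : 0 < N)
  have hW0 : (0 : ℝ) < W := by exact_mod_cast h.W_pos
  refine (LB_le_of_weights (by omega) hC h.prob_pos (fun G hG => Grouped.size_pos (hQ hG))
    (fun G hG => h.cst_le (hQ hG))).trans ?_
  have h1 : ENNReal.ofReal (V ^ 2 / (2 * W)) ≤ opt W D.p D.c := by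
    rw [hV, Grouped.sum_weight]
    exact sq_sum_sqrt_le_opt h.W_pos (fun i => (h.rounded_p_pos i).le) h.rounded_c_nonneg
  have h2 : ENNReal.ofReal (1 / 2) ≤ opt W D.p D.c :=
    half_le_opt (fun i => (h.rounded_p_pos i).le) h.rounded_p_sum h.rounded_c_nonneg
  have h3 : (N : ℝ) * (∑ G ∈ Q, D.weight G) ^ 2 / 2 ≤ ε / 10 * (V ^ 2 / (2 * W)) := by
    calc (N : ℝ) * (∑ G ∈ Q, D.weight G) ^ 2 / 2 ≤ N * (ε / (10 * N * W) * V ^ 2) / 2 := by gcongr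
      _ = _ := by field_simp
  have h4 : C / N ≤ ε / 5 * (1 / 2) := by
    rw [div_le_iff₀ hN0]
    have h5 := insertPeriod_ge ε C
    rw [div_le_iff₀ hε] at h5
    have := le_max_left C 1
    nlinarith
  calc ENNReal.ofReal (N * (∑ G ∈ Q, D.weight G) ^ 2 / 2 + C / N) ≤
        ENNReal.ofReal (ε / 10 * (V ^ 2 / (2 * W)) + ε / 5 * (1 / 2)) :=
        ENNReal.ofReal_le_ofReal (add_le_add h3 h4)
    _ = ENNReal.ofReal (ε / 10) * ENNReal.ofReal (V ^ 2 / (2 * W)) +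
          ENNReal.ofReal (ε / 5) * ENNReal.ofReal (1 / 2) := by
        rw [ENNReal.ofReal_add (by positivity) (by positivity), ENNReal.ofReal_mul (by positivity),
          ENNReal.ofReal_mul (by positivity)]
    _ ≤ ENNReal.ofReal (ε / 10) * opt W D.p D.c + ENNReal.ofReal (ε / 5) * opt W D.p D.c := by
        gcongr
    _ = _ := by
        rw [← add_mul, ← ENNReal.ofReal_add (by positivity) (by positivity)]
        congr 2
        ring

/-- The total weight of the small groups of small probability is negligible. -/
lemma exists_window (hε : 0 < ε) {δ : ℝ} (hδ : 0 < δ) (s : ℝ) (hs : 0 ≤ s) :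
    ∃ J : ℕ, ∀ (m : ℕ) (p c : Fin m → ℝ), IsInstance W ε C p c → ∀ j0 : ℕ,
      (∃ G ∈ (rounded W ε p c).labels, G.1 = j0) → ∀ Q ⊆ (rounded W ε p c).labels,
      (∀ G ∈ Q, j0 + J ≤ G.1 ∧ ((rounded W ε p c).size G : ℝ) ≤ s) →
      ∑ G ∈ Q, (rounded W ε p c).weight G ≤
        δ * ∑ G ∈ (rounded W ε p c).labels, (rounded W ε p c).weight G := by
  set b := √(1 / (1 + ε)) with hb
  have hb0 : 0 < b := Real.sqrt_pos.2 (by positivity)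
  have hb1 : b < 1 := by
    rw [hb, Real.sqrt_lt' one_pos, one_pow, div_lt_one (by linarith)]; linarith
  set q := ⌊C * W / ε⌋₊ + 1 with hq
  have h1b : 0 < 1 - b := by linarith
  -- At the level `j` there are at most `q` groups, each of weight at most `√r * s * b ^ j`. The
  -- geometric tail from `j0 + J` on is compared with one group at level `j0`, of weight at least
  -- `√r * b ^ j0`. The summand `1` keeps the denominator positive.
  obtain ⟨J, hJ⟩ := exists_pow_lt_of_lt_one
    (show 0 < δ * (1 - b) / (q * s + 1) by positivity) hb1
  refine ⟨J, fun m p c h j0 hj0 Q hQ hQs => ?_⟩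
  set D := rounded W ε p c with hD
  set r := normConst ε p with hr
  have hW0 : (0 : ℝ) < W := by exact_mod_cast h.W_pos
  have hr0 : 0 < r := lt_of_lt_of_le one_pos (normConst_bounds h.eps_pos h.p_pos h.p_sum).1
  have hprob : ∀ G : Label, √(D.prob G) = √r * b ^ G.1 := by
    intro G
    have e : D.prob G = r * (1 / (1 + ε)) ^ G.1 := by
      rw [one_div, inv_pow, ← div_eq_mul_inv]; rfl
    rw [e, Real.sqrt_mul hr0.le, hb]
    congr 1
    rw [← Real.sqrt_sq (by positivity : (0 : ℝ) ≤ √(1 / (1 + ε)) ^ G.1), ← pow_mul, mul_comm,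
      pow_mul, Real.sq_sqrt (by positivity)]
  have hG2 : ∀ G ∈ D.labels, G.2 < q := by
    intro G hG
    obtain ⟨i, -, rfl⟩ := Finset.mem_image.1 hG
    refine Nat.lt_succ_of_le (Nat.floor_le_floor ?_)
    have := h.c_le i
    gcongr
  have hVlow : √r * b ^ j0 ≤ ∑ G ∈ D.labels, D.weight G := by
    obtain ⟨G, hG, rfl⟩ := hj0
    refine le_trans ?_ (Finset.single_le_sum (fun H _ => D.weight_nonneg H) hG)
    rw [Grouped.weight, hprob]
    refine le_mul_of_one_le_right (by positivity) ?_
    exact_mod_cast Grouped.size_pos hG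
  calc ∑ G ∈ Q, D.weight G ≤ ∑ G ∈ Q, √r * s * b ^ G.1 := by
        refine Finset.sum_le_sum fun G hG => ?_
        rw [Grouped.weight, hprob]
        have := (hQs G hG).2
        calc √r * b ^ G.1 * (D.size G : ℝ) ≤ √r * b ^ G.1 * s := by gcongr
          _ = _ := by ring
    _ = √r * s * ∑ G ∈ Q, b ^ G.1 := by rw [Finset.mul_sum]
    _ ≤ √r * s * (q * (b ^ (j0 + J) / (1 - b))) := by
        gcongr
        exact sum_pow_le_of_labels hb0.le hb1 fun G hG => ⟨(hQs G hG).1, hG2 G (hQ hG)⟩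
    _ = (q * s * b ^ J / (1 - b)) * (√r * b ^ j0) := by rw [pow_add]; field_simp
    _ ≤ δ * (√r * b ^ j0) := by
        gcongr
        rw [div_le_iff₀ h1b]
        rw [lt_div_iff₀ (by positivity)] at hJ
        nlinarith [pow_pos hb0 J]
    _ ≤ _ := by gcongr

/-- Starting with the empty `A`, let `B` contain the other groups that are large relative to `A`. If
the rest is not negligible, its weight exceeds `δ * V`; the part far beyond the most probable group
accounts for at most half of `δ * V`, and the remaining part consists of boundedly many groups of
bounded size. Adding it to `A` raises the weight of `A` by at least `δ / 2 * V`, which can happen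
only about `2 / δ` times. -/
theorem exists_isPartition (hW : 1 ≤ W) (hε : 0 < ε) (hε7 : ε < 1 / 7) (hC : 0 ≤ C) :
    ∃ K : ℕ, ∀ (m : ℕ) (p c : Fin m → ℝ), IsInstance W ε C p c →
      ∃ A B Q : Finset Label, IsPartition (rounded W ε p c) W ε C A B Q ∧
        ((rounded W ε p c).messages A).card ≤ K := by
  classical
  set N := insertPeriod ε C with hNdef
  have hN2 : 2 ≤ N := two_le_insertPeriod hε hε7
  have hN0 : (0 : ℝ) < N := by exact_mod_cast (by omega : 0 < N)
  have hW0 : (0 : ℝ) < W := by exact_mod_cast hW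
  set δ := √(ε / (10 * N * W)) with hδdef
  have hδ : 0 < δ := Real.sqrt_pos.2 (by positivity)
  have hδ2 : δ ^ 2 = ε / (10 * N * W) := Real.sq_sqrt (by positivity)
  have hκ : 0 < kappa W ε C := kappa_pos hW hε hε7
  have step : ∀ t : ℕ, ∃ K : ℕ, ∀ (m : ℕ) (p c : Fin m → ℝ), IsInstance W ε C p c →
      (∃ A B Q : Finset Label, IsPartition (rounded W ε p c) W ε C A B Q ∧
        ((rounded W ε p c).messages A).card ≤ K) ∨
      ∃ A ⊆ (rounded W ε p c).labels, ((rounded W ε p c).messages A).card ≤ K ∧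
        t * (δ / 2) * ∑ G ∈ (rounded W ε p c).labels, (rounded W ε p c).weight G ≤
          ∑ G ∈ A, (rounded W ε p c).weight G := by
    intro t
    induction t with
    | zero =>
      exact ⟨0, fun m p c h => Or.inr ⟨∅, Finset.empty_subset _, by simp [Grouped.messages], by simp⟩⟩
    | succ t ih =>
      obtain ⟨K, hK⟩ := ih
      -- The size threshold is computed from the bound `K` instead of the actual size of `A`, so
      -- that the window length `J` does not depend on the instance.
      set s : ℝ := kappa W ε C * ((max K 1 : ℕ) : ℝ) ^ 2 with hs
      have hs0 : 0 ≤ s := by positivity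
      obtain ⟨J, hJ⟩ := exists_window (W := W) (C := C) hε (half_pos hδ) s hs0
      set q := ⌊C * W / ε⌋₊ + 1 with hq
      refine ⟨K + J * q * ⌈s⌉₊, fun m p c h => ?_⟩
      rcases hK m p c h with ⟨A, B, Q, h1, h2⟩ | ⟨A, hA, hAK, hAw⟩
      · exact Or.inl ⟨A, B, Q, h1, h2.trans (Nat.le_add_right _ _)⟩
      set D := rounded W ε p c with hD
      set V := ∑ G ∈ D.labels, D.weight G with hV
      set s' : ℝ := kappa W ε C * (size1 D A : ℝ) ^ 2 with hs'
      have hss' : s' ≤ s := by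
        have : size1 D A ≤ max K 1 := max_le_max hAK le_rfl
        rw [hs, hs']
        gcongr
      set B := (D.labels \ A).filter fun G => s' ≤ D.size G with hB
      set Q := (D.labels \ A).filter fun G => ¬ s' ≤ D.size G with hQ
      have hQl : Q ⊆ D.labels := (Finset.filter_subset _ _).trans Finset.sdiff_subset
      by_cases hneg : ∑ G ∈ Q, D.weight G ≤ δ * V
      · refine Or.inl ⟨A, B, Q, ⟨?_, ?_, ?_, ?_, ?_, ?_⟩, hAK.trans (Nat.le_add_right _ _)⟩
        · rw [Finset.union_assoc, hB, hQ, Finset.filter_union_filter_not_eq,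
            Finset.union_sdiff_of_subset hA]
        · exact Finset.disjoint_of_subset_right (Finset.filter_subset _ _) Finset.disjoint_sdiff
        · exact Finset.disjoint_of_subset_right (Finset.filter_subset _ _) Finset.disjoint_sdiff
        · exact Finset.disjoint_filter_filter_not _ _ _
        · intro G hG
          exact (Finset.mem_filter.1 hG).2
        · refine h.negligible hε7 hC hQl ?_
          rw [← hδ2, ← mul_pow]
          exact pow_le_pow_left₀ (Finset.sum_nonneg fun G _ => D.weight_nonneg G) hneg 2
      · right
        push Not at hneg
        have hQne : Q.Nonempty := by
          by_contra h0
          rw [Finset.not_nonempty_iff_eq_empty] at h0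
          rw [h0, Finset.sum_empty] at hneg
          have : 0 ≤ V := Finset.sum_nonneg fun G _ => D.weight_nonneg G
          nlinarith
        -- The minimum is over all groups: `G0` only bounds the total weight from below and need not
        -- belong to `Q`.
        obtain ⟨G0, hG0, hmin⟩ := Finset.exists_min_image D.labels Prod.fst (hQne.mono hQl)
        set Tl := Q.filter fun G => G0.1 + J ≤ G.1 with hTl
        set Wn := Q.filter fun G => ¬ G0.1 + J ≤ G.1 with hWn
        have hTw : ∑ G ∈ Tl, D.weight G ≤ δ / 2 * V := by
          refine hJ m p c h G0.1 ⟨G0, hG0, rfl⟩ Tl ((Finset.filter_subset _ _).trans hQl) ?_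
          intro G hG
          have h1 := Finset.mem_filter.1 hG
          have h2 := (Finset.mem_filter.1 h1.1).2
          exact ⟨h1.2, (not_le.1 h2).le.trans hss'⟩
        have hsplit : ∑ G ∈ Tl, D.weight G + ∑ G ∈ Wn, D.weight G = ∑ G ∈ Q, D.weight G :=
          Finset.sum_filter_add_sum_filter_not _ _ _
        have hdisj : Disjoint A Wn :=
          Finset.disjoint_of_subset_right ((Finset.filter_subset _ _).trans (Finset.filter_subset _ _))
            Finset.disjoint_sdiff
        refine ⟨A ∪ Wn, Finset.union_subset hA ((Finset.filter_subset _ _).trans hQl), ?_, ?_⟩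
        · rw [Grouped.card_messages, Finset.sum_union hdisj, ← Grouped.card_messages]
          refine add_le_add hAK ?_
          have hWc : Wn.card ≤ J * q := by
            have hsub : Wn ⊆ Finset.Ico G0.1 (G0.1 + J) ×ˢ Finset.range q := by
              intro G hG
              have h1 := Finset.mem_filter.1 hG
              have h2 := hmin G (hQl h1.1)
              have h3 : G.2 < q := by
                obtain ⟨i, -, rfl⟩ := Finset.mem_image.1 (hQl h1.1)
                refine Nat.lt_succ_of_le (Nat.floor_le_floor ?_)
                have := h.c_le i
                gcongr
              simp only [Finset.mem_product, Finset.mem_Ico, Finset.mem_range]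
              omega
            refine (Finset.card_le_card hsub).trans_eq ?_
            simp
          calc ∑ G ∈ Wn, D.size G ≤ ∑ G ∈ Wn, ⌈s⌉₊ := by
                refine Finset.sum_le_sum fun G hG => ?_
                have h2 := (Finset.mem_filter.1 (Finset.mem_filter.1 hG).1).2
                have h3 : (D.size G : ℝ) ≤ ⌈s⌉₊ := ((not_le.1 h2).le.trans hss').trans (Nat.le_ceil s)
                exact_mod_cast h3
            _ = Wn.card * ⌈s⌉₊ := by simp
            _ ≤ _ := Nat.mul_le_mul_right _ hWc
        · rw [Finset.sum_union hdisj]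
          push_cast
          linarith
  obtain ⟨K, hK⟩ := step (⌈2 / δ⌉₊ + 1)
  refine ⟨K, fun m p c h => ?_⟩
  rcases hK m p c h with hp | ⟨A, hA, -, hAw⟩
  · exact hp
  exfalso
  set D := rounded W ε p c with hD
  have hle : ∑ G ∈ A, D.weight G ≤ ∑ G ∈ D.labels, D.weight G :=
    Finset.sum_le_sum_of_subset_of_nonneg hA fun G _ _ => D.weight_nonneg G
  have hpos : 0 < ∑ G ∈ D.labels, D.weight G := by
    rw [Grouped.sum_weight]
    refine Finset.sum_pos (fun i _ => Real.sqrt_pos.2 (h.rounded_p_pos i)) ?_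
    by_contra hne
    rw [Finset.not_nonempty_iff_eq_empty] at hne
    have := h.p_sum
    rw [hne, Finset.sum_empty] at this
    exact zero_ne_one this
  -- After this many rounds `A` would weigh more than all groups together.
  have h1 : 1 < ((⌈2 / δ⌉₊ + 1 : ℕ) : ℝ) * (δ / 2) := by
    have h2 : 2 / δ ≤ ⌈2 / δ⌉₊ := Nat.le_ceil _
    rw [div_le_iff₀ hδ] at h2
    push_cast
    nlinarith
  nlinarith

end Partition

/-! ## Periodic schedules made of stretched windows of a schedule -/

section Blocks

variable {W m : ℕ}

/-- The position, within a block, of the slot number `c` of a window, if one slot is inserted after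
every `h` slots of the window. -/
def windowPos (h c : ℕ) : ℕ := c + c / h

lemma windowPos_add {h : ℕ} (q : ℕ) {r : ℕ} (hr : r < h) :
    windowPos h (q * h + r) = q * (h + 1) + r := by
  rw [windowPos, mul_comm q h, Nat.mul_add_div (by omega), Nat.div_eq_of_lt hr]
  ring

lemma windowPos_strictMono (h : ℕ) : StrictMono (windowPos h) := fun a b hab => by
  have := Nat.div_le_div_right (c := h) hab.le
  simp only [windowPos]; omega

/-- Repeat, with period `L`, `Z` blocks of `b` slots. The `j`-th block is a window of `S` that
starts at `u j`, restricted to the messages of `X`, with one slot inserted after every `h` slots;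
the first inserted slots broadcast the messages of `X` one after the other. -/
def blockSchedule (S : Schedule W m) (X : Finset (Fin m)) (h b Z L : ℕ) (u : ℕ → ℕ) :
    Schedule W m := fun t k =>
  if t % L / b < Z then
    if t % L % b % (h + 1) = h then
      if k.val = 0 then (X.sort (· ≤ ·))[t % L % b / (h + 1)]? else none
    else (S (u (t % L / b) + (t % L % b / (h + 1) * h + t % L % b % (h + 1))) k).filter (· ∈ X)
  else none

section

variable {S : Schedule W m} {X : Finset (Fin m)} {h b Z L : ℕ} {u : ℕ → ℕ}

lemma blockSchedule_mem {t : ℕ} {k : Fin W} {i : Fin m}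
    (hi : blockSchedule S X h b Z L u t k = some i) : i ∈ X := by
  rw [blockSchedule] at hi
  split_ifs at hi with h1 h2 h3
  · have := List.mem_of_getElem? hi
    simpa using this
  · exact of_decide_eq_true (Option.filter_eq_some_iff.1 hi).2

lemma blockSchedule_periodic (t : ℕ) (k : Fin W) :
    blockSchedule S X h b Z L u (t + L) k = blockSchedule S X h b Z L u t k := by
  simp only [blockSchedule, Nat.add_mod_right]

lemma block_mod {j v : ℕ} (hj : j < Z) (hv : v < b) (hL : Z * b ≤ L) :
    (j * b + v) % L = j * b + v ∧ (j * b + v) / b = j ∧ (j * b + v) % b = v := by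
  refine ⟨Nat.mod_eq_of_lt ?_, ?_, ?_⟩
  · have : (j + 1) * b ≤ Z * b := Nat.mul_le_mul_right _ hj
    rw [Nat.succ_mul] at this
    omega
  · rw [mul_comm, Nat.mul_add_div (by omega), Nat.div_eq_of_lt hv, add_zero]
  · rw [mul_comm, Nat.mul_add_mod, Nat.mod_eq_of_lt hv]

lemma window_mod {q r : ℕ} (hr : r ≤ h) :
    (q * (h + 1) + r) / (h + 1) = q ∧ (q * (h + 1) + r) % (h + 1) = r := by
  constructor
  · rw [mul_comm, Nat.mul_add_div (by omega), Nat.div_eq_of_lt (by omega), add_zero]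
  · rw [mul_comm, Nat.mul_add_mod, Nat.mod_eq_of_lt (by omega)]

lemma blockSchedule_window {j c : ℕ} (hh : 1 ≤ h) (hj : j < Z) (hv : windowPos h c < b)
    (hL : Z * b ≤ L) (k : Fin W) :
    blockSchedule S X h b Z L u (j * b + windowPos h c) k = (S (u j + c) k).filter (· ∈ X) := by
  obtain ⟨e1, e2, e3⟩ := block_mod hj hv hL
  have hc : c = c / h * h + c % h := (Nat.div_add_mod' c h).symm
  have hr : c % h < h := Nat.mod_lt _ (by omega)
  have hp : windowPos h c = c / h * (h + 1) + c % h := by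
    conv_lhs => rw [hc]
    exact windowPos_add _ hr
  obtain ⟨e4, e5⟩ := window_mod (q := c / h) hr.le
  rw [blockSchedule, e1, e2, e3, if_pos hj, hp, e4, e5, if_neg hr.ne, ← hc]

lemma blockSchedule_inserted {j q : ℕ} (hj : j < Z) (hv : q * (h + 1) + h < b)
    (hL : Z * b ≤ L) (k : Fin W) :
    blockSchedule S X h b Z L u (j * b + (q * (h + 1) + h)) k =
      if k.val = 0 then (X.sort (· ≤ ·))[q]? else none := by
  obtain ⟨e1, e2, e3⟩ := block_mod hj hv hL
  obtain ⟨e4, e5⟩ := window_mod (q := q) (le_refl h)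
  rw [blockSchedule, e1, e2, e3, if_pos hj, e4, e5, if_pos rfl]

lemma exists_inserted_broadcast (hW : 1 ≤ W) {i : Fin m} (hi : i ∈ X) {j : ℕ} (hj : j < Z)
    (hb : X.card * (h + 1) ≤ b) (hL : Z * b ≤ L) :
    ∃ v, v < X.card * (h + 1) ∧ ∃ k, blockSchedule S X h b Z L u (j * b + v) k = some i := by
  have hmem : i ∈ X.sort (· ≤ ·) := by simpa using hi
  obtain ⟨q, hq, hqi⟩ := List.mem_iff_getElem.1 hmem
  have hqX : q < X.card := by simpa using hq
  have h1 : (q + 1) * (h + 1) ≤ X.card * (h + 1) := Nat.mul_le_mul_right _ hqX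
  rw [Nat.succ_mul] at h1
  refine ⟨q * (h + 1) + h, by omega, ⟨0, by omega⟩, ?_⟩
  rw [blockSchedule_inserted hj (by omega) hL, if_pos rfl, List.getElem?_eq_getElem hq, hqi]

/-- After the end of a block it takes at most `|X| (h + 1)` slots of the next block until all
messages are broadcast. -/
lemma countWait_blockSchedule_le (hW : 1 ≤ W) {i : Fin m} (hi : i ∈ X)
    (hb : X.card * (h + 1) ≤ b) (hL : Z * b ≤ L) {j v : ℕ} (hj : j < Z) (hv : v < b) :
    countWait (airs (blockSchedule S X h b Z L u) i) 1 (j * b + v) ≤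
      ((b - v + (X.card * (h + 1) + (L - Z * b)) : ℕ) : ℝ≥0∞) := by
  rcases Nat.lt_or_ge (j + 1) Z with hj1 | hj1
  · obtain ⟨w, hw, k, hk⟩ := exists_inserted_broadcast (S := S) (u := u) hW hi hj1 hb hL
    refine (countWait_airs_le (s := (j + 1) * b + w) ?_ ⟨k, hk⟩).trans ?_
    · rw [Nat.succ_mul]; omega
    · rw [Nat.succ_mul]
      exact_mod_cast (by omega)
  · have hjZ : Z = j + 1 := by omega
    obtain ⟨w, hw, k, hk⟩ := exists_inserted_broadcast (S := S) (u := u) (j := 0) hW hi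
      (by omega) hb hL
    rw [zero_mul, zero_add, ← blockSchedule_periodic] at hk
    refine (countWait_airs_le (s := w + L) ?_ ⟨k, hk⟩).trans ?_
    · rw [hjZ, Nat.succ_mul] at hL; omega
    · rw [hjZ, Nat.succ_mul] at hL ⊢
      exact_mod_cast (by omega)

lemma countWait_blockSchedule_pad_le (hW : 1 ≤ W) {i : Fin m} (hi : i ∈ X) (hZ : 1 ≤ Z)
    (hb : X.card * (h + 1) ≤ b) (hL : Z * b ≤ L) {r : ℕ} (hr : r < L - Z * b) :
    countWait (airs (blockSchedule S X h b Z L u) i) 1 (Z * b + r) ≤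
      ((X.card * (h + 1) + (L - Z * b) : ℕ) : ℝ≥0∞) := by
  obtain ⟨w, hw, k, hk⟩ := exists_inserted_broadcast (S := S) (u := u) (j := 0) hW hi
    (by omega) hb hL
  rw [zero_mul, zero_add, ← blockSchedule_periodic] at hk
  refine (countWait_airs_le (s := w + L) (by omega) ⟨k, hk⟩).trans ?_
  exact_mod_cast (by omega)

/-- Bound for the waiting time of a request in the slot at position `v` of a block, if a request in
the slot number `c` of the window waits `d` slots in the original schedule. -/
def blockWait (h b R c d v : ℕ) : ℕ :=
  (windowPos h (c + d) - v) + if windowPos h c < b ∧ b ≤ windowPos h (c + d) then R else 0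

/-- If the next broadcast of the original schedule still belongs to the block, its copy serves the
request; `u j + b ≤ n` excludes that this "broadcast" is merely the end of the truncated schedule.
Otherwise the request waits for the inserted broadcasts at the beginning of the following block,
possibly after the padding at the end of the period. -/
lemma countWait_blockSchedule_le_blockWait (hW : 1 ≤ W) (hh : 1 ≤ h) {i : Fin m} (hi : i ∈ X)
    (hb : X.card * (h + 1) ≤ b) (hL : Z * b ≤ L) {j v n c : ℕ} (hj : j < Z)
    (hv : v < b) (hn : u j + b ≤ n) (hcn : u j + c < n) (hcv : windowPos h c ≤ v)
    (hvc : v < windowPos h (c + 1)) :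
    countWait (airs (blockSchedule S X h b Z L u) i) 1 (j * b + v) ≤
      (blockWait h b (X.card * (h + 1) + (L - Z * b)) c
        (nextTime S n i (u j + c) - (u j + c)) v : ℕ) := by
  set y := nextTime S n i (u j + c) with hy
  have hlt : u j + c < y := lt_nextTime hcn
  set d := y - (u j + c) with hd
  have hcb : windowPos h c < b := hcv.trans_lt hv
  rcases Nat.lt_or_ge (windowPos h (c + d)) b with hin | hout
  · have hle : c + d ≤ windowPos h (c + d) := Nat.le_add_right _ _
    obtain ⟨-, k, hk⟩ := (nextTime_eq_end_or (S := S) (n := n) (i := i) (t := u j + c)).resolve_left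
      (by omega)
    have hyd : u j + (c + d) = y := by omega
    have hk' : blockSchedule S X h b Z L u (j * b + windowPos h (c + d)) k = some i := by
      rw [blockSchedule_window hh hj hin hL, hyd, hk]
      simp [Option.filter, hi]
    have hmono : windowPos h (c + 1) ≤ windowPos h (c + d) :=
      (windowPos_strictMono h).monotone (by omega)
    refine (countWait_airs_le (s := j * b + windowPos h (c + d)) (by omega) ⟨k, hk'⟩).trans ?_
    rw [blockWait, if_neg (by omega), add_zero]
    exact_mod_cast (by omega)
  · refine (countWait_blockSchedule_le hW hi hb hL hj hv).trans ?_
    rw [blockWait, if_pos ⟨hcb, hout⟩]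
    exact_mod_cast (by omega)

end

/-! ### Sums over blocks and over all windows -/

lemma sum_block_le {α : Type*} [AddCommMonoid α] [PartialOrder α] [IsOrderedAddMonoid α]
    [CanonicallyOrderedAdd α] {h b K : ℕ} (hbK : b ≤ K * (h + 1)) {g G1 G2 : ℕ → α}
    (h1 : ∀ q r, r < h → q * (h + 1) + r < b → g (q * (h + 1) + r) ≤ G1 (q * h + r))
    (h2 : ∀ q, q * (h + 1) + h < b → g (q * (h + 1) + h) ≤ G2 q) :
    ∑ v ∈ Finset.range b, g v ≤
      ∑ c ∈ Finset.range (K * h), G1 c + ∑ q ∈ Finset.range K, G2 q := by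
  calc ∑ v ∈ Finset.range b, g v = ∑ v ∈ Finset.range b, (if v < b then g v else 0) :=
        Finset.sum_congr rfl fun v hv => (if_pos (Finset.mem_range.1 hv)).symm
    _ ≤ ∑ v ∈ Finset.range (K * (h + 1)), (if v < b then g v else 0) :=
        Finset.sum_le_sum_of_subset (Finset.range_mono hbK)
    _ ≤ ∑ q ∈ Finset.range K, (∑ r ∈ Finset.range h, G1 (q * h + r) + G2 q) := by
        rw [sum_range_mul_eq]
        refine Finset.sum_le_sum fun q _ => ?_
        rw [Finset.sum_range_succ]
        refine add_le_add (Finset.sum_le_sum fun r hr => ?_) ?_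
        · split_ifs with hb
          exacts [h1 q r (Finset.mem_range.1 hr) hb, zero_le]
        · split_ifs with hb
          exacts [h2 q hb, zero_le]
    _ = _ := by rw [Finset.sum_add_distrib, ← sum_range_mul_eq]

/-- Double counting: over all window starts `s`, a fixed slot of the original schedule appears at
most once at a fixed position `c` of the window. -/
lemma sum_windows_le {α : Type*} [AddCommMonoid α] [PartialOrder α] [IsOrderedAddMonoid α]
    {M l n : ℕ} (hn : M + l ≤ n) (w : ℕ → ℕ) {k : ℕ}
    (hw : ∀ c < k, w c ≤ l) (g : ℕ → ℕ → α) (hg : ∀ u c, 0 ≤ g u c) :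
    ∑ s ∈ Finset.range M, ∑ c ∈ Finset.range k, g (s + w c) c ≤
      ∑ u ∈ Finset.range n, ∑ c ∈ Finset.range k, g u c := by
  rw [Finset.sum_comm, Finset.sum_comm (s := Finset.range n)]
  refine Finset.sum_le_sum fun c hc => ?_
  have hwc := hw c (Finset.mem_range.1 hc)
  calc ∑ s ∈ Finset.range M, g (s + w c) c ≤ ∑ u ∈ Finset.range (M + w c), g u c := by
        rw [add_comm M, Finset.sum_range_add]
        simp only [add_comm (w c)]
        exact le_add_of_nonneg_left (Finset.sum_nonneg fun u _ => hg u c)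
    _ ≤ _ := Finset.sum_le_sum_of_subset_of_nonneg (Finset.range_mono (by omega))
        fun u _ _ => hg u c

/-- As in the insertion of the negligible messages, the stretch of a wait `d` is exactly `(h + 1) /
h` on average over the positions, without rounding errors. -/
lemma sum_windowPos_add {h : ℕ} (hh : 1 ≤ h) (K d : ℕ) :
    ∑ c ∈ Finset.range (K * h), windowPos h (c + d) =
      ∑ c ∈ Finset.range (K * h), windowPos h c + K * (h + 1) * d := by
  have hdiv : ∀ d, ∑ c ∈ Finset.range (K * h), (c + d) / h =
      ∑ q ∈ Finset.range K, q * h + K * d := by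
    intro d
    rw [sum_range_mul_eq]
    have : ∀ q, ∑ r ∈ Finset.range h, (q * h + r + d) / h = q * h + d := by
      intro q
      rw [← sum_add_div hh (q * h + d)]
      exact Finset.sum_congr rfl fun r _ => by congr 1; omega
    simp only [this]
    rw [Finset.sum_add_distrib, Finset.sum_const, Finset.card_range, smul_eq_mul]
  have h0 := hdiv 0
  simp only [add_zero, mul_zero] at h0
  simp only [windowPos]
  rw [Finset.sum_add_distrib, Finset.sum_add_distrib, Finset.sum_add_distrib, hdiv, h0,
    Finset.sum_const, Finset.card_range, smul_eq_mul]
  ring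

/-- A wait of length `d` crosses the end of the block only from the last `d` positions before it. So
a crossing penalty `R` costs at most `R * d` in total. -/
lemma card_cross_le (h b d k : ℕ) :
    ((Finset.range k).filter fun c => windowPos h c < b ∧ b ≤ windowPos h (c + d)).card ≤ d := by
  set F := (Finset.range k).filter fun c => windowPos h c < b ∧ b ≤ windowPos h (c + d) with hF
  rcases F.eq_empty_or_nonempty with h0 | hne
  · rw [h0]; simp
  obtain ⟨c0, hc0, hmin⟩ := Finset.exists_min_image F id hne
  have hsub : F ⊆ Finset.Ico c0 (c0 + d) := by
    intro c hc
    refine Finset.mem_Ico.2 ⟨hmin c hc, ?_⟩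
    have h1 := (Finset.mem_filter.1 hc).2.1
    have h2 := (Finset.mem_filter.1 hc0).2.2
    exact (windowPos_strictMono h).lt_iff_lt.1 (h1.trans_le h2)
  simpa using Finset.card_le_card hsub

lemma sum_blockWait_window_le {h : ℕ} (hh : 1 ≤ h) (b R K d : ℕ) :
    ∑ c ∈ Finset.range (K * h), blockWait h b R c d (windowPos h c) ≤
      K * (h + 1) * d + R * d := by
  simp only [blockWait]
  rw [Finset.sum_add_distrib, ← Finset.sum_filter, Finset.sum_const, smul_eq_mul, mul_comm R,
    Finset.sum_tsub_distrib _ fun c _ => (windowPos_strictMono h).monotone (Nat.le_add_right c d),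
    sum_windowPos_add hh, Nat.add_sub_cancel_left]
  exact Nat.add_le_add_left (Nat.mul_le_mul_right _ (card_cross_le h b d _)) _

/-- A request in the inserted slot number `q` is charged to the window slot `q * h + (h - 1)`
immediately before it. Distinct `q` give distinct slots, so the bound on crossings applies again. -/
lemma sum_blockWait_inserted_le {h : ℕ} (hh : 1 ≤ h) (b R K : ℕ) {d : ℕ} (hd : 1 ≤ d) :
    ∑ q ∈ Finset.range K, blockWait h b R (q * h + (h - 1)) d (q * (h + 1) + h) ≤
      K * (d + d / h) + R * d := by
  simp only [blockWait]
  rw [Finset.sum_add_distrib]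
  refine add_le_add ?_ ?_
  · calc _ ≤ ∑ q ∈ Finset.range K, (d + d / h) := by
          refine Finset.sum_le_sum fun q _ => ?_
          have e : q * h + (h - 1) + d = (q + 1) * h + (d - 1) := by rw [Nat.succ_mul]; omega
          rw [e, windowPos, mul_comm (q + 1) h, Nat.mul_add_div (by omega)]
          have := Nat.div_le_div_right (c := h) (by omega : d - 1 ≤ d)
          have e2 : h * (q + 1) = q * h + h := by ring
          have e3 : q * (h + 1) = q * h + q := by ring
          generalize d / h = x at *
          generalize (d - 1) / h = y at *
          omega
      _ = _ := by simp
  · rw [← Finset.sum_filter, Finset.sum_const, smul_eq_mul, mul_comm R]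
    refine Nat.mul_le_mul_right _ ((Finset.card_le_card_of_injOn (fun q => q * h + (h - 1))
      ?_ ?_).trans (card_cross_le h b d (K * h)))
    · intro q hq
      rw [Finset.mem_coe, Finset.mem_filter, Finset.mem_range] at hq
      rw [Finset.mem_coe, Finset.mem_filter, Finset.mem_range]
      refine ⟨?_, hq.2⟩
      have : (q + 1) * h ≤ K * h := Nat.mul_le_mul_right _ hq.1
      rw [Nat.succ_mul] at this
      dsimp only
      omega
    · intro q _ q' _ hqq
      have : q * h = q' * h := by dsimp only at hqq; omega
      exact Nat.eq_of_mul_eq_mul_right (by omega) this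

end Blocks

/-! ### Cost and density of the periodic block schedules -/

section Periodic

variable {W m : ℕ}

/-- The total weight of the messages of `X` broadcast in the slot `t`. -/
def slotSum {α : Type*} [AddCommMonoid α] (w : Fin m → α) (X : Finset (Fin m)) (S : Schedule W m)
    (t : ℕ) : α := ∑ k : Fin W, ∑ i ∈ X, if S t k = some i then w i else 0

/-- The converse of `slotCostInf_average_le`: replacing truncated waits by untruncated ones only
increases the cost. -/
lemma periodic_cost_add_half_le {p c : Fin m → ℝ} {X : Finset (Fin m)} {S : Schedule W m}
    (hp : ∀ i, 0 ≤ p i) (hc : ∀ i, 0 ≤ c i) {P : ℕ} (hP : 1 ≤ P)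
    (hS : ∀ t k, S (t + P) k = S t k) :
    cost p c X S + ENNReal.ofReal ((∑ i ∈ X, p i) / 2) ≤
      (∑ u ∈ Finset.range P, slotCostInf p c X S u) / P := by
  refine (cost_add_half_le hp hc (y := slotCostInf p c X S) fun n t _ => ?_).trans
    (limsup_average_le_of_periodic _ hP fun t => ?_)
  · unfold slotCost slotCostInf
    gcongr
    exact nextTime_sub_le_countWait
  · have h1 : S (t + P) = S t := funext fun k => hS t k
    have h2 : ∀ i, (fun s => airs S i (s + P)) = airs S i := by
      intro i
      funext s
      simp only [airs, hS]
    simp only [slotCostInf, countWait_shift le_rfl, h2, slotBc, h1]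

lemma sum_getElem_le {α : Type*} [AddCommMonoid α] [PartialOrder α] [IsOrderedAddMonoid α]
    [CanonicallyOrderedAdd α] (w : Fin m → α) (X : Finset (Fin m)) (K : ℕ) :
    ∑ q ∈ Finset.range K, ∑ i ∈ X, (if (X.sort (· ≤ ·))[q]? = some i then w i else 0) ≤
      ∑ i ∈ X, w i := by
  rw [Finset.sum_comm]
  refine Finset.sum_le_sum fun i _ => ?_
  rw [← Finset.sum_filter, Finset.sum_const]
  have hcard : ((Finset.range K).filter fun q => (X.sort (· ≤ ·))[q]? = some i).card ≤ 1 := by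
    refine Finset.card_le_one.2 fun q hq q' hq' => ?_
    have h1 := (Finset.mem_filter.1 hq).2
    have h2 := (Finset.mem_filter.1 hq').2
    have hlt := (List.getElem?_eq_some_iff.1 h1).1
    exact (List.getElem?_inj hlt (X.sort_nodup (· ≤ ·))).1 (by rw [h1, h2])
  calc _ ≤ 1 • w i := nsmul_le_nsmul_left zero_le hcard
    _ = w i := one_nsmul _

variable {S : Schedule W m} {X : Finset (Fin m)} {h b Z L : ℕ} {u : ℕ → ℕ}

lemma slotSum_block_le {α : Type*} [AddCommMonoid α] [PartialOrder α] [IsOrderedAddMonoid α]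
    [CanonicallyOrderedAdd α] (hW : 1 ≤ W) (w : Fin m → α) (hh : 1 ≤ h) {K : ℕ}
    (hbK : b ≤ K * (h + 1)) (hL : Z * b ≤ L) {j : ℕ} (hj : j < Z) :
    ∑ v ∈ Finset.range b, slotSum w X (blockSchedule S X h b Z L u) (j * b + v) ≤
      ∑ c ∈ Finset.range (K * h), slotSum w X S (u j + c) + ∑ i ∈ X, w i := by
  refine (sum_block_le hbK (G1 := fun c => slotSum w X S (u j + c))
    (G2 := fun q => ∑ i ∈ X, if (X.sort (· ≤ ·))[q]? = some i then w i else 0) ?_ ?_).trans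
    (add_le_add le_rfl (sum_getElem_le w X K))
  · intro q r hr hb
    refine le_of_eq ?_
    rw [slotSum, slotSum, ← windowPos_add q hr]
    refine Finset.sum_congr rfl fun k _ => Finset.sum_congr rfl fun i hi => ?_
    rw [blockSchedule_window hh hj (by rwa [windowPos_add q hr]) hL]
    simp [Option.filter_eq_some_iff, hi]
  · intro q hb
    rw [slotSum, Finset.sum_eq_single (⟨0, by omega⟩ : Fin W)]
    · simp only [blockSchedule_inserted hj hb hL]
      simp
    · intro k _ hk
      refine Finset.sum_eq_zero fun i _ => ?_
      rw [blockSchedule_inserted hj hb hL, if_neg (fun h0 => hk (Fin.ext h0))]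
      simp
    · intro hn
      exact absurd (Finset.mem_univ _) hn

lemma blockSchedule_pad (hb : 1 ≤ b) {r : ℕ} (hr : Z * b + r < L) (k : Fin W) :
    blockSchedule S X h b Z L u (Z * b + r) k = none := by
  rw [blockSchedule, if_neg]
  rw [Nat.mod_eq_of_lt hr, not_lt, Nat.le_div_iff_mul_le (by omega)]
  omega

lemma slotSum_pad {α : Type*} [AddCommMonoid α] (w : Fin m → α) (hb : 1 ≤ b) {r : ℕ}
    (hr : Z * b + r < L) : slotSum w X (blockSchedule S X h b Z L u) (Z * b + r) = 0 := by
  refine Finset.sum_eq_zero fun k _ => Finset.sum_eq_zero fun i _ => ?_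
  rw [blockSchedule_pad hb hr]
  simp

lemma sum_period {α : Type*} [AddCommMonoid α] (hL : Z * b ≤ L) (g : ℕ → α) :
    ∑ t ∈ Finset.range L, g t = ∑ j ∈ Finset.range Z, ∑ v ∈ Finset.range b, g (j * b + v) +
      ∑ r ∈ Finset.range (L - Z * b), g (Z * b + r) := by
  conv_lhs => rw [show L = Z * b + (L - Z * b) by omega]
  rw [Finset.sum_range_add, sum_range_mul_eq]

/-- Bound for the total waiting time for a message over a block whose window starts at `s`. -/
def blockWaitSum (S : Schedule W m) (n h b R K : ℕ) (i : Fin m) (s : ℕ) : ℕ :=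
  ∑ c ∈ Finset.range (K * h),
      blockWait h b R c (nextTime S n i (s + c) - (s + c)) (windowPos h c) +
    ∑ q ∈ Finset.range K, blockWait h b R (q * h + (h - 1))
      (nextTime S n i (s + (q * h + (h - 1))) - (s + (q * h + (h - 1)))) (q * (h + 1) + h)

lemma sum_countWait_block_le (hW : 1 ≤ W) (hh : 1 ≤ h) {i : Fin m} (hi : i ∈ X)
    (hb : X.card * (h + 1) ≤ b) (hL : Z * b ≤ L) {K n j : ℕ} (hbK : b ≤ K * (h + 1)) (hj : j < Z)
    (hn : u j + b ≤ n) :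
    ∑ v ∈ Finset.range b, countWait (airs (blockSchedule S X h b Z L u) i) 1 (j * b + v) ≤
      (blockWaitSum S n h b (X.card * (h + 1) + (L - Z * b)) K i (u j) : ℕ) := by
  rw [blockWaitSum, Nat.cast_add, Nat.cast_sum, Nat.cast_sum]
  refine sum_block_le hbK ?_ ?_
  · intro q r hr hv
    have e := windowPos_add q hr
    have hle : q * h + r ≤ windowPos h (q * h + r) := Nat.le_add_right _ _
    have := countWait_blockSchedule_le_blockWait (S := S) (u := u) hW hh hi hb hL hj hv hn
      (c := q * h + r) (by omega) e.le (by rw [← e]; exact windowPos_strictMono h (Nat.lt_succ_self _))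
    rwa [e]
  · intro q hv
    have e := windowPos_add q (show h - 1 < h by omega)
    have e2 : windowPos h (q * h + (h - 1) + 1) = (q + 1) * (h + 1) := by
      have := windowPos_add (q + 1) (show 0 < h by omega)
      rw [add_zero, add_zero] at this
      rw [← this, Nat.succ_mul]
      congr 1; omega
    have e3 : (q + 1) * (h + 1) = q * (h + 1) + (h + 1) := Nat.succ_mul _ _
    have hle : q * h + (h - 1) ≤ windowPos h (q * h + (h - 1)) := Nat.le_add_right _ _
    exact countWait_blockSchedule_le_blockWait (S := S) (u := u) hW hh hi hb hL hj hv hn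
      (c := q * h + (h - 1)) (by omega) (by omega) (by omega)

/-- The factor splits into `K * (h + 1)` for the window slots, `K * (1 + 1 / h)` for the inserted
slots, and `R` for the crossings from each of the two kinds. -/
lemma sum_blockWaitSum_le (hh : 1 ≤ h) (S : Schedule W m) {n M K : ℕ} (b R : ℕ) (i : Fin m)
    (hn : M + K * h ≤ n) :
    (∑ s ∈ Finset.range M, (blockWaitSum S n h b R K i s : ℝ)) ≤
      (K * (h + 1) * (1 + 1 / h) + 2 * R) * ∑ t ∈ Finset.range n, ((nextTime S n i t : ℝ) - t) := by
  set d : ℕ → ℕ := fun t => nextTime S n i t - t with hd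
  have hnat : ∑ s ∈ Finset.range M, blockWaitSum S n h b R K i s ≤
      ∑ t ∈ Finset.range n, ((K * (h + 1) * d t + R * d t) + (K * (d t + d t / h) + R * d t)) := by
    simp only [blockWaitSum]
    rw [Finset.sum_add_distrib, Finset.sum_add_distrib]
    refine add_le_add ?_ ?_
    · refine (sum_windows_le hn (fun c => c) (fun c hc => hc.le)
        (fun u c => blockWait h b R c (d u) (windowPos h c)) fun _ _ => Nat.zero_le _).trans ?_
      exact Finset.sum_le_sum fun t _ => sum_blockWait_window_le hh b R K (d t)
    · refine (sum_windows_le hn (fun q => q * h + (h - 1)) (fun q hq => ?_)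
        (fun u q => blockWait h b R (q * h + (h - 1)) (d u) (q * (h + 1) + h))
        fun _ _ => Nat.zero_le _).trans ?_
      · have : (q + 1) * h ≤ K * h := Nat.mul_le_mul_right _ hq
        rw [Nat.succ_mul] at this
        omega
      · refine Finset.sum_le_sum fun t ht => sum_blockWait_inserted_le hh b R K ?_
        have : t < nextTime S n i t := lt_nextTime (Finset.mem_range.1 ht)
        simp only [hd]; omega
  have hh0 : (0 : ℝ) < h := by exact_mod_cast hh
  calc (∑ s ∈ Finset.range M, (blockWaitSum S n h b R K i s : ℝ)) ≤
        ∑ t ∈ Finset.range n, (((K * (h + 1) * d t + R * d t) +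
          (K * (d t + d t / h) + R * d t) : ℕ) : ℝ) := by exact_mod_cast hnat
    _ ≤ ∑ t ∈ Finset.range n, (K * (h + 1) * (1 + 1 / h) + 2 * R) * (d t : ℝ) := by
        refine Finset.sum_le_sum fun t _ => ?_
        have h1 : ((d t / h : ℕ) : ℝ) ≤ (d t : ℝ) / h := Nat.cast_div_le
        have h2 : (K : ℝ) * ((d t / h : ℕ) : ℝ) ≤ K * ((d t : ℝ) / h) := by gcongr
        push_cast
        have h3 : ((K : ℝ) * (h + 1) * (1 + 1 / h) + 2 * R) * (d t : ℝ) =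
            K * (h + 1) * d t + K * d t + K * ((d t : ℝ) / h) + 2 * R * d t := by
          field_simp; ring
        rw [h3]
        linarith
    _ = _ := by
        rw [← Finset.mul_sum]
        congr 1
        refine Finset.sum_congr rfl fun t ht => ?_
        exact Nat.cast_sub (lt_nextTime (Finset.mem_range.1 ht)).le

lemma sum_wait_eq (p : Fin m → ℝ) (X : Finset (Fin m)) (S : Schedule W m) {n : ℕ} (hn : 1 ≤ n) :
    ∑ i ∈ X, p i * ∑ t ∈ Finset.range n, ((nextTime S n i t : ℝ) - t) =
      n * (ert p X S n + (∑ i ∈ X, p i) / 2) := by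
  have hn0 : (n : ℝ) ≠ 0 := by exact_mod_cast (by omega : n ≠ 0)
  have h1 : n * ert p X S n = ∑ i ∈ X, p i * ∑ t ∈ Finset.range n,
      ((nextTime S n i t : ℝ) - t - 1 / 2) := by
    rw [ert, mul_div_cancel₀ _ hn0, Finset.sum_comm]
    exact Finset.sum_congr rfl fun i _ => by rw [Finset.mul_sum]
  have h2 : ∀ i, ∑ t ∈ Finset.range n, ((nextTime S n i t : ℝ) - t - 1 / 2) =
      ∑ t ∈ Finset.range n, ((nextTime S n i t : ℝ) - t) - n * (1 / 2) := by
    intro i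
    rw [Finset.sum_sub_distrib (f := fun t => (nextTime S n i t : ℝ) - t)]
    simp
  simp only [h2, mul_sub] at h1
  rw [Finset.sum_sub_distrib, ← Finset.sum_mul] at h1
  linarith

/-- Every finite schedule can be turned into a periodic one, of almost the same cost, that leaves
some more slots empty. -/
theorem exists_periodic_schedule (hW : 1 ≤ W) {p c : Fin m → ℝ} (hp : ∀ i, 0 ≤ p i)
    (hc : ∀ i, 0 ≤ c i) (X : Finset (Fin m)) (S : Schedule W m) {h Z L b K n R : ℕ} (hh : 1 ≤ h)
    (hb1 : 1 ≤ b) (hZb : Z * b ≤ L) (hL : 1 ≤ L) (hb : X.card * (h + 1) ≤ b)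
    (hbK : b ≤ K * (h + 1)) (hn : K * (h + 1) < n) (hZ : 1 ≤ Z)
    (hR : X.card * (h + 1) + (L - Z * b) = R) :
    ∃ S' : Schedule W m, (∀ t k i, S' t k = some i → i ∈ X) ∧
      (∀ t k, S' (t + L) k = S' t k) ∧
      ((∑ t ∈ Finset.range L, occupied S' X t : ℕ) : ℝ) ≤
        Z * (K * h * ((∑ t ∈ Finset.range n, occupied S X t : ℕ) : ℝ) / (n - K * (h + 1))) +
          W * (K * h) + Z * X.card ∧
      cost p c X S' + ENNReal.ofReal ((∑ i ∈ X, p i) / 2) ≤ ENNReal.ofReal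
        ((Z * (((K * (h + 1) * (1 + 1 / h) + 2 * R) * (n * (ert p X S n + (∑ i ∈ X, p i) / 2)) +
            K * h * (n * bc c X S n)) / (n - K * (h + 1))) +
          Z * ∑ i ∈ X, c i + (L - Z * b) * (R * ∑ i ∈ X, p i)) / L) := by
  set M := n - K * (h + 1) with hM
  have hM0 : 0 < M := by omega
  have hMR : (M : ℝ) = n - K * (h + 1) := by
    rw [hM, Nat.cast_sub hn.le]; push_cast; ring
  have hKh : K * h ≤ K * (h + 1) := Nat.mul_le_mul_left _ (Nat.le_succ h)
  have hMn : M + K * h ≤ n := by omega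
  have hn0 : (n : ℝ) ≠ 0 := by exact_mod_cast (by omega : n ≠ 0)
  set br : ℕ → ℝ := fun t => ∑ k : Fin W, ∑ i ∈ X, if S t k = some i then c i else 0 with hbr
  have hbr0 : ∀ t, 0 ≤ br t := fun t => Finset.sum_nonneg fun k _ => Finset.sum_nonneg fun i _ => by
    split_ifs; exacts [hc i, le_rfl]
  set dn : ℕ → ℝ := fun s => ((∑ x ∈ Finset.range (K * h), occupied S X (s + x) : ℕ) : ℝ) with hdn
  set F : ℕ → ℝ := fun s => ∑ i ∈ X, p i * (blockWaitSum S n h b R K i s : ℝ) +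
    ∑ x ∈ Finset.range (K * h), br (s + x) with hF
  -- The two coordinates are the occupied positions and the cost of a window. Their averages over
  -- all starts are controlled by the given finite schedule; the cost of the selection is at most
  -- the average, and the density exceeds it by at most one full window.
  obtain ⟨u, huI, huF, hud⟩ := exists_selection (Finset.range M) ⟨0, Finset.mem_range.2 hM0⟩ dn F
    (M := W * (K * h)) (fun s _ => Nat.cast_nonneg _) (fun s _ => by
      have : ∑ x ∈ Finset.range (K * h), occupied S X (s + x) ≤ W * (K * h) := by
        refine (Finset.sum_le_sum fun x _ => occupied_le S X (s + x)).trans_eq ?_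
        rw [Finset.sum_const, Finset.card_range, smul_eq_mul, mul_comm]
      simp only [hdn]
      exact_mod_cast this) Z
  rw [Finset.card_range] at huF hud
  have hun : ∀ j, u j + b ≤ n := fun j => by
    have := Finset.mem_range.1 (huI j)
    omega
  refine ⟨blockSchedule S X h b Z L u, fun t k i => blockSchedule_mem,
    blockSchedule_periodic, ?_, ?_⟩
  · have h1 : ∑ t ∈ Finset.range L, occupied (blockSchedule S X h b Z L u) X t ≤
        ∑ j ∈ Finset.range Z, (∑ x ∈ Finset.range (K * h), occupied S X (u j + x) + X.card) := by
      rw [sum_period hZb]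
      have h2 : ∑ r ∈ Finset.range (L - Z * b),
          occupied (blockSchedule S X h b Z L u) X (Z * b + r) = 0 :=
        Finset.sum_eq_zero fun r hr => slotSum_pad (fun _ => 1) hb1 (by
          rw [Finset.mem_range] at hr; omega)
      rw [h2, add_zero]
      refine Finset.sum_le_sum fun j hj => ?_
      have := slotSum_block_le (S := S) (X := X) (u := u) hW (fun _ => 1) hh hbK hZb
        (Finset.mem_range.1 hj)
      simpa [slotSum, occupied] using this
    have h3 : ((∑ t ∈ Finset.range L, occupied (blockSchedule S X h b Z L u) X t : ℕ) : ℝ) ≤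
        ∑ j ∈ Finset.range Z, dn (u j) + Z * X.card := by
      refine (Nat.cast_le.2 h1).trans_eq ?_
      rw [Nat.cast_sum]
      simp only [Nat.cast_add, hdn]
      rw [Finset.sum_add_distrib]
      simp
    have h4 : ∑ s ∈ Finset.range M, dn s ≤
        K * h * ((∑ t ∈ Finset.range n, occupied S X t : ℕ) : ℝ) := by
      have h5 := sum_windows_le hMn (fun x => x) (fun x hx => hx.le)
        (fun t _ => occupied S X t) fun _ _ => Nat.zero_le _
      have h6 : ∑ t ∈ Finset.range n, ∑ x ∈ Finset.range (K * h), occupied S X t =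
          K * h * ∑ t ∈ Finset.range n, occupied S X t := by
        simp only [Finset.sum_const, Finset.card_range, smul_eq_mul, Finset.mul_sum]
      rw [h6] at h5
      simp only [hdn]
      exact_mod_cast h5
    have h7 : (∑ s ∈ Finset.range M, dn s) / M ≤
        K * h * ((∑ t ∈ Finset.range n, occupied S X t : ℕ) : ℝ) / M := by gcongr
    have h8 : (Z : ℝ) * ((∑ s ∈ Finset.range M, dn s) / M) ≤
        Z * (K * h * ((∑ t ∈ Finset.range n, occupied S X t : ℕ) : ℝ) / M) := by gcongr
    rw [← hMR]
    linarith
  · refine (periodic_cost_add_half_le hp hc hL blockSchedule_periodic).trans ?_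
    have hL0 : (0 : ℝ) < L := by exact_mod_cast hL
    rw [ENNReal.ofReal_div_of_pos hL0, ENNReal.ofReal_natCast]
    refine ENNReal.div_le_div_right ?_ _
    have hper : ∑ t ∈ Finset.range L, slotCostInf p c X (blockSchedule S X h b Z L u) t ≤
        ENNReal.ofReal (∑ j ∈ Finset.range Z, (F (u j) + ∑ i ∈ X, c i) +
          (L - Z * b : ℕ) * (R * ∑ i ∈ X, p i)) := by
      have hF0 : ∀ s, 0 ≤ F s := fun s => add_nonneg
        (Finset.sum_nonneg fun i _ => mul_nonneg (hp i) (Nat.cast_nonneg _))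
        (Finset.sum_nonneg fun x _ => hbr0 _)
      have hcX : 0 ≤ ∑ i ∈ X, c i := Finset.sum_nonneg fun i _ => hc i
      have hpX : 0 ≤ ∑ i ∈ X, p i := Finset.sum_nonneg fun i _ => hp i
      rw [sum_period hZb, ENNReal.ofReal_add (Finset.sum_nonneg fun j _ => add_nonneg (hF0 _) hcX)
        (by positivity), ENNReal.ofReal_sum_of_nonneg fun j _ => add_nonneg (hF0 _) hcX]
      refine add_le_add (Finset.sum_le_sum fun j hj => ?_) ?_
      · have hjZ := Finset.mem_range.1 hj
        simp only [slotCostInf]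
        rw [Finset.sum_add_distrib, Finset.sum_comm, hF, add_assoc, ENNReal.ofReal_add
          (Finset.sum_nonneg fun i _ => mul_nonneg (hp i) (Nat.cast_nonneg _))
          (add_nonneg (Finset.sum_nonneg fun x _ => hbr0 _) hcX),
          ENNReal.ofReal_sum_of_nonneg fun i _ => mul_nonneg (hp i) (Nat.cast_nonneg _),
          ENNReal.ofReal_add (Finset.sum_nonneg fun x _ => hbr0 _) hcX,
          ENNReal.ofReal_sum_of_nonneg fun x _ => hbr0 _,
          ENNReal.ofReal_sum_of_nonneg fun i _ => hc i]
        refine add_le_add (Finset.sum_le_sum fun i hi => ?_) ?_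
        · rw [← Finset.mul_sum, ENNReal.ofReal_mul (hp i), ENNReal.ofReal_natCast, ← hR]
          gcongr
          exact sum_countWait_block_le hW hh hi hb hZb hbK hjZ (hun j)
        · have h1 := slotSum_block_le (S := S) (X := X) (u := u) hW
            (fun i => ENNReal.ofReal (c i)) hh hbK hZb hjZ
          have h2 : ∀ t, ENNReal.ofReal (br t) = slotSum (fun i => ENNReal.ofReal (c i)) X S t :=
            fun t => (slotBc_eq_ofReal hc).symm
          simp only [h2]
          exact h1
      · calc _ ≤ ∑ r ∈ Finset.range (L - Z * b), ∑ i ∈ X, ENNReal.ofReal (p i) * R := by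
              refine Finset.sum_le_sum fun r hr => ?_
              rw [Finset.mem_range] at hr
              have h0 : slotBc c X (blockSchedule S X h b Z L u) (Z * b + r) = 0 :=
                slotSum_pad (fun i => ENNReal.ofReal (c i)) hb1 (by omega)
              rw [slotCostInf, h0, add_zero]
              refine Finset.sum_le_sum fun i hi => ?_
              gcongr
              rw [← hR]
              exact countWait_blockSchedule_pad_le hW hi hZ hb hZb hr
          _ = _ := by
              rw [Finset.sum_const, Finset.card_range, nsmul_eq_mul, ← Finset.sum_mul,
                ENNReal.ofReal_mul (Nat.cast_nonneg _), ENNReal.ofReal_mul (Nat.cast_nonneg _),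
                ENNReal.ofReal_natCast, ENNReal.ofReal_natCast,
                ENNReal.ofReal_sum_of_nonneg fun i _ => hp i, mul_comm (∑ i ∈ X, _)]
    refine hper.trans (ENNReal.ofReal_le_ofReal ?_)
    have hsumF : ∑ s ∈ Finset.range M, F s ≤ (K * (h + 1) * (1 + 1 / h) + 2 * R) *
        (n * (ert p X S n + (∑ i ∈ X, p i) / 2)) + K * h * (n * bc c X S n) := by
      rw [hF, Finset.sum_add_distrib]
      refine add_le_add ?_ ?_
      · rw [Finset.sum_comm, ← sum_wait_eq p X S (by omega : 1 ≤ n), Finset.mul_sum]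
        refine Finset.sum_le_sum fun i _ => ?_
        rw [← Finset.mul_sum, ← mul_assoc, mul_comm _ (p i), mul_assoc]
        exact mul_le_mul_of_nonneg_left (sum_blockWaitSum_le hh S b R i hMn) (hp i)
      · refine (sum_windows_le hMn (fun x => x) (fun x hx => hx.le)
          (fun t _ => br t) fun t _ => hbr0 t).trans_eq ?_
        rw [bc, mul_div_cancel₀ _ hn0]
        simp only [hbr, Finset.sum_const, Finset.card_range, nsmul_eq_mul, Finset.mul_sum,
          Nat.cast_mul]
    have h7 : (∑ s ∈ Finset.range M, F s) / M ≤ ((K * (h + 1) * (1 + 1 / h) + 2 * R) *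
        (n * (ert p X S n + (∑ i ∈ X, p i) / 2)) + K * h * (n * bc c X S n)) / M := by gcongr
    have h8 : (Z : ℝ) * ((∑ s ∈ Finset.range M, F s) / M) ≤
        Z * (((K * (h + 1) * (1 + 1 / h) + 2 * R) *
        (n * (ert p X S n + (∑ i ∈ X, p i) / 2)) + K * h * (n * bc c X S n)) / M) := by gcongr
    rw [← hMR, Finset.sum_add_distrib, Nat.cast_sub hZb]
    push_cast
    simp only [Finset.sum_const, Finset.card_range, nsmul_eq_mul]
    linarith

end Periodic

/-! ### Numerical estimates for density and cost of the block schedules -/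

section Candidate

/-- Here `g = h + 1` and `θ = 1 / g` is the fraction of inserted slots. Copying windows of density
`α` gives `(1 - θ) * α` up to `7 / 50 * θ`; the extra window of the selection costs about `1 / Z = θ
/ 2`, bounded by `543 / 1000 * θ`; the inserted broadcasts cost `9 / 100 * θ`. The sum stays below
`4 / 5 * θ`, so at least `θ / 5` of the gain from the insertions is left over. -/
lemma block_density_bound {L Z K g n α w o ca ε : ℝ} (hL : 0 < L) (hg : 1 ≤ g)
    (hgε : g * ε ≤ 23 / 7) (hK : 0 ≤ K)
    (hZ : Z = 2 * g) (hα0 : 0 ≤ α) (hα1 : α ≤ 1) (hw : 1 ≤ w) (ho : o = α * (w * n))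
    (hn : K * g < n) (hnu : n ≤ (1 + 1 / 20 * (1 / g)) * (n - K * g))
    (h1 : Z * (K * g) ≤ (1 + 13 / 500 * ε) * L) (h2 : Z * g * ca ≤ 13 / 500 * ε * L) :
    Z * (K * (g - 1) * o / (n - K * g)) + w * (K * (g - 1)) + Z * ca ≤
      w * L * ((1 - 1 / g) * α + 4 / 5 * (1 / g)) := by
  have hg0 : 0 < g := by linarith
  set θ := 1 / g with hθ
  have hθ0 : 0 < θ := one_div_pos.2 hg0
  have hgθ : g * θ = 1 := by rw [hθ]; field_simp
  have hθ1 : θ ≤ 1 := by rw [hθ, div_le_one hg0]; exact hg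
  have he : 13 / 500 * ε ≤ 43 / 500 * θ := by
    have : ε ≤ 23 / 7 * θ := by
      calc ε = (g * ε) * θ := by rw [mul_right_comm, hgθ, one_mul]
        _ ≤ 23 / 7 * θ := by gcongr
    linarith
  have hM : 0 < n - K * g := by linarith
  set ν := n / (n - K * g) with hν
  have hν1 : ν ≤ 1 + 1 / 20 * θ := by rw [hν, div_le_iff₀ hM]; exact hnu
  have hν0 : 0 ≤ ν := div_nonneg (by nlinarith) hM.le
  have hgm : g - 1 = (1 - θ) * g := by rw [sub_mul, mul_comm θ, hgθ]; ring
  have hw0 : 0 < w := by linarith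
  have h3 : Z * (K * (g - 1)) ≤ (1 - θ) * ((1 + 43 / 500 * θ) * L) := by
    rw [hgm]
    calc Z * (K * ((1 - θ) * g)) = (1 - θ) * (Z * (K * g)) := by ring
      _ ≤ (1 - θ) * ((1 + 13 / 500 * ε) * L) :=
        mul_le_mul_of_nonneg_left h1 (by linarith)
      _ ≤ (1 - θ) * ((1 + 43 / 500 * θ) * L) := by
        refine mul_le_mul_of_nonneg_left ?_ (by linarith)
        gcongr
  have h4 : Z * (K * (g - 1) * o / (n - K * g)) ≤
      w * L * ((1 - θ) * α + 7 / 50 * θ) := by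
    have e1 : Z * (K * (g - 1) * o / (n - K * g)) = Z * (K * (g - 1)) * (α * w * ν) := by
      rw [ho, hν]; field_simp
    rw [e1]
    have e2 : Z * (K * (g - 1)) * (α * w * ν) ≤
        (1 - θ) * ((1 + 43 / 500 * θ) * L) * (α * w * (1 + 1 / 20 * θ)) := by
      have : 0 ≤ (1 - θ) * ((1 + 43 / 500 * θ) * L) :=
        mul_nonneg (by linarith) (by positivity)
      gcongr
    refine e2.trans ?_
    have e3 : (1 - θ) * ((1 + 43 / 500 * θ) * L) * (α * w * (1 + 1 / 20 * θ)) =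
        w * L * ((1 - θ) * α * ((1 + 43 / 500 * θ) * (1 + 1 / 20 * θ))) := by ring
    rw [e3]
    refine mul_le_mul_of_nonneg_left ?_ (by positivity)
    have e4 : (1 + 43 / 500 * θ) * (1 + 1 / 20 * θ) =
        1 + (68 / 500 * θ + 43 / 10000 * θ ^ 2) := by ring
    have e5 : (1 - θ) * α ≤ 1 - θ := mul_le_of_le_one_right (by linarith) hα1
    have e6 : (1 - θ) * α * (68 / 500 * θ + 43 / 10000 * θ ^ 2) ≤
        (1 - θ) * (68 / 500 * θ + 43 / 10000 * θ ^ 2) :=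
      mul_le_mul_of_nonneg_right e5 (by positivity)
    have e7 : 0 ≤ θ ^ 3 := by positivity
    have e8 : 0 ≤ θ ^ 2 := by positivity
    rw [e4, mul_add, mul_one]
    linarith
  have h5 : w * (K * (g - 1)) ≤ w * L * (543 / 1000 * θ) := by
    have e1 : g * (2 * (K * (g - 1))) ≤ (1 + 43 / 500 * θ) * L := by
      calc g * (2 * (K * (g - 1))) = Z * (K * (g - 1)) := by rw [hZ]; ring
        _ ≤ (1 - θ) * ((1 + 43 / 500 * θ) * L) := h3
        _ ≤ _ := mul_le_of_le_one_left (by positivity) (by linarith)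
    have e2 : 2 * (K * (g - 1)) ≤ (1 + 43 / 500 * θ) * L * θ := by
      calc 2 * (K * (g - 1)) = (g * (2 * (K * (g - 1)))) * θ := by
            rw [mul_right_comm, hgθ, one_mul]
        _ ≤ _ := by gcongr
    have e3 : (1 + 43 / 500 * θ) * L * θ ≤ 1086 / 1000 * (L * θ) := by
      have := mul_pos hL hθ0
      have e4 : L * θ * θ ≤ L * θ := mul_le_of_le_one_right this.le hθ1
      linarith
    rw [mul_assoc w L]
    refine mul_le_mul_of_nonneg_left ?_ hw0.le
    linarith
  have h6 : Z * ca ≤ w * L * (9 / 100 * θ) := by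
    have e1 : Z * ca ≤ 13 / 500 * ε * L * θ := by
      calc Z * ca = Z * g * ca * θ := by
            rw [show Z * g * ca * θ = Z * ca * (g * θ) by ring, hgθ, mul_one]
        _ ≤ _ := by gcongr
    have e2 : 13 / 500 * ε * L * θ ≤ 43 / 500 * (L * θ) := by
      have : 13 / 500 * ε ≤ 43 / 500 := by linarith
      calc 13 / 500 * ε * L * θ = 13 / 500 * ε * (L * θ) := by ring
        _ ≤ _ := by gcongr
    have e3 : L * θ ≤ w * (L * θ) := le_mul_of_one_le_left (by positivity) hw
    have : 0 < L * θ := mul_pos hL hθ0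
    linarith
  have h7 : 0 < w * L * θ := by positivity
  linarith

/-- The main loss is `1 / h ≤ ε / 3`, caused by the inserted slots; the crossings add `2 * (39 /
500) * ε`, and the rest comes from incomplete windows and from finite `n`. The term `q / 2` is kept
apart, to cancel against the half slot in the cost. -/
lemma block_cost_bound {L Z K h R n E q β cs Zb ε : ℝ} (hε : 0 < ε) (hε7 : ε < 1 / 7) (hL : 0 < L)
    (hh : 3 / ε ≤ h) (hZ : 0 ≤ Z) (hK : 0 ≤ K) (hR : 0 ≤ R) (hE : 0 ≤ E) (hq : 0 ≤ q)
    (hq1 : q ≤ 1) (hβ : 0 ≤ β)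
    (hn : K * (h + 1) < n) (hnu : n ≤ (1 + 1 / 100 * ε) * (n - K * (h + 1)))
    (h1 : Z * (K * (h + 1)) ≤ (1 + 13 / 500 * ε) * L) (h2 : Z * R ≤ 39 / 500 * ε * L)
    (h3 : Z * cs ≤ 1 / 100 * ε * L) (h4 : (L - Zb) * R ≤ 39 / 500 * ε * L) :
    (Z * (((K * (h + 1) * (1 + 1 / h) + 2 * R) * (n * (E + q / 2)) + K * h * (n * β)) /
        (n - K * (h + 1))) + Z * cs + (L - Zb) * (R * q)) / L ≤
      (1 + 53 / 100 * ε) * (E + β) + 9 / 25 * ε + q / 2 := by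
  have hh0 : 0 < h := (div_pos (by norm_num) hε).trans_le hh
  have hinv : 1 / h ≤ ε / 3 := by
    rw [div_le_div_iff₀ hh0 (by norm_num)]
    rw [div_le_iff₀ hε] at hh
    linarith
  have hinv0 : 0 < 1 / h := one_div_pos.2 hh0
  have hM : 0 < n - K * (h + 1) := by linarith
  set ν := n / (n - K * (h + 1)) with hν
  have hν1 : ν ≤ 1 + 1 / 100 * ε := by rw [hν, div_le_iff₀ hM]; exact hnu
  have hn0 : 0 ≤ n := le_trans (by positivity) hn.le
  have hν0 : 0 ≤ ν := div_nonneg hn0 hM.le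
  have e1 : Z * (((K * (h + 1) * (1 + 1 / h) + 2 * R) * (n * (E + q / 2)) + K * h * (n * β)) /
        (n - K * (h + 1))) =
      ν * (((Z * (K * (h + 1))) * (1 + 1 / h) + 2 * (Z * R)) * (E + q / 2) + Z * (K * h) * β) := by
    rw [hν]; field_simp
  have e2 : (Z * (K * (h + 1))) * (1 + 1 / h) + 2 * (Z * R) ≤ (1 + 518 / 1000 * ε) * L := by
    calc (Z * (K * (h + 1))) * (1 + 1 / h) + 2 * (Z * R) ≤
          (1 + 13 / 500 * ε) * L * (1 + ε / 3) + 2 * (39 / 500 * ε * L) := by gcongr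
      _ = (1 + (13 / 500 + 1 / 3 + 13 / 1500 * ε + 39 / 250) * ε) * L := by ring
      _ ≤ _ := by gcongr; linarith
  have e3 : Z * (K * h) ≤ (1 + 518 / 1000 * ε) * L := by
    calc Z * (K * h) ≤ Z * (K * (h + 1)) := by gcongr; linarith
      _ ≤ _ := h1
      _ ≤ _ := mul_le_mul_of_nonneg_right (by linarith) hL.le
  have e4 : ν * (((Z * (K * (h + 1))) * (1 + 1 / h) + 2 * (Z * R)) * (E + q / 2) +
      Z * (K * h) * β) ≤ (1 + 53 / 100 * ε) * L * (E + q / 2 + β) := by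
    calc _ ≤ (1 + 1 / 100 * ε) * ((1 + 518 / 1000 * ε) * L * (E + q / 2) +
          (1 + 518 / 1000 * ε) * L * β) := by
          gcongr
      _ = (1 + 1 / 100 * ε) * (1 + 518 / 1000 * ε) * (L * (E + q / 2 + β)) := by ring
      _ ≤ (1 + 53 / 100 * ε) * (L * (E + q / 2 + β)) := by
          gcongr
          nlinarith
      _ = _ := by ring
  rw [e1, div_le_iff₀ hL]
  have e5 : (L - Zb) * (R * q) ≤ 39 / 500 * ε * L := by
    calc (L - Zb) * (R * q) = ((L - Zb) * R) * q := by ring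
      _ ≤ (39 / 500 * ε * L) * q := by gcongr
      _ ≤ _ := mul_le_of_le_one_right (by positivity) hq1
  have e6 : ε * L * q ≤ ε * L := mul_le_of_le_one_right (by positivity) hq1
  have e7 : 0 < ε * L := mul_pos hε hL
  linarith

end Candidate

/-! ### Short periodic schedules of `A` are almost as good as arbitrary schedules -/

section Candidate

/-- The choice `h = ⌈3 / ε⌉` makes the stretch `1 / h` at most `ε / 3`, and `Z = 2 * (h + 1)` makes
one superfluous window cost only half of the inserted slots. The block length `b = L / Z` must be
much larger than the `a * (h + 1)` slots needed to broadcast all messages of `A`. The errors are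
governed by `Z * (h + 1) * a`, of order `a / ε ^ 2`, which has to be small against `ε * L`; the size
of `L` is made for that. -/
lemma exists_block_parameters {ε C : ℝ} (hε : 0 < ε) (hε7 : ε < 1 / 7) {a k L : ℕ} (ha : 1 ≤ a)
    (hk : k ≤ a) (hL : L = ⌊periodConst ε C * (a : ℝ) ^ 2⌋₊) :
    ∃ h Z b K : ℕ, 3 / ε ≤ h ∧ ((h : ℝ) + 1) * ε ≤ 23 / 7 ∧ 1 ≤ h ∧ 1 ≤ b ∧ Z * b ≤ L ∧ 1 ≤ L ∧
      k * (h + 1) ≤ b ∧ b ≤ K * (h + 1) ∧ 1 ≤ Z ∧ (Z : ℝ) = 2 * ((h : ℝ) + 1) ∧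
      (Z : ℝ) * (K * ((h : ℝ) + 1)) ≤ (1 + 13 / 500 * ε) * L ∧
      (Z : ℝ) * ((h : ℝ) + 1) * k ≤ 13 / 500 * ε * L ∧
      (Z : ℝ) * ((k * (h + 1) + (L - Z * b) : ℕ) : ℝ) ≤ 39 / 500 * ε * L ∧
      ((L : ℝ) - Z * b) * ((k * (h + 1) + (L - Z * b) : ℕ) : ℝ) ≤ 39 / 500 * ε * L ∧
      (Z : ℝ) * (a * max C 1) ≤ 1 / 100 * ε * L := by
  set Cb := max C 1 with hCb
  have hCb1 : 1 ≤ Cb := le_max_right _ _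
  have ha1 : (1 : ℝ) ≤ a := by exact_mod_cast ha
  have hε1 : ε < 1 := by linarith
  set h := ⌈3 / ε⌉₊ with hh
  have h3 : 3 / ε ≤ h := Nat.le_ceil _
  have h3' : (h : ℝ) < 3 / ε + 1 := Nat.ceil_lt_add_one (by positivity)
  have h21 : (21 : ℝ) ≤ h := by
    refine le_trans ?_ h3
    rw [le_div_iff₀ hε]; linarith
  have hg : ((h : ℝ) + 1) * ε ≤ 23 / 7 := by
    have : ((h : ℝ) + 1) * ε < (3 / ε + 1 + 1) * ε := by gcongr
    have e : (3 / ε + 1 + 1) * ε = 3 + 2 * ε := by field_simp; ring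
    linarith
  -- The logarithm in `periodConst` is at least `3`, which gives `120`; rounding down to an integer
  -- costs less than one further unit.
  have hLr : 119 * (a : ℝ) ^ 2 * Cb / ε ^ 4 ≤ L := by
    have e1 : periodConst ε C * (a : ℝ) ^ 2 < L + 1 := by rw [hL]; exact Nat.lt_floor_add_one _
    have e2 : 120 * Cb / ε ^ 4 * (a : ℝ) ^ 2 ≤ periodConst ε C * (a : ℝ) ^ 2 := by
      gcongr; exact le_periodConst hε hε7
    have e3 : 1 ≤ Cb * (a : ℝ) ^ 2 / ε ^ 4 := by
      rw [le_div_iff₀ (by positivity), one_mul]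
      calc ε ^ 4 ≤ 1 := pow_le_one₀ hε.le hε1.le
        _ = 1 * 1 ^ 2 := by norm_num
        _ ≤ _ := by gcongr
    have e4 : 120 * Cb / ε ^ 4 * (a : ℝ) ^ 2 = 120 * (Cb * (a : ℝ) ^ 2 / ε ^ 4) := by ring
    have e5 : 119 * (a : ℝ) ^ 2 * Cb / ε ^ 4 = 119 * (Cb * (a : ℝ) ^ 2 / ε ^ 4) := by ring
    linarith
  have hstar : 2 * ((h : ℝ) + 1) * ((h : ℝ) + 1) * (a * Cb) ≤ 13 / 500 * ε * L := by
    have e1 : ((h : ℝ) + 1) ≤ 23 / 7 / ε := by rwa [le_div_iff₀ hε]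
    calc 2 * ((h : ℝ) + 1) * ((h : ℝ) + 1) * (a * Cb)
        ≤ 2 * (23 / 7 / ε) * (23 / 7 / ε) * (a * Cb) := by gcongr
      _ = 1058 / 49 * (a * Cb / ε ^ 2) := by field_simp; ring
      _ ≤ 13 / 500 * (119 * (1 / ε * a)) * (a * Cb / ε ^ 2) := by
          gcongr
          have : 7 ≤ 1 / ε := by rw [le_div_iff₀ hε]; linarith
          nlinarith
      _ = 13 / 500 * ε * (119 * (a : ℝ) ^ 2 * Cb / ε ^ 4) := by field_simp
      _ ≤ _ := by gcongr
  have hL0 : (0 : ℝ) < L := lt_of_lt_of_le (by positivity) hLr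
  have hk1 : (k : ℝ) ≤ a := by exact_mod_cast hk
  have hak : (a : ℝ) ≤ a * Cb := le_mul_of_one_le_right (by linarith) hCb1
  have hZga : 2 * ((h : ℝ) + 1) * ((h : ℝ) + 1) * a ≤ 13 / 500 * ε * L :=
    le_trans (by gcongr) hstar
  have hZg : 2 * ((h : ℝ) + 1) * ((h : ℝ) + 1) ≤ 13 / 500 * ε * L :=
    le_trans (le_mul_of_one_le_right (by positivity) ha1) hZga
  have hLL : 13 / 500 * ε * L ≤ L := by
    calc 13 / 500 * ε * L ≤ 1 * L := by gcongr; linarith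
      _ = L := one_mul _
  set Z := 2 * (h + 1) with hZ
  have hZr : (Z : ℝ) = 2 * ((h : ℝ) + 1) := by rw [hZ]; push_cast; ring
  have hZ1 : 1 ≤ Z := by omega
  set b := L / Z with hb
  have hZb : Z * b ≤ L := Nat.mul_div_le _ _
  have hZb' : L < Z * b + Z := by
    have := Nat.lt_mul_div_succ L (show 0 < Z by omega)
    rwa [Nat.mul_succ] at this
  have hb1 : 1 ≤ b := by
    rw [hb, Nat.le_div_iff_mul_le (by omega), one_mul]
    have : (Z : ℝ) ≤ L := by rw [hZr]; nlinarith
    exact_mod_cast this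
  have hkb : k * (h + 1) ≤ b := by
    rw [hb, Nat.le_div_iff_mul_le (by omega)]
    have : (k : ℝ) * ((h : ℝ) + 1) * Z ≤ L := by
      calc (k : ℝ) * ((h : ℝ) + 1) * Z = 2 * ((h : ℝ) + 1) * ((h : ℝ) + 1) * k := by
            rw [hZr]; ring
        _ ≤ 2 * ((h : ℝ) + 1) * ((h : ℝ) + 1) * a := by gcongr
        _ ≤ L := hZga.trans hLL
    exact_mod_cast this
  set K := b / (h + 1) + 1 with hK
  have hbK : b ≤ K * (h + 1) := by
    have := Nat.lt_mul_div_succ b (show 0 < h + 1 by omega)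
    rw [hK, mul_comm]; exact this.le
  have hKb : K * (h + 1) ≤ b + (h + 1) := by
    rw [hK, Nat.add_mul, one_mul]
    have := Nat.div_mul_le_self b (h + 1)
    omega
  have hZKg : (Z : ℝ) * (K * ((h : ℝ) + 1)) ≤ (1 + 13 / 500 * ε) * L := by
    have e1 : (Z : ℝ) * (K * ((h : ℝ) + 1)) ≤ Z * b + Z * ((h : ℝ) + 1) := by
      have : Z * (K * (h + 1)) ≤ Z * b + Z * (h + 1) := by
        rw [← Nat.mul_add]; exact Nat.mul_le_mul_left _ hKb
      exact_mod_cast this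
    have e2 : (Z : ℝ) * b ≤ L := by exact_mod_cast hZb
    rw [hZr] at e1 e2 ⊢
    linarith
  have hR : ((k * (h + 1) + (L - Z * b) : ℕ) : ℝ) ≤ 3 * (((h : ℝ) + 1) * a) := by
    have e1 : k * (h + 1) + (L - Z * b) ≤ a * (h + 1) + 2 * (h + 1) * a := by
      refine add_le_add (Nat.mul_le_mul_right _ hk) ?_
      calc L - Z * b ≤ Z := by omega
        _ ≤ 2 * (h + 1) * a := Nat.le_mul_of_pos_right _ ha
    calc ((k * (h + 1) + (L - Z * b) : ℕ) : ℝ) ≤ ((a * (h + 1) + 2 * (h + 1) * a : ℕ) : ℝ) := by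
          exact_mod_cast e1
      _ = _ := by push_cast; ring
  have hR0 : (0 : ℝ) ≤ ((k * (h + 1) + (L - Z * b) : ℕ) : ℝ) := Nat.cast_nonneg _
  have hZR : (Z : ℝ) * ((k * (h + 1) + (L - Z * b) : ℕ) : ℝ) ≤ 39 / 500 * ε * L := by
    rw [hZr]
    calc _ ≤ 2 * ((h : ℝ) + 1) * (3 * (((h : ℝ) + 1) * a)) := by gcongr
      _ = 3 * (2 * ((h : ℝ) + 1) * ((h : ℝ) + 1) * a) := by ring
      _ ≤ 3 * (13 / 500 * ε * L) := by gcongr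
      _ = _ := by ring
  refine ⟨h, Z, b, K, h3, hg, ?_, hb1, hZb, ?_, hkb, hbK, hZ1, hZr, hZKg, ?_, hZR, ?_, ?_⟩
  · have : (1 : ℝ) ≤ h := by linarith
    exact_mod_cast this
  · exact_mod_cast hL0
  · rw [hZr]
    refine le_trans ?_ hZga
    gcongr
  · refine le_trans ?_ hZR
    gcongr
    have : (L : ℝ) < Z * b + Z := by exact_mod_cast hZb'
    linarith
  · rw [hZr]
    have e1 : 21 * (2 * ((h : ℝ) + 1) * (a * Cb)) ≤ 13 / 500 * ε * L := by
      refine le_trans ?_ hstar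
      have e2 : 0 ≤ 2 * ((h : ℝ) + 1) * (a * Cb) := by positivity
      nlinarith
    have e3 : 0 < ε * L := mul_pos hε hL0
    linarith

variable {W m : ℕ}

lemma disjoint_messages (D : Grouped m) {A B : Finset Label} (h : Disjoint A B) :
    Disjoint (D.messages A) (D.messages B) := by
  refine Finset.disjoint_filter.2 fun i _ hA hB => Finset.disjoint_left.1 h hA hB

lemma ert_add_le {p : Fin m → ℝ} (hp : ∀ i, 0 ≤ p i) {X Y : Finset (Fin m)} (h : Disjoint X Y)
    (S : Schedule W m) (n : ℕ) : ert p X S n + ert p Y S n ≤ ert p Finset.univ S n := by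
  rw [ert, ert, ert, ← add_div, ← Finset.sum_add_distrib]
  refine div_le_div_of_nonneg_right (Finset.sum_le_sum fun t ht => ?_) (Nat.cast_nonneg _)
  rw [← Finset.sum_union h]
  exact Finset.sum_le_sum_of_subset_of_nonneg (Finset.subset_univ _) fun i _ _ =>
    mul_nonneg (hp i) (wait_nonneg ht)

lemma bc_add_le {c : Fin m → ℝ} (hc : ∀ i, 0 ≤ c i) {X Y : Finset (Fin m)} (h : Disjoint X Y)
    (S : Schedule W m) (n : ℕ) : bc c X S n + bc c Y S n ≤ bc c Finset.univ S n := by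
  rw [bc, bc, bc, ← add_div, ← Finset.sum_add_distrib]
  refine div_le_div_of_nonneg_right (Finset.sum_le_sum fun t ht => ?_) (Nat.cast_nonneg _)
  rw [← Finset.sum_add_distrib]
  refine Finset.sum_le_sum fun k _ => ?_
  rw [← Finset.sum_union h]
  exact Finset.sum_le_sum_of_subset_of_nonneg (Finset.subset_univ _) fun i _ _ => by
    split_ifs; exacts [hc i, le_rfl]

lemma card_filter_ne_none (S : Schedule W m) {X : Finset (Fin m)}
    (hX : ∀ t k i, S t k = some i → i ∈ X) (P : ℕ) :
    ((Finset.range P ×ˢ (Finset.univ : Finset (Fin W))).filter fun s => S s.1 s.2 ≠ none).card =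
      ∑ t ∈ Finset.range P, occupied S X t := by
  rw [Finset.card_filter, Finset.sum_product]
  refine Finset.sum_congr rfl fun t _ => Finset.sum_congr rfl fun k _ => ?_
  rcases hS : S t k with _ | i
  · simp
  · simp [hX t k i hS]

/-- Large finite parts of a schedule have a cost close to the cost of the schedule. -/
lemma eventually_ert_add_bc_le {p c : Fin m → ℝ} {X : Finset (Fin m)} {S : Schedule W m}
    {y z : ℝ} (hy : cost p c X S ≤ ENNReal.ofReal y) (hz0 : 0 < z) (hz : y < z) :
    ∀ᶠ n in atTop, ert p X S n + bc c X S n ≤ z := by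
  have h1 : cost p c X S < ENNReal.ofReal z :=
    hy.trans_lt ((ENNReal.ofReal_lt_ofReal_iff hz0).2 hz)
  filter_upwards [eventually_lt_of_limsup_lt h1] with n hn
  exact ((ENNReal.ofReal_lt_ofReal_iff hz0).1 hn).le

lemma eventually_div_natCast_le (x : ℝ) {δ : ℝ} (hδ : 0 < δ) : ∀ᶠ n : ℕ in atTop, x / n ≤ δ :=
  (tendsto_const_div_atTop_nhds_zero_nat x).eventually_le_const hδ

lemma eventually_le_mul_sub (H : ℝ) {δ : ℝ} (hδ : 0 < δ) :
    ∀ᶠ n : ℕ in atTop, (n : ℝ) ≤ (1 + δ) * (n - H) := by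
  filter_upwards [tendsto_natCast_atTop_atTop.eventually_ge_atTop ((1 + δ) * H / δ)] with n hn
  rw [div_le_iff₀ hδ] at hn
  linarith

set_option maxHeartbeats 1000000 in
-- One finite part of `S` serves both purposes: its broadcasts of `A` are turned into a periodic
-- schedule, and its broadcasts of `B` give a solution of the relaxation. The inserted slots bring
-- the density of `A` to at most `(1 - θ) * α + 4 / 5 * θ`, which leaves `(1 - θ) * (1 - α) + θ / 5`
-- for `B`. So the solution for `B`, slowed down by `1 / (1 - θ) = 1 + 1 / h`, is feasible.
theorem IsInstance.exists_candidate_le {ε C : ℝ} {p c : Fin m → ℝ} (hI : IsInstance W ε C p c)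
    (hε7 : ε < 1 / 7) {A B Q : Finset Label} (hP : IsPartition (rounded W ε p c) W ε C A B Q)
    (S : Schedule W m)
    (hS : cost (rounded W ε p c).p (rounded W ε p c).c Finset.univ S ≠ ⊤) :
    ∃ x S', Candidate (rounded W ε p c) W ε C A x S' ∧
      cost (rounded W ε p c).p (rounded W ε p c).c ((rounded W ε p c).messages A) S' +
        LB (rounded W ε p c) W B (1 - gridDensity (rounded W ε p c) W ε C A x) ≤
      ENNReal.ofReal (1 + 3 / 2 * ε) *
        cost (rounded W ε p c).p (rounded W ε p c).c Finset.univ S := by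
  have hps := hI.rounded_p_sum
  have hp0 : ∀ i, 0 ≤ (rounded W ε p c).p i := fun i => (hI.rounded_p_pos i).le
  have hc0 : ∀ i, 0 ≤ (rounded W ε p c).c i := hI.rounded_c_nonneg
  have hprob : ∀ G, 0 ≤ (rounded W ε p c).prob G := fun G => (hI.prob_pos G).le
  have hcst : ∀ G, 0 ≤ (rounded W ε p c).cst G := hI.cst_nonneg
  have hcC : ∀ i, (rounded W ε p c).c i ≤ C := fun i => (hI.rounded_c_le i).trans (hI.c_le i)
  generalize rounded W ε p c = D at *
  have hW := hI.W_pos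
  have hε := hI.eps_pos
  have hWr : (1 : ℝ) ≤ W := by exact_mod_cast hW
  have hBs : ∀ G ∈ B, 1 ≤ D.size G := fun G hG => Grouped.size_pos (by
    rw [← hP.cover]; simp [hG])
  have hdis := disjoint_messages D hP.disj_AB
  set y := (cost D.p D.c Finset.univ S).toReal with hy
  have hyS : cost D.p D.c Finset.univ S = ENNReal.ofReal y := (ENNReal.ofReal_toReal hS).symm
  have hy2 : 1 / 2 ≤ y := by
    have := (half_le_opt (W := W) hp0 hps hc0).trans (iInf_le _ S)
    rw [hyS] at this
    exact (ENNReal.ofReal_le_ofReal_iff (by positivity)).1 this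
  obtain ⟨h, Z, b, K, h3, hgε, hh, hb1, hZb, hL, hkb, hbK, hZ1, hZr, hB1, hB2, hB3, hB4, hB5⟩ :=
    exists_block_parameters (C := C) hε hε7 (a := size1 D A) (k := (D.messages A).card)
      (L := maxPeriod D ε C A) (le_max_right _ _) (le_max_left _ _) rfl
  set L := maxPeriod D ε C A with hLdef
  have hL0 : (0 : ℝ) < L := by exact_mod_cast hL
  have hh0 : (0 : ℝ) < h := by exact_mod_cast hh
  set θ := 1 / ((h : ℝ) + 1) with hθ
  have hθ0 : 0 < θ := by positivity
  have hθ1 : θ < 1 := by rw [hθ, div_lt_one (by linarith)]; linarith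
  -- A part so long that its cost is close to that of `S` and that the effects of the window length,
  -- of the number of messages and of one extra broadcast per message are negligible.
  obtain ⟨n, hn1, hn2, hn3, hn4, hn5, hn6⟩ := ((eventually_ert_add_bc_le hyS.le
    (z := (1 + 1 / 100 * ε) * y) (by positivity)
      (lt_mul_of_one_lt_left (by linarith) (by linarith))).and
    ((eventually_gt_atTop (K * (h + 1))).and
    ((eventually_le_mul_sub (K * ((h : ℝ) + 1)) (δ := 1 / 100 * ε) (by positivity)).and
    ((eventually_le_mul_sub (K * ((h : ℝ) + 1)) (δ := 1 / 20 * θ) (by positivity)).and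
    ((eventually_div_natCast_le m (δ := 1 / 5 * θ) (by positivity)).and
    (eventually_div_natCast_le (∑ i, D.c i) (δ := 1 / 100 * ε) (by positivity))))))).exists
  have hn2r : (K : ℝ) * ((h : ℝ) + 1) < n := by exact_mod_cast hn2
  have hnpos : 1 ≤ n := by omega
  have hn0 : (0 : ℝ) < n := by exact_mod_cast hnpos
  obtain ⟨S', hS1, hS2, hS3, hS4⟩ := exists_periodic_schedule hW hp0 hc0 (D.messages A) S hh hb1 hZb
    hL hkb hbK hn2 hZ1 rfl
  set o := ∑ t ∈ Finset.range n, occupied S (D.messages A) t with ho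
  set oB := ∑ t ∈ Finset.range n, occupied S (D.messages B) t with hoB
  have hoo : o + oB ≤ W * n := by
    rw [ho, hoB, ← Finset.sum_add_distrib]
    refine (Finset.sum_le_sum fun t _ => ((occupied_union S hdis t).symm.trans_le
      (occupied_le S _ t))).trans_eq ?_
    simp [mul_comm]
  have hoor : (o : ℝ) + oB ≤ W * n := by exact_mod_cast hoo
  set α := (o : ℝ) / (W * n) with hα
  have hWn : (0 : ℝ) < W * n := by positivity
  have hoα : (o : ℝ) = α * (W * n) := by rw [hα]; field_simp
  have hα0 : 0 ≤ α := by positivity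
  have hoB0 : (0 : ℝ) ≤ oB := Nat.cast_nonneg _
  have hα1 : α ≤ 1 := by rw [hα, div_le_one hWn]; linarith
  set x := ∑ t ∈ Finset.range L, occupied S' (D.messages A) t with hx
  have hxle : (x : ℝ) ≤ W * L * ((1 - θ) * α + 4 / 5 * θ) := by
    refine hS3.trans ?_
    have := block_density_bound (n := n) hL0 (by linarith : 1 ≤ (h : ℝ) + 1) hgε
      (Nat.cast_nonneg K) hZr hα0 hα1 hWr hoα hn2r hn4 hB1 hB2
    rwa [add_sub_cancel_right] at this
  have hWL : (0 : ℝ) < W * L := by positivity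
  have hgd : gridDensity D W ε C A x ≤ (1 - θ) * α + 4 / 5 * θ := by
    rw [gridDensity, div_le_iff₀ hWL]
    linarith
  have hxlt : x < W * L := by
    have : (x : ℝ) < W * L := by
      refine hxle.trans_lt (mul_lt_of_lt_one_right hWL ?_)
      have : (1 - θ) * α ≤ 1 - θ := mul_le_of_le_one_right (sub_nonneg.2 hθ1.le) hα1
      linarith only [this, hθ0]
    exact_mod_cast this
  -- The period is exactly the maximal one, so the density lies on the grid without any rounding.
  refine ⟨x, S', ⟨hxlt, hS1, L, hL, le_rfl, hS2, ?_⟩, ?_⟩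
  · rw [card_filter_ne_none S' hS1, gridDensity]
  obtain ⟨τ, hτ0, hτ1, hτ2⟩ := exists_lbValue_le hprob hcst hBs S hnpos
  have hlb : LB D W B (1 - gridDensity D W ε C A x) ≤ ENNReal.ofReal ((1 + 1 / 3 * ε) *
      (ert D.p (D.messages B) S n + bc D.c (D.messages B) S n + 1 / 100 * ε)) := by
    have hθ' : 0 < 1 - θ := by linarith
    refine (iInf₂_le (fun G => τ G / (1 - θ)) ⟨fun G hG => div_pos (hτ0 G hG) hθ', ?_⟩).trans
      (ENNReal.ofReal_le_ofReal ?_)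
    swap
    · have e1 : ∑ G ∈ B, 1 / (τ G / (1 - θ)) = (1 - θ) * ∑ G ∈ B, 1 / τ G := by
        rw [Finset.mul_sum]
        exact Finset.sum_congr rfl fun G _ => by rw [one_div_div, mul_one_div]
      have e2 : ((oB : ℝ) + m) / n ≤ W * (1 - α) + 1 / 5 * θ := by
        rw [add_div]
        refine add_le_add ?_ hn5
        rw [div_le_iff₀ hn0]
        linarith
      refine e1.trans_le ?_
      have e3 : (1 - θ) * ∑ G ∈ B, 1 / τ G ≤ (1 - θ) * (W * (1 - α) + 1 / 5 * θ) := by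
        gcongr
        exact hτ1.trans e2
      refine e3.trans ?_
      have e4 : ((1 - θ) * (1 - α) + 1 / 5 * θ) * W ≤ (1 - gridDensity D W ε C A x) * W := by
        gcongr
        linarith
      refine le_trans ?_ e4
      have e5 : (1 - θ) * (1 / 5 * θ) ≤ 1 / 5 * θ :=
        mul_le_of_le_one_left (by positivity) (by linarith only [hθ0])
      have e6 : 1 / 5 * θ ≤ 1 / 5 * θ * W := le_mul_of_one_le_right (by positivity) hWr
      linarith only [e5, e6]
    · refine (lbValue_div_le hθ' (by linarith) hcst hτ0).trans ?_
      have e1 : 1 / (1 - θ) ≤ 1 + 1 / 3 * ε := by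
        have : 1 / (1 - θ) = 1 + 1 / h := by
          have e : 1 - θ = h / ((h : ℝ) + 1) := by rw [hθ]; field_simp; ring
          rw [e, one_div_div, add_div, div_self hh0.ne']
        rw [this]
        have : 1 / (h : ℝ) ≤ 1 / 3 * ε := by
          rw [div_le_iff₀ hh0]
          rw [div_le_iff₀ hε] at h3
          linarith
        linarith
      have e2 := lbValue_nonneg hprob hcst hτ0
      refine mul_le_mul e1 (hτ2.trans (by linarith)) e2 (by positivity)
  set q := ∑ i ∈ D.messages A, D.p i with hq
  have hq0 : 0 ≤ q := Finset.sum_nonneg fun i _ => hp0 i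
  have hq1 : q ≤ 1 := by
    rw [← hps]
    exact Finset.sum_le_sum_of_subset_of_nonneg (Finset.subset_univ _) fun i _ _ => hp0 i
  have hcs : (Z : ℝ) * ∑ i ∈ D.messages A, D.c i ≤ 1 / 100 * ε * L := by
    refine le_trans ?_ hB5
    gcongr
    calc ∑ i ∈ D.messages A, D.c i ≤ ∑ i ∈ D.messages A, max C 1 :=
          Finset.sum_le_sum fun i _ => (hcC i).trans (le_max_left _ _)
      _ = (D.messages A).card * max C 1 := by rw [Finset.sum_const, nsmul_eq_mul]
      _ ≤ (size1 D A : ℕ) * max C 1 := by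
          gcongr
          exact le_max_left _ _
  have hE0 : 0 ≤ ert D.p (D.messages A) S n := ert_nonneg hp0
  have hb0 : 0 ≤ bc D.c (D.messages A) S n := bc_nonneg hc0
  have hcA : cost D.p D.c (D.messages A) S' ≤ ENNReal.ofReal ((1 + 53 / 100 * ε) *
      (ert D.p (D.messages A) S n + bc D.c (D.messages A) S n) + 9 / 25 * ε) := by
    have e1 := block_cost_bound hε hε7 hL0 h3 (Nat.cast_nonneg Z) (Nat.cast_nonneg K)
      (Nat.cast_nonneg _) hE0 hq0 hq1 hb0 hn2r hn3 hB1 hB3 hcs hB4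
    have e2 := hS4.trans (ENNReal.ofReal_le_ofReal e1)
    rw [ENNReal.ofReal_add (by positivity) (by positivity)] at e2
    exact (ENNReal.add_le_add_iff_right ENNReal.ofReal_ne_top).1 e2
  refine (add_le_add hcA hlb).trans ?_
  have hEB0 : 0 ≤ ert D.p (D.messages B) S n := ert_nonneg hp0
  have hbB0 : 0 ≤ bc D.c (D.messages B) S n := bc_nonneg hc0
  rw [← ENNReal.ofReal_add (by positivity) (by positivity), hyS,
    ← ENNReal.ofReal_mul (by positivity)]
  refine ENNReal.ofReal_le_ofReal ?_
  have e1 := ert_add_le hp0 hdis S n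
  have e2 := bc_add_le hc0 hdis S n
  set u := ert D.p (D.messages A) S n + bc D.c (D.messages A) S n with hu
  set v := ert D.p (D.messages B) S n + bc D.c (D.messages B) S n with hv
  have huv : u + v ≤ (1 + 1 / 100 * ε) * y := by linarith
  have hv0 : 0 ≤ v := by positivity
  -- The smaller factor for `B` is enlarged to that for `A`, and the additive multiples of `ε` are
  -- absorbed using `1 / 2 ≤ y`.
  have e3 : (1 + 53 / 100 * ε) * (u + v) ≤ (1 + 53 / 100 * ε) * ((1 + 1 / 100 * ε) * y) := by
    gcongr
  have e4 : ε * ε ≤ 1 / 7 * ε := by gcongr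
  have e5 : ε * (1 / 2) ≤ ε * y := mul_le_mul_of_nonneg_left hy2 hε.le
  have e6 : ε * ε * y ≤ 1 / 7 * ε * y := by gcongr
  have e7 : 0 ≤ ε * v := by positivity
  linarith only [e3, e4, e5, e6, e7, huv, hv0, hε, hy2]

end Candidate

/-! ### Feasibility of the deterministic steps and quality of the selected candidate -/

section Plan

variable {W m : ℕ}

/-- A candidate is determined by its period, its density index and its first `maxPeriod` slots, so
the exhaustive search ranges over a finite set and the minimum is attained. -/
lemma finite_candidates (D : Grouped m) (ε C : ℝ) (A : Finset Label) :
    {xS : ℕ × Schedule W m | Candidate D W ε C A xS.1 xS.2}.Finite := by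
  classical
  set L := maxPeriod D ε C A with hL
  refine (Set.finite_range fun z : Fin (W * L) × Fin (L + 1) × (Fin L → Fin W → Option (Fin m)) =>
    ((z.1 : ℕ), (fun t k => if h : t % z.2.1 < L then z.2.2 ⟨t % z.2.1, h⟩ k else none :
      Schedule W m))).subset ?_
  rintro ⟨x, S⟩ ⟨hx, -, P, hP1, hPL, hper, -⟩
  refine ⟨⟨⟨x, hx⟩, ⟨P, Nat.lt_succ_of_le hPL⟩, fun t k => S t k⟩, ?_⟩
  refine Prod.ext rfl (funext fun t => funext fun k => ?_)
  have h1 : t % P < L := (Nat.mod_lt t hP1).trans_le hPL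
  have h2 : Function.Periodic S P := fun t => funext fun k => hper t k
  simp only [h1, dif_pos]
  rw [h2.map_mod_nat]

lemma exists_isBestCandidate (D : Grouped m) (hW : 1 ≤ W) {ε C : ℝ} {A : Finset Label}
    (hL : 1 ≤ maxPeriod D ε C A) (B : Finset Label) :
    ∃ x, ∃ S : Schedule W m, IsBestCandidate D W ε C A B x S := by
  have hne : {xS : ℕ × Schedule W m | Candidate D W ε C A xS.1 xS.2}.Nonempty := by
    refine ⟨(0, fun _ _ => none), Nat.mul_pos hW hL, by simp, 1, le_rfl, hL, by simp, ?_⟩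
    simp [gridDensity]
  obtain ⟨⟨x, S⟩, hxS, hmin⟩ := Set.exists_min_image _
    (fun xS : ℕ × Schedule W m => cost D.p D.c (D.messages A) xS.2 +
      LB D W B (1 - gridDensity D W ε C A xS.1)) (finite_candidates D ε C A) hne
  exact ⟨x, S, hxS, fun x' S' h => hmin (x', S') h⟩

lemma exists_isDrawLaw {Q : Finset Label} {τ : Label → ℝ}
    (hτ : ∀ G ∈ Q, 0 < τ G) (h1 : ∑ G ∈ Q, 1 / τ G ≤ 1) : ∃ q, IsDrawLaw Q τ q := by
  classical
  have hsum : ∑ G ∈ Q, ENNReal.ofReal (1 / τ G) ≤ 1 := by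
    rw [← ENNReal.ofReal_sum_of_nonneg fun G hG => (one_div_pos.2 (hτ G hG)).le]
    exact ENNReal.ofReal_le_one.2 h1
  refine ⟨PMF.ofFinset (fun o => o.elim (1 - ∑ G ∈ Q, ENNReal.ofReal (1 / τ G))
    fun G => if G ∈ Q then ENNReal.ofReal (1 / τ G) else 0) (Finset.insertNone Q) ?_ ?_, fun G => ?_⟩
  · rw [Finset.sum_insertNone]
    simp only [Option.elim]
    rw [Finset.sum_congr rfl fun G hG => if_pos hG]
    exact tsub_add_cancel_of_le hsum
  · rintro (_ | G) hG
    · simp at hG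
    · simp only [Finset.some_mem_insertNone] at hG
      simp [hG]
  · rfl

lemma gridDensity_lt_one {D : Grouped m} {ε C : ℝ} {A : Finset Label} {x : ℕ} {S : Schedule W m}
    (h : Candidate D W ε C A x S) : gridDensity D W ε C A x < 1 := by
  have h1 : (x : ℝ) < W * maxPeriod D ε C A := by exact_mod_cast h.1
  rw [gridDensity, div_lt_one (lt_of_le_of_lt (Nat.cast_nonneg x) h1)]
  exact h1

lemma one_le_maxPeriod (D : Grouped m) {ε : ℝ} (hε : 0 < ε) (hε7 : ε < 1 / 7) (C : ℝ)
    (A : Finset Label) : 1 ≤ maxPeriod D ε C A := by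
  obtain ⟨_, _, _, _, _, _, _, _, _, h, _⟩ := exists_block_parameters (C := C) hε hε7
    (a := size1 D A) (k := 0) (le_max_right _ _) (Nat.zero_le _) rfl
  exact h

theorem IsInstance.exists_isPlan {ε C : ℝ} {p c : Fin m → ℝ} (hI : IsInstance W ε C p c)
    (hε7 : ε < 1 / 7) {A B Q : Finset Label} (hP : IsPartition (rounded W ε p c) W ε C A B Q) :
    ∃ x S τB τQ qB qQ, IsPlan (rounded W ε p c) W ε C A B Q x S τB τQ qB qQ := by
  have hW : (0 : ℝ) < W := by exact_mod_cast hI.W_pos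
  obtain ⟨x, S, hbest⟩ := exists_isBestCandidate (rounded W ε p c) hI.W_pos
    (one_le_maxPeriod _ hI.eps_pos hε7 C A) B
  have hα := sub_pos.2 (gridDensity_lt_one hbest.1)
  set β := 1 - gridDensity (rounded W ε p c) W ε C A x with hβ
  have hN : (0 : ℝ) < insertPeriod ε C := by
    have := two_le_insertPeriod (C := C) hI.eps_pos hε7
    exact_mod_cast (by omega : 0 < insertPeriod ε C)
  obtain ⟨τB, hB⟩ := exists_isLBSolution (mul_pos hα hW) hI.prob_pos hI.cst_nonneg
    (Q := B) fun G hG => Grouped.size_pos (by rw [← hP.cover]; simp [hG])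
  obtain ⟨τQ, hQ⟩ := exists_isLBSolution (W := 1) (α := 1 / insertPeriod ε C)
    (by rw [Nat.cast_one, mul_one]; positivity) hI.prob_pos
    hI.cst_nonneg (Q := Q) fun G hG => Grouped.size_pos (by rw [← hP.cover]; simp [hG])
  obtain ⟨qB, hqB⟩ := exists_isDrawLaw (Q := B) (τ := fun G => τB G * β * W)
    (fun G hG => mul_pos (mul_pos (hB.1.1 G hG) hα) hW) (by
      have h1 : ∑ G ∈ B, 1 / (τB G * β * W) = (∑ G ∈ B, 1 / τB G) / (β * W) := by
        rw [Finset.sum_div]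
        exact Finset.sum_congr rfl fun G _ => by rw [div_div, mul_assoc]
      rw [h1, div_le_one (mul_pos hα hW)]
      exact hB.1.2)
  obtain ⟨qQ, hqQ⟩ := exists_isDrawLaw (Q := Q) (τ := fun G => τQ G / insertPeriod ε C)
    (fun G hG => div_pos (hQ.1.1 G hG) hN) (by
      have h1 : ∑ G ∈ Q, 1 / (τQ G / insertPeriod ε C) =
          insertPeriod ε C * ∑ G ∈ Q, 1 / τQ G := by
        rw [Finset.mul_sum]
        exact Finset.sum_congr rfl fun G _ => by rw [one_div_div, mul_one_div]
      have h2 := hQ.1.2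
      rw [Nat.cast_one, mul_one, le_div_iff₀ hN] at h2
      rw [h1]
      linarith)
  exact ⟨x, S, τB, τQ, qB, qQ, hbest, hB, hQ, hqB, hqQ⟩

/-- The candidate selected by the algorithm is almost optimal. -/
theorem IsInstance.best_le {ε C : ℝ} {p c : Fin m → ℝ} (hI : IsInstance W ε C p c)
    (hε7 : ε < 1 / 7) {A B Q : Finset Label} (hP : IsPartition (rounded W ε p c) W ε C A B Q)
    {x : ℕ} {S : Schedule W m} (hS : IsBestCandidate (rounded W ε p c) W ε C A B x S) :
    cost (rounded W ε p c).p (rounded W ε p c).c ((rounded W ε p c).messages A) S +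
        LB (rounded W ε p c) W B (1 - gridDensity (rounded W ε p c) W ε C A x) ≤
      ENNReal.ofReal (1 + 3 / 2 * ε) * opt W (rounded W ε p c).p (rounded W ε p c).c := by
  have hε := hI.eps_pos
  have h0 : ENNReal.ofReal (1 + 3 / 2 * ε) ≠ 0 := by
    rw [Ne, ENNReal.ofReal_eq_zero, not_le]; positivity
  rw [opt, ENNReal.mul_iInf_of_ne h0 ENNReal.ofReal_ne_top]
  refine le_iInf fun S₀ => ?_
  by_cases hS₀ : cost (rounded W ε p c).p (rounded W ε p c).c Finset.univ S₀ = ⊤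
  · rw [hS₀, ENNReal.mul_top h0]
    exact le_top
  · obtain ⟨x', S', h1, h2⟩ := hI.exists_candidate_le hε7 hP S₀ hS₀
    exact (hS.2 x' S' h1).trans h2

end Plan

/-! ### Measurability of the cost in the random draws -/

section Measurability

instance : DiscreteMeasurableSpace (Option Label) := ⟨fun _ => trivial⟩

/-- A finite family of draws takes values in a countable discrete space, on which every function is
measurable. The cost of the first `n` slots depends only on the draws with times below `n`. -/
lemma measurable_of_finite_dependence {ι κ α : Type*} [MeasurableSpace α]
    (f : (ι → Option Label) × (κ → Option Label) → α) (s : Finset ι) (u : Finset κ)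
    (h : ∀ d d' e e', (∀ i ∈ s, d i = d' i) → (∀ i ∈ u, e i = e' i) → f (d, e) = f (d', e')) :
    Measurable f := by
  classical
  let E : ∀ {ι : Type _} (s : Finset ι), (s → Option Label) → ι → Option Label :=
    fun s d i => if hi : i ∈ s then d ⟨i, hi⟩ else none
  let E' : ∀ {ι : Type _} (s : Finset ι), (s → Option Label) → ι → Option Label :=
    fun s d i => if hi : i ∈ s then d ⟨i, hi⟩ else none
  have hf : f = (fun z : (s → Option Label) × (u → Option Label) => f (E s z.1, E' u z.2)) ∘
      fun z => (fun i => z.1 i, fun i => z.2 i) := by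
    funext ⟨d, e⟩
    exact h _ _ _ _ (fun i hi => by simp [E, hi]) fun i hi => by simp [E', hi]
  rw [hf]
  refine (measurable_of_countable _).comp (Measurable.prodMk ?_ ?_)
  · exact measurable_pi_lambda _ fun i => (measurable_pi_apply _).comp measurable_fst
  · exact measurable_pi_lambda _ fun i => (measurable_pi_apply _).comp measurable_snd

variable {W m : ℕ}

lemma nextTime_congr {S S' : Schedule W m} {n : ℕ} (h : ∀ t < n, S t = S' t) (i : Fin m) (t : ℕ) :
    nextTime S n i t = nextTime S' n i t := by
  have key : ∀ S S' : Schedule W m, (∀ t < n, S t = S' t) →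
      nextTime S n i t ≤ nextTime S' n i t := by
    intro S S' h
    rcases nextTime_eq_end_or (S := S') (n := n) (i := i) (t := t) with h1 | ⟨h1, k, hk⟩
    · rw [h1]; exact nextTime_le_end
    · rcases lt_or_ge (nextTime S' n i t) n with h2 | h2
      · exact nextTime_le_of_broadcast h1 ⟨k, by rw [h _ h2]; exact hk⟩
      · exact nextTime_le_end.trans h2
  exact le_antisymm (key S S' h) (key S' S fun t ht => (h t ht).symm)

lemma ert_congr {S S' : Schedule W m} {n : ℕ} (h : ∀ t < n, S t = S' t) (p : Fin m → ℝ)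
    (X : Finset (Fin m)) : ert p X S n = ert p X S' n := by
  simp only [ert, nextTime_congr h]

lemma bc_congr {S S' : Schedule W m} {n : ℕ} (h : ∀ t < n, S t = S' t) (c : Fin m → ℝ)
    (X : Finset (Fin m)) : bc c X S n = bc c X S' n := by
  rw [bc, bc]
  congr 1
  refine Finset.sum_congr rfl fun t ht => ?_
  rw [h t (Finset.mem_range.1 ht)]

lemma fill_congr (D : Grouped m) (S : Schedule W m) {d d' : ℕ × Fin W → Option Label} {t : ℕ}
    (h : ∀ s k, s ≤ t → d (s, k) = d' (s, k)) : fill D S d t = fill D S d' t := by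
  funext k
  have hcard : ∀ G, ((Finset.range (t + 1) ×ˢ (Finset.univ : Finset (Fin W))).filter fun s =>
        (s.1 < t ∨ s.1 = t ∧ s.2 < k) ∧ S s.1 s.2 = none ∧ d s = some G) =
      ((Finset.range (t + 1) ×ˢ (Finset.univ : Finset (Fin W))).filter fun s =>
        (s.1 < t ∨ s.1 = t ∧ s.2 < k) ∧ S s.1 s.2 = none ∧ d' s = some G) := by
    intro G
    refine Finset.filter_congr fun s hs => ?_
    rw [Finset.mem_product, Finset.mem_range] at hs
    rw [show d s = d' s from h s.1 s.2 (by omega)]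
  simp only [fill, h t k le_rfl, hcard]

lemma roundRobin_congr (D : Grouped m) {d d' : ℕ → Option Label} {t : ℕ}
    (h : ∀ s, s ≤ t → d s = d' s) : roundRobin D d t = roundRobin D d' t := by
  have hcard : ∀ G, ((Finset.range t).filter fun l => d l = some G) =
      (Finset.range t).filter fun l => d' l = some G := by
    intro G
    refine Finset.filter_congr fun s hs => ?_
    rw [h s (Finset.mem_range.1 hs).le]
  simp only [roundRobin, h t le_rfl, hcard]

lemma output_congr (D : Grouped m) (N x : ℕ) (S : Schedule W m) {d d' : ℕ × Fin W → Option Label}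
    {e e' : ℕ → Option Label} {t : ℕ} (hd : ∀ s k, s ≤ t → d (s, k) = d' (s, k))
    (he : ∀ s, s ≤ t → e s = e' s) :
    output D N S (x, d, e) t = output D N S (x, d', e') t := by
  funext k
  simp only [output, insertSlots]
  rw [fill_congr D S fun s k hs => hd s k (hs.trans (Nat.sub_le _ _)),
    roundRobin_congr D fun s hs => he s (hs.trans ((Nat.div_le_self _ _).trans (Nat.sub_le _ _)))]

theorem measurable_cost_output (D : Grouped m) (N : ℕ) (S : Schedule W m) (p c : Fin m → ℝ)
    (X : Finset (Fin m)) :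
    Measurable fun ω : Choices W => cost p c X (output D N S ω) := by
  unfold cost
  refine Measurable.limsup fun n => ?_
  refine ENNReal.measurable_ofReal.comp (measurable_from_prod_countable_right fun x => ?_)
  refine measurable_of_finite_dependence _ (Finset.range n ×ˢ Finset.univ) (Finset.range n)
    fun d d' e e' hd he => ?_
  have h : ∀ t < n, output D N S (x, d, e) t = output D N S (x, d', e') t := fun t ht =>
    output_congr D N x S (fun s k hs => hd _ (by simp; omega)) fun s hs => he _ (by simp; omega)
  simp only [ert_congr h, bc_congr h]

end Measurability

/-! ### Expected waiting times for independent draws -/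

section Draws

variable {ι : Type*}

/-- The law of independent draws, indexed by `ι`. -/
abbrev drawsLaw (ι : Type*) (q : PMF (Option Label)) : Measure (ι → Option Label) :=
  Measure.infinitePi fun _ : ι => q.toMeasure

/-- The number of draws of the group `G` with indices in `I`. -/
def drawCount (G : Label) (I : Finset ι) (d : ι → Option Label) : ℕ :=
  (I.filter fun i => d i = some G).card

lemma drawCount_le (G : Label) (I : Finset ι) (d : ι → Option Label) : drawCount G I d ≤ I.card :=
  Finset.card_filter_le _ _

lemma drawCount_eq_sum (G : Label) (I : Finset ι) (d : ι → Option Label) :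
    drawCount G I d = ∑ i ∈ I, if d i = some G then 1 else 0 := Finset.card_filter _ _

lemma measurable_drawCount (G : Label) (I : Finset ι) : Measurable (drawCount (ι := ι) G I) := by
  rw [funext (drawCount_eq_sum G I)]
  exact Finset.measurable_sum _ fun i _ =>
    (measurable_of_countable fun o : Option Label => if o = some G then 1 else 0).comp
      (measurable_pi_apply i)

variable (q : PMF (Option Label)) (G : Label)

lemma lintegral_draw (i : ι) (f : Option Label → ℝ≥0∞) :
    ∫⁻ d, f (d i) ∂drawsLaw ι q = ∑' o, f o * q o := by
  have h := (measurePreserving_eval_infinitePi (fun _ : ι => q.toMeasure) i).lintegral_comp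
    (measurable_of_countable f)
  refine h.trans ?_
  rw [lintegral_countable']
  exact tsum_congr fun o => by rw [PMF.toMeasure_apply_singleton _ _ (measurableSet_singleton o)]

/-- Whether the process still runs is decided by the draws in `J`, hence is independent of the next
draw. -/
lemma lintegral_indicator_drawCount_mul (J : Finset ι) (j : ℕ) {i : ι} (hi : i ∉ J) :
    ∫⁻ d, (if drawCount G J d < j then 1 else 0) * (if d i = some G then 1 else 0) ∂drawsLaw ι q =
      (∫⁻ d, (if drawCount G J d < j then 1 else 0) ∂drawsLaw ι q) * q (some G) := by
  classical
  have hind : ProbabilityTheory.iIndepFun (fun (i : ι) (d : ι → Option Label) => d i)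
      (drawsLaw ι q) :=
    ProbabilityTheory.iIndepFun_infinitePi (X := fun _ o => o) fun _ => measurable_id
  have h1 := hind.indepFun_finset J {i} (Finset.disjoint_singleton_right.2 hi)
    fun i => measurable_pi_apply i
  have h2 := h1.comp (φ := fun z : J → Option Label =>
      (if (∑ a : J, if z a = some G then 1 else 0) < j then 1 else 0 : ℝ≥0∞))
    (ψ := fun z : ({i} : Finset ι) → Option Label =>
      (if z ⟨i, Finset.mem_singleton_self i⟩ = some G then 1 else 0 : ℝ≥0∞))
    (measurable_of_countable _) (measurable_of_countable _)
  have h3 : ∀ d : ι → Option Label, drawCount G J d = ∑ a : J, if d a = some G then 1 else 0 := by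
    intro d
    rw [drawCount_eq_sum]
    exact (Finset.sum_coe_sort J fun i => if d i = some G then 1 else 0).symm
  have h4 : ∫⁻ d, (if d i = some G then 1 else 0) ∂drawsLaw ι q = q (some G) := by
    rw [lintegral_draw q i fun o => if o = some G then 1 else 0]
    rw [tsum_eq_single (some G) fun o ho => by simp [ho]]
    simp
  simp only [h3]
  rw [← h4]
  refine ProbabilityTheory.lintegral_mul_eq_lintegral_mul_lintegral_of_indepFun ?_ ?_ h2
  · refine (measurable_of_countable fun z : J → Option Label =>
      (if (∑ a : J, if z a = some G then 1 else 0) < j then 1 else 0 : ℝ≥0∞)).comp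
      (f := fun (d : ι → Option Label) (a : J) => d a)
      (measurable_pi_lambda _ fun a => measurable_pi_apply _)
  · exact (measurable_of_countable fun o : Option Label =>
      if o = some G then (1 : ℝ≥0∞) else 0).comp
      (f := fun d : ι → Option Label => d i) (measurable_pi_apply i)

/-- When the last chunk is opened, at most `j - 1` successes have occurred, and one chunk overshoots
by at most `E`. -/
lemma sum_stopped_le {X : ℕ → ℕ} {E j : ℕ} (hX : ∀ κ, X κ ≤ E) (hj : 1 ≤ j) (n : ℕ) :
    (∑ κ ∈ Finset.range n, if ∑ s ∈ Finset.range κ, X s < j then X κ else 0) ≤ j - 1 + E := by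
  have h : (∑ κ ∈ Finset.range n, if ∑ s ∈ Finset.range κ, X s < j then X κ else 0) ≤
      ∑ s ∈ Finset.range n, X s ∧
      (∑ κ ∈ Finset.range n, if ∑ s ∈ Finset.range κ, X s < j then X κ else 0) ≤ j - 1 + E := by
    induction n with
    | zero => simp
    | succ n ih =>
      rw [Finset.sum_range_succ, Finset.sum_range_succ]
      have := hX n
      split_ifs with h
      · omega
      · omega
  exact h.2

/-- Expected number of chunks of independent draws before the `j`-th draw of the group `G`. -/
theorem lintegral_tsum_drawCount_le (I : ℕ → Finset ι)
    (hI : ∀ κ κ', κ' < κ → Disjoint (I κ') (I κ)) {E j : ℕ} (hE : ∀ κ, (I κ).card = E)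
    (hj : 1 ≤ j) :
    q (some G) * E * ∫⁻ d, ∑' κ, (if ∑ s ∈ Finset.range κ, drawCount G (I s) d < j
      then (1 : ℝ≥0∞) else 0) ∂drawsLaw ι q ≤ (j - 1 + E : ℕ) := by
  classical
  -- A Wald type argument: `U κ` collects the draws before the chunk `κ`, and the process is running
  -- at `κ` if they contain fewer than `j` successes. By independence, the expected number of
  -- successes in chunks opened while running is `q (some G) * E` times the expected number of such
  -- chunks; pathwise it is at most `j - 1 + E`.
  set U : ℕ → Finset ι := fun κ => (Finset.range κ).biUnion I with hU
  have hUc : ∀ κ d, drawCount G (U κ) d = ∑ s ∈ Finset.range κ, drawCount G (I s) d := by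
    intro κ d
    simp only [drawCount_eq_sum]
    refine Finset.sum_biUnion fun a _ b _ hab => ?_
    rcases lt_or_gt_of_ne hab with h | h
    · exact hI b a h
    · exact (hI a b h).symm
  have hUd : ∀ κ, ∀ i ∈ I κ, i ∉ U κ := by
    intro κ i hi hiU
    obtain ⟨s, hs, his⟩ := Finset.mem_biUnion.1 hiU
    exact Finset.disjoint_left.1 (hI κ s (Finset.mem_range.1 hs)) his hi
  simp only [← hUc]
  have hmeas : ∀ κ, Measurable fun d : ι → Option Label =>
      (if drawCount G (U κ) d < j then (1 : ℝ≥0∞) else 0) := fun κ =>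
    (measurable_of_countable fun n : ℕ => if n < j then (1 : ℝ≥0∞) else 0).comp
      (measurable_drawCount G (U κ))
  have hmeas2 : ∀ i, Measurable fun d : ι → Option Label =>
      (if d i = some G then (1 : ℝ≥0∞) else 0) := fun i =>
    (measurable_of_countable fun o : Option Label => if o = some G then (1 : ℝ≥0∞) else 0).comp
      (measurable_pi_apply i)
  have hmeas3 : ∀ κ i, Measurable fun d : ι → Option Label =>
      (if drawCount G (U κ) d < j then (1 : ℝ≥0∞) else 0) *
        (if d i = some G then (1 : ℝ≥0∞) else 0) := fun κ i => (hmeas κ).mul (hmeas2 i)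
  rw [lintegral_tsum fun κ => (hmeas κ).aemeasurable, ENNReal.tsum_eq_iSup_nat, ENNReal.mul_iSup]
  refine iSup_le fun n => ?_
  calc q (some G) * E * ∑ κ ∈ Finset.range n,
        ∫⁻ d, (if drawCount G (U κ) d < j then (1 : ℝ≥0∞) else 0) ∂drawsLaw ι q
      = ∑ κ ∈ Finset.range n, ∑ i ∈ I κ, ∫⁻ d, (if drawCount G (U κ) d < j then 1 else 0) *
          (if d i = some G then 1 else 0) ∂drawsLaw ι q := by
        rw [Finset.mul_sum]
        refine Finset.sum_congr rfl fun κ _ => ?_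
        rw [Finset.sum_congr rfl fun i hi =>
          lintegral_indicator_drawCount_mul q G (U κ) j (hUd κ i hi), Finset.sum_const, hE κ,
          nsmul_eq_mul]
        ring
    _ = ∫⁻ d, ∑ κ ∈ Finset.range n, ∑ i ∈ I κ, (if drawCount G (U κ) d < j then 1 else 0) *
          (if d i = some G then 1 else 0) ∂drawsLaw ι q := by
        rw [lintegral_finsetSum _ fun κ _ => Finset.measurable_sum _ fun i _ =>
          hmeas3 κ i]
        exact Finset.sum_congr rfl fun κ _ =>
          (lintegral_finsetSum _ fun i _ => hmeas3 κ i).symm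
    _ ≤ ∫⁻ _, ((j - 1 + E : ℕ) : ℝ≥0∞) ∂drawsLaw ι q := by
        refine lintegral_mono fun d => ?_
        have := sum_stopped_le (X := fun κ => drawCount G (I κ) d) (E := E) (j := j)
          (fun κ => (drawCount_le G (I κ) d).trans_eq (hE κ)) hj n
        refine le_of_eq_of_le ?_ (Nat.cast_le (α := ℝ≥0∞).2 this)
        rw [Nat.cast_sum]
        refine Finset.sum_congr rfl fun κ _ => ?_
        rw [← Finset.mul_sum, hUc]
        rw [drawCount_eq_sum G (I κ)]
        split_ifs
        · push_cast; simp
        · simp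
    _ = _ := by simp

/-- Expected waiting time for the `j`-th draw of the group `G`. -/
theorem lintegral_countWait_le (c : (ι → Option Label) → ℕ → ℕ) (t : ℕ) {P : ℕ} (hP : 1 ≤ P)
    (I : ℕ → Finset ι) (hI : ∀ κ κ', κ' < κ → Disjoint (I κ') (I κ)) {E j : ℕ}
    (hE : ∀ κ, (I κ).card = E) (hj : 1 ≤ j)
    (hc : ∀ d κ, ∑ s ∈ Finset.range (t + κ * P + 1), c d s =
      ∑ s ∈ Finset.range (t + 1), c d s + ∑ s ∈ Finset.range κ, drawCount G (I s) d) :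
    q (some G) * E * ∫⁻ d, countWait (c d) j t ∂drawsLaw ι q ≤ P * (j - 1 + E : ℕ) := by
  calc q (some G) * E * ∫⁻ d, countWait (c d) j t ∂drawsLaw ι q
      ≤ q (some G) * E * ∫⁻ d, P * ∑' κ, (if ∑ s ∈ Finset.range κ, drawCount G (I s) d < j
      then (1 : ℝ≥0∞) else 0) ∂drawsLaw ι q := by
        gcongr with d
        refine (countWait_le_tsum hP).trans_eq ?_
        congr 1
        refine tsum_congr fun κ => ?_
        rw [hc d κ, add_comm j]
        simp only [Nat.add_lt_add_iff_left]
    _ = P * (q (some G) * E * ∫⁻ d, ∑' κ, (if ∑ s ∈ Finset.range κ, drawCount G (I s) d < j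
      then (1 : ℝ≥0∞) else 0) ∂drawsLaw ι q) := by
        rw [lintegral_const_mul' _ _ (ENNReal.natCast_ne_top P)]
        ring
    _ ≤ _ := by
        gcongr
        exact lintegral_tsum_drawCount_le q G I hI hE hj

end Draws

/-! ### Waiting times under round robin and the structure of the output schedule -/

section RoundRobin

lemma sum_range_add_of_periodic {M : Type*} [AddCommMonoid M] {f : ℕ → M} {P : ℕ}
    (hf : ∀ s, f (s + P) = f s) (a : ℕ) :
    ∑ s ∈ Finset.range P, f (a + s) = ∑ s ∈ Finset.range P, f s := by
  induction a with
  | zero => simp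
  | succ a ih =>
    rw [← ih]
    cases P with
    | zero => simp
    | succ k =>
      rw [Finset.sum_range_succ, Finset.sum_range_succ' (fun s => f (a + s)),
        show a + 1 + k = a + (k + 1) by omega, hf a, add_zero]
      simp only [add_assoc, add_comm 1]

variable {W m : ℕ}

/-- Waiting times for the messages of a group that is broadcast in round robin order. -/
theorem sum_wait_roundRobin_le (D : Grouped m) (G : Label) (S : Schedule W m) (cnt : ℕ → ℕ)
    (h : ∀ v r, r < cnt v → ∃ k, S v k = D.nth G (∑ s ∈ Finset.range v, cnt s + r)) (n t : ℕ) :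
    ∑ i ∈ D.group G, ((nextTime S n i t - t : ℕ) : ℝ≥0∞) ≤
      ∑ j ∈ Finset.range (D.size G), countWait cnt (j + 1) t := by
  rcases Nat.eq_zero_or_pos (D.size G) with h0 | hpos
  · rw [Finset.card_eq_zero.1 h0]; simp
  set n0 := ∑ s ∈ Finset.range (t + 1), cnt s with hn0
  have hlen : ((D.group G).sort (· ≤ ·)).length = D.size G := Finset.length_sort _
  let F : ℕ → ℝ≥0∞ := fun r => if hr : r % D.size G < ((D.group G).sort (· ≤ ·)).length then
    ((nextTime S n (((D.group G).sort (· ≤ ·))[r % D.size G]) t - t : ℕ) : ℝ≥0∞) else 0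
  have h1 : ∑ i ∈ D.group G, ((nextTime S n i t - t : ℕ) : ℝ≥0∞) =
      ∑ r ∈ Finset.range (D.size G), F r := by
    rw [← Finset.sum_coe_sort, ← (Equiv.sum_comp ((D.group G).orderIsoOfFin rfl).toEquiv _),
      Finset.sum_range]
    refine Finset.sum_congr rfl fun r _ => ?_
    have hr : (r : ℕ) < D.size G := r.2
    simp only [F, Nat.mod_eq_of_lt hr, hlen, hr, dif_pos]
    rfl
  -- The next `D.size G` broadcasts of the group, with indices from `n0` on, form a complete residue
  -- system, so each message occurs exactly once among them. Thus the sum over the messages equals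
  -- the sum over the positions in the queue.
  have h2 : ∑ r ∈ Finset.range (D.size G), F r = ∑ j ∈ Finset.range (D.size G), F (n0 + j) :=
    (sum_range_add_of_periodic (fun s => by simp only [F, Nat.add_mod_right]) n0).symm
  rw [h1, h2]
  refine Finset.sum_le_sum fun j _ => ?_
  have hlt : (n0 + j) % D.size G < ((D.group G).sort (· ≤ ·)).length := by
    rw [hlen]; exact Nat.mod_lt _ hpos
  simp only [F, hlt, dif_pos]
  refine le_iInf₂ fun y hy => ?_
  have hex : ∃ v, n0 + j < ∑ s ∈ Finset.range (v + 1), cnt s := ⟨y, by omega⟩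
  classical
  set v := Nat.find hex with hv
  have hv1 : n0 + j < ∑ s ∈ Finset.range (v + 1), cnt s := Nat.find_spec hex
  have hvy : v ≤ y := Nat.find_min' hex (by omega)
  have hv2 : ∑ s ∈ Finset.range v, cnt s ≤ n0 + j := by
    rcases Nat.eq_zero_or_pos v with h0 | hp
    · rw [h0]; simp
    · have := Nat.find_min hex (m := v - 1) (by omega)
      rwa [Nat.sub_add_cancel hp, not_lt] at this
  have htv : t < v := by
    by_contra hle
    have := prefix_mono cnt (show v + 1 ≤ t + 1 by omega)
    simp only at this
    omega
  rw [Finset.sum_range_succ] at hv1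
  obtain ⟨k, hk⟩ := h v (n0 + j - ∑ s ∈ Finset.range v, cnt s) (by omega)
  rw [Nat.add_sub_cancel' hv2, Grouped.nth, List.getElem?_eq_getElem hlt] at hk
  have := nextTime_le_of_broadcast (n := n) htv ⟨k, hk⟩
  exact_mod_cast Nat.sub_le_sub_right (this.trans hvy) t

/-- Applied to the channels of one slot on which the same group is drawn: they receive consecutive
messages, and every queue index in the range belongs to some channel. -/
lemma exists_card_filter_lt_eq {α : Type*} [LinearOrder α] (F : Finset α) {r : ℕ}
    (hr : r < F.card) : ∃ k ∈ F, (F.filter (· < k)).card = r := by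
  refine ⟨F.orderEmbOfFin rfl ⟨r, hr⟩, Finset.orderEmbOfFin_mem _ _ _, ?_⟩
  have h : F.filter (· < F.orderEmbOfFin rfl ⟨r, hr⟩) =
      (Finset.Iio (⟨r, hr⟩ : Fin F.card)).map (F.orderEmbOfFin rfl).toEmbedding := by
    ext a
    rw [Finset.mem_filter, Finset.mem_map]
    constructor
    · rintro ⟨ha, hlt⟩
      obtain ⟨b, rfl⟩ : a ∈ Set.range (F.orderEmbOfFin rfl) := by
        rw [Finset.range_orderEmbOfFin]; exact ha
      exact ⟨b, Finset.mem_Iio.2 ((F.orderEmbOfFin rfl).lt_iff_lt.1 hlt), rfl⟩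
    · rintro ⟨b, hb, rfl⟩
      exact ⟨Finset.orderEmbOfFin_mem _ _ _, (F.orderEmbOfFin rfl).lt_iff_lt.2 (Finset.mem_Iio.1 hb)⟩
  rw [h, Finset.card_map, Fin.card_Iio]

/-- The empty positions of the slot `s`. -/
def emptySlots (S : Schedule W m) (s : ℕ) : Finset (ℕ × Fin W) :=
  ({s} ×ˢ Finset.univ).filter fun z => S z.1 z.2 = none

lemma sum_emptySlots {M : Type*} [AddCommMonoid M] (S : Schedule W m) (s : ℕ)
    (f : ℕ × Fin W → M) :
    ∑ z ∈ emptySlots S s, f z = ∑ k, if S s k = none then f (s, k) else 0 := by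
  rw [emptySlots, Finset.sum_filter, Finset.sum_product, Finset.sum_singleton]

/-- The number of draws of `G` for the empty positions of the slot `s`. -/
def emptyDraws (S : Schedule W m) (G : Label) (d : ℕ × Fin W → Option Label) (s : ℕ) : ℕ :=
  drawCount G (emptySlots S s) d

lemma emptyDraws_eq (S : Schedule W m) (G : Label) (d : ℕ × Fin W → Option Label) (s : ℕ) :
    emptyDraws S G d s =
      (Finset.univ.filter fun k => S s k = none ∧ d (s, k) = some G).card := by
  rw [emptyDraws, drawCount_eq_sum, sum_emptySlots, Finset.card_filter]
  exact Finset.sum_congr rfl fun k _ => by rw [ite_and]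

lemma fill_of_draw (D : Grouped m) {S : Schedule W m} {G : Label} {d : ℕ × Fin W → Option Label}
    {s : ℕ} {k : Fin W} (hk : S s k = none) (hd : d (s, k) = some G) :
    fill D S d s k = D.nth G (∑ v ∈ Finset.range s, emptyDraws S G d v +
      ((Finset.univ.filter fun k => S s k = none ∧ d (s, k) = some G).filter (· < k)).card) := by
  have h : ((Finset.range (s + 1) ×ˢ (Finset.univ : Finset (Fin W))).filter fun z =>
        (z.1 < s ∨ z.1 = s ∧ z.2 < k) ∧ S z.1 z.2 = none ∧ d z = some G).card =
      ∑ v ∈ Finset.range s, emptyDraws S G d v +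
      ((Finset.univ.filter fun k => S s k = none ∧ d (s, k) = some G).filter (· < k)).card := by
    rw [Finset.card_filter, Finset.sum_product, Finset.sum_range_succ]
    congr 1
    · refine Finset.sum_congr rfl fun v hv => ?_
      rw [emptyDraws_eq, Finset.card_filter]
      simp [Finset.mem_range.1 hv]
    · rw [Finset.filter_filter, Finset.card_filter]
      refine Finset.sum_congr rfl fun k' _ => ?_
      simp [and_comm]
  simp only [fill, hk, hd, h]

lemma exists_fill_eq_nth (D : Grouped m) (S : Schedule W m) (G : Label)
    (d : ℕ × Fin W → Option Label) {s r : ℕ} (hr : r < emptyDraws S G d s) :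
    ∃ k, fill D S d s k = D.nth G (∑ v ∈ Finset.range s, emptyDraws S G d v + r) := by
  rw [emptyDraws_eq] at hr
  obtain ⟨k, hk, hkr⟩ := exists_card_filter_lt_eq _ hr
  obtain ⟨-, h1, h2⟩ := Finset.mem_filter.1 hk
  exact ⟨k, by rw [fill_of_draw D h1 h2, hkr]⟩

variable {N x : ℕ} (D : Grouped m) (S : Schedule W m) (d : ℕ × Fin W → Option Label)
  (e : ℕ → Option Label)

lemma output_of_not_inserted {t : ℕ} (h : ¬ (x ≤ t ∧ N ∣ t - x)) :
    output D N S (x, d, e) t = fill D S d (origIndex N x t) := by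
  funext k
  simp only [output, insertSlots, if_neg h, origIndex]

lemma output_of_inserted {t : ℕ} (h : x ≤ t ∧ N ∣ t - x) (k : Fin W) :
    output D N S (x, d, e) t k = if k.val = 0 then roundRobin D e ((t - x) / N) else none := by
  simp only [output, insertSlots, if_pos h]

/-- The number of slots inserted before the time `t`. -/
def insertedBefore (N x t : ℕ) : ℕ := (t - x + N - 1) / N

lemma insertedBefore_add {k r : ℕ} (h1 : 1 ≤ r) (h2 : r ≤ N) :
    insertedBefore N x (x + k * N + r) = k + 1 := by
  rw [insertedBefore, show x + k * N + r - x + N - 1 = (r - 1) + (k + 1) * N by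
    rw [Nat.succ_mul]; omega, Nat.add_mul_div_right _ _ (by omega), Nat.div_eq_of_lt (by omega),
    zero_add]

lemma insertedBefore_of_le (hN : 1 ≤ N) {t : ℕ} (h : t ≤ x) : insertedBefore N x t = 0 := by
  rw [insertedBefore, Nat.sub_eq_zero_of_le h, zero_add, Nat.div_eq_of_lt (by omega)]

lemma insertedBefore_inserted (hN : 1 ≤ N) (k : ℕ) : insertedBefore N x (x + k * N) = k := by
  cases k with
  | zero => exact insertedBefore_of_le hN (by simp)
  | succ k =>
    rw [Nat.succ_mul, ← Nat.add_assoc]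
    exact insertedBefore_add hN le_rfl

lemma insertedBefore_add_period (hx : x < N) (t κ : ℕ) :
    insertedBefore N x (t + 1 + κ * N) = insertedBefore N x (t + 1) + κ := by
  have hN : 0 < N := by omega
  rcases le_or_gt x (t + 1) with h | h
  · rw [insertedBefore, insertedBefore, show t + 1 + κ * N - x + N - 1 =
      (t + 1 - x + N - 1) + κ * N by omega, Nat.add_mul_div_right _ _ hN]
  · rw [insertedBefore_of_le hN h.le]
    cases κ with
    | zero => simpa using insertedBefore_of_le hN h.le
    | succ κ =>
      rw [Nat.succ_mul, show t + 1 + (κ * N + N) = x + κ * N + (N - (x - (t + 1))) by omega,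
        insertedBefore_add (by omega) (by omega), zero_add]

/-- The number of draws of `G` for the slot `t` if `t` is an inserted slot. -/
def insertedDraws (N x : ℕ) (G : Label) (e : ℕ → Option Label) (t : ℕ) : ℕ :=
  if x ≤ t ∧ N ∣ t - x then drawCount G {(t - x) / N} e else 0

lemma drawCount_range_succ (G : Label) (e : ℕ → Option Label) (n : ℕ) :
    drawCount G (Finset.range (n + 1)) e = drawCount G (Finset.range n) e + drawCount G {n} e := by
  simp only [drawCount_eq_sum, Finset.sum_range_succ, Finset.sum_singleton]

lemma sum_insertedDraws (hN : 1 ≤ N) (G : Label) (v : ℕ) :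
    ∑ s ∈ Finset.range v, insertedDraws N x G e s =
      drawCount G (Finset.range (insertedBefore N x v)) e := by
  induction v with
  | zero => rw [insertedBefore_of_le hN (Nat.zero_le _)]; simp [drawCount]
  | succ v ih =>
    rw [Finset.sum_range_succ, ih]
    rcases slot_cases (x := x) hN v with h | ⟨k, rfl⟩ | ⟨k, r, h1, h2, rfl⟩
    · rw [insertedBefore_of_le hN h.le, insertedBefore_of_le hN h, insertedDraws,
        if_neg (not_inserted_of_lt h), add_zero]
    · rw [insertedDraws, if_pos (inserted_add k), insertedBefore_inserted hN,
        insertedBefore_add le_rfl hN, drawCount_range_succ,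
        Nat.add_sub_cancel_left, Nat.mul_div_cancel _ hN]
    · rw [insertedDraws, if_neg (not_inserted_add h1 h2), add_zero, insertedBefore_add h1 h2.le,
        add_assoc, insertedBefore_add (by omega) h2]

lemma sum_wait_filled_le (hN : 1 ≤ N) (G : Label) (n t : ℕ) :
    ∑ i ∈ D.group G, ((nextTime (output D N S (x, d, e)) n i t - t : ℕ) : ℝ≥0∞) ≤
      ∑ j ∈ Finset.range (D.size G), countWait (stretch N x (emptyDraws S G d)) (j + 1) t := by
  refine sum_wait_roundRobin_le D G _ _ (fun v r hr => ?_) n t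
  rw [stretch] at hr
  split_ifs at hr with h
  · omega
  · rw [output_of_not_inserted D S d e h, sum_stretch hN]
    exact exists_fill_eq_nth D S G d hr

lemma sum_wait_inserted_le (hW : 1 ≤ W) (hN : 1 ≤ N) (G : Label) (n t : ℕ) :
    ∑ i ∈ D.group G, ((nextTime (output D N S (x, d, e)) n i t - t : ℕ) : ℝ≥0∞) ≤
      ∑ j ∈ Finset.range (D.size G), countWait (insertedDraws N x G e) (j + 1) t := by
  refine sum_wait_roundRobin_le D G _ _ (fun v r hr => ⟨⟨0, hW⟩, ?_⟩) n t
  rw [sum_insertedDraws e hN]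
  rw [insertedDraws] at hr
  split_ifs at hr with h
  · rw [output_of_inserted D S d e h, if_pos rfl]
    have hr1 := hr.trans_le (drawCount_le _ _ _)
    rw [Finset.card_singleton, Nat.lt_one_iff] at hr1
    subst hr1
    have hd : e ((v - x) / N) = some G := by
      by_contra hne
      simp [drawCount, Finset.filter_singleton, hne] at hr
    obtain ⟨k, hk⟩ := h.2
    have hv : v = x + k * N := by rw [mul_comm] at hk; omega
    subst hv
    rw [Nat.add_sub_cancel_left, Nat.mul_div_cancel _ hN] at hd ⊢
    rw [insertedBefore_inserted hN]
    simp only [roundRobin, hd, add_zero]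
    rfl
  · omega

end RoundRobin

/-! ### A pathwise bound for the cost of each slot of the output -/

section SlotBound

lemma countWait_anti {c c' : ℕ → ℕ} (h : ∀ s, c s ≤ c' s) {j : ℕ} (hj : 1 ≤ j) (t : ℕ) :
    countWait c' j t ≤ countWait c j t := by
  refine le_iInf₂ fun y hy => countWait_le ?_
  have hty : t + 1 ≤ y + 1 := Nat.succ_le_succ (lt_of_prefix_le hj hy).le
  rw [← Finset.sum_range_add_sum_Ico c' hty]
  rw [← Finset.sum_range_add_sum_Ico c hty] at hy
  have : ∑ s ∈ Finset.Ico (t + 1) (y + 1), c s ≤ ∑ s ∈ Finset.Ico (t + 1) (y + 1), c' s :=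
    Finset.sum_le_sum fun s _ => h s
  omega

variable {W m : ℕ}

lemma sum_ite_eq_some_elim {M : Type*} [AddCommMonoid M] (o : Option (Fin m)) (w : Fin m → M) :
    (∑ i, if o = some i then w i else 0) = o.elim 0 w := by
  cases o with
  | none => simp
  | some j => simp

/-- Broadcast cost of a message of the drawn group. -/
def drawCost (D : Grouped m) (o : Option Label) : ℝ≥0∞ := o.elim 0 fun G => ENNReal.ofReal (D.cst G)

lemma nth_elim_le (D : Grouped m) (G : Label) (n : ℕ) :
    (D.nth G n).elim 0 (fun i => ENNReal.ofReal (D.c i)) ≤ ENNReal.ofReal (D.cst G) := by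
  rcases h : D.nth G n with _ | i
  · simp
  · have hi : i ∈ D.group G := by
      have := List.mem_of_getElem? h
      rwa [Finset.mem_sort] at this
    have : D.label i = G := (Finset.mem_filter.1 hi).2
    simp [Grouped.c, this]

variable (D : Grouped m) (N : ℕ) (S : Schedule W m) (A B Q : Finset Label) (x t : ℕ)
  (d : ℕ × Fin W → Option Label) (e : ℕ → Option Label)

/-- Bound for the broadcast cost of the slot `t` of the output. -/
def bcBound : ℝ≥0∞ :=
  if x ≤ t ∧ N ∣ t - x then drawCost D (e ((t - x) / N))
  else slotBc D.c (D.messages A) S (origIndex N x t) +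
    ∑ z ∈ emptySlots S (origIndex N x t), drawCost D (d z)

/-- Bound for the waiting times for the messages of `A`. -/
def waitBound : ℝ≥0∞ :=
  ∑ i ∈ D.messages A, ENNReal.ofReal (D.p i) * countWait (stretch N x (airs S i)) 1 t

/-- Bound for the waiting times for the messages of `B`. -/
def filledBound : ℝ≥0∞ :=
  ∑ G ∈ B, ENNReal.ofReal (D.prob G) *
    ∑ j ∈ Finset.range (D.size G), countWait (stretch N x (emptyDraws S G d)) (j + 1) t

/-- Bound for the waiting times for the messages of `Q`. -/
def insertedBound : ℝ≥0∞ :=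
  ∑ G ∈ Q, ENNReal.ofReal (D.prob G) *
    ∑ j ∈ Finset.range (D.size G), countWait (insertedDraws N x G e) (j + 1) t

/-- Bound for the contribution of the slot `t` to the cost of the output. -/
def slotBound : ℝ≥0∞ :=
  waitBound D N S A x t + filledBound D N S B x t d + insertedBound D N Q x t e +
    bcBound D N S A x t d e

variable {D N S A B Q x t d e}

lemma fill_of_some {s : ℕ} {k : Fin W} {i : Fin m} (h : S s k = some i) :
    fill D S d s k = some i := by
  simp only [fill, h]

lemma slotBc_output_le (hS : ∀ t k i, S t k = some i → i ∈ D.messages A) :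
    slotBc D.c Finset.univ (output D N S (x, d, e)) t ≤ bcBound D N S A x t d e := by
  rw [slotBc, bcBound]
  simp only [sum_ite_eq_some_elim]
  split_ifs with h
  · simp only [output_of_inserted D S d e h]
    calc ∑ k : Fin W, Option.elim (if k.val = 0 then roundRobin D e ((t - x) / N) else none) 0
          (fun i => ENNReal.ofReal (D.c i))
        ≤ ∑ k : Fin W, if k.val = 0 then drawCost D (e ((t - x) / N)) else 0 := by
          refine Finset.sum_le_sum fun k _ => ?_
          split_ifs
          · rw [roundRobin]
            rcases he : e ((t - x) / N) with _ | G
            · simp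
            · exact nth_elim_le D G _
          · simp
      _ ≤ drawCost D (e ((t - x) / N)) := by
          rw [← Finset.sum_filter, Finset.sum_const]
          have hcard : (Finset.univ.filter fun k : Fin W => k.val = 0).card ≤ 1 :=
            Finset.card_le_one.2 fun a ha b hb => Fin.ext (by
              rw [(Finset.mem_filter.1 ha).2, (Finset.mem_filter.1 hb).2])
          calc _ ≤ 1 • drawCost D (e ((t - x) / N)) := nsmul_le_nsmul_left zero_le hcard
            _ = _ := one_nsmul _
  · rw [output_of_not_inserted D S d e h, slotBc, sum_emptySlots, ← Finset.sum_add_distrib]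
    refine Finset.sum_le_sum fun k _ => ?_
    rcases hk : S (origIndex N x t) k with _ | i
    · simp only [reduceCtorEq, if_false, Finset.sum_const_zero, zero_add, if_true]
      rcases hd : d (origIndex N x t, k) with _ | G
      · simp [fill, hk, hd]
      · rw [fill_of_draw D hk hd]
        exact nth_elim_le D G _
    · rw [fill_of_some hk]
      simp [hS _ _ _ hk]

lemma sum_univ_eq {M : Type*} [AddCommMonoid M] (hcov : A ∪ B ∪ Q = D.labels)
    (hAB : Disjoint A B) (hAQ : Disjoint A Q) (hBQ : Disjoint B Q) (f : Fin m → M) :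
    ∑ i, f i = ∑ i ∈ D.messages A, f i + ∑ G ∈ B, ∑ i ∈ D.group G, f i +
      ∑ G ∈ Q, ∑ i ∈ D.group G, f i := by
  have h1 : D.messages D.labels = Finset.univ := by
    ext i
    simp [Grouped.messages, Grouped.labels]
  rw [← h1, sum_messages, sum_messages, ← hcov,
    Finset.sum_union (Finset.disjoint_union_left.2 ⟨hAQ, hBQ⟩), Finset.sum_union hAB]

/-- The bound does not depend on the truncation time `n` and treats `A`, `B` and `Q` separately: the
output contains the stretched schedule of `A`, the filled positions serve `B`, and the inserted
slots serve `Q`. -/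
theorem slotCost_output_le (hW : 1 ≤ W) (hN : 1 ≤ N) (hcov : A ∪ B ∪ Q = D.labels)
    (hAB : Disjoint A B) (hAQ : Disjoint A Q) (hBQ : Disjoint B Q)
    (hS : ∀ t k i, S t k = some i → i ∈ D.messages A) (n : ℕ) :
    slotCost D.p D.c Finset.univ (output D N S (x, d, e)) n t ≤
      slotBound D N S A B Q x t d e := by
  rw [slotCost, slotBound, sum_univ_eq hcov hAB hAQ hBQ]
  refine add_le_add (add_le_add (add_le_add ?_ ?_) ?_) (slotBc_output_le hS)
  · refine Finset.sum_le_sum fun i _ => ?_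
    gcongr
    refine nextTime_sub_le_countWait.trans (countWait_anti (fun s => ?_) le_rfl t)
    rw [stretch]
    split_ifs with h
    · exact Nat.zero_le _
    · rw [airs]
      split_ifs with h2
      · obtain ⟨k, hk⟩ := h2
        have : ∃ k, output D N S (x, d, e) s k = some i :=
          ⟨k, by rw [output_of_not_inserted D S d e h]; exact fill_of_some hk⟩
        rw [airs, if_pos this]
      · exact Nat.zero_le _
  · refine Finset.sum_le_sum fun G _ => ?_
    rw [sum_group_p D G fun a _ i => ENNReal.ofReal a *
      ((nextTime (output D N S (x, d, e)) n i t - t : ℕ) : ℝ≥0∞), ← Finset.mul_sum]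
    gcongr
    exact sum_wait_filled_le D S d e hN G n t
  · refine Finset.sum_le_sum fun G _ => ?_
    rw [sum_group_p D G fun a _ i => ENNReal.ofReal a *
      ((nextTime (output D N S (x, d, e)) n i t - t : ℕ) : ℝ≥0∞), ← Finset.mul_sum]
    gcongr
    exact sum_wait_inserted_le D S d e hW hN G n t

lemma measurable_stretch_emptyDraws (G : Label) (s : ℕ) :
    Measurable fun d : ℕ × Fin W → Option Label => stretch N x (emptyDraws S G d) s := by
  unfold stretch emptyDraws
  split_ifs
  exacts [measurable_const, measurable_drawCount G _]

lemma measurable_insertedDraws (G : Label) (s : ℕ) :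
    Measurable fun e : ℕ → Option Label => insertedDraws N x G e s := by
  unfold insertedDraws
  split_ifs
  exacts [measurable_drawCount G _, measurable_const]

lemma measurable_filledBound : Measurable fun d => filledBound D N S B x t d :=
  Finset.measurable_sum _ fun G _ => measurable_const.mul (Finset.measurable_sum _ fun _ _ =>
    measurable_countWait (fun s => measurable_stretch_emptyDraws G s) _ _)

lemma measurable_insertedBound : Measurable fun e => insertedBound D N Q x t e :=
  Finset.measurable_sum _ fun G _ => measurable_const.mul (Finset.measurable_sum _ fun _ _ =>
    measurable_countWait (fun s => measurable_insertedDraws G s) _ _)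

lemma measurable_bcBound : Measurable fun z : (ℕ × Fin W → Option Label) × (ℕ → Option Label) =>
    bcBound D N S A x t z.1 z.2 := by
  unfold bcBound
  split_ifs
  · exact (measurable_of_countable (drawCost D)).comp
      ((measurable_pi_apply _).comp measurable_snd)
  · exact measurable_const.add (Finset.measurable_sum _ fun z _ =>
      (measurable_of_countable (drawCost D)).comp ((measurable_pi_apply _).comp measurable_fst))

lemma measurable_slotBound : Measurable fun z : (ℕ × Fin W → Option Label) × (ℕ → Option Label) =>
    slotBound D N S A B Q x t z.1 z.2 :=
  (((measurable_const.add (measurable_filledBound.comp measurable_fst)).add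
    (measurable_insertedBound.comp measurable_snd))).add measurable_bcBound

/-! ### Shift equivariance and passage to expectations -/

section Shift

variable {P : ℕ}

lemma emptyDraws_add (hS : ∀ t k, S (t + P) k = S t k) (G : Label) (s : ℕ) :
    emptyDraws S G d (s + P) = emptyDraws S G (fun z => d (z.1 + P, z.2)) s := by
  simp only [emptyDraws_eq, hS]

lemma insertedDraws_add (hx : x < N) (G : Label) :
    insertedDraws N x G e (t + N * P) = insertedDraws N x G (fun l => e (l + P)) t := by
  simp only [insertedDraws, inserted_add_period hx]
  split_ifs with h
  · rw [show t + N * P - x = t - x + P * N by rw [mul_comm]; omega,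
      Nat.add_mul_div_right _ _ (by omega)]
    simp only [drawCount_eq_sum, Finset.sum_singleton]
  · rfl

lemma periodic_mul (hS : ∀ t k, S (t + P) k = S t k) (M t : ℕ) (k : Fin W) :
    S (t + M * P) k = S t k := by
  have h : Function.Periodic (fun t => S t k) P := fun t => hS t k
  exact h.nat_mul M t

lemma countWait_stretch_add (hx : x < N) (c : ℕ → ℕ) {j : ℕ} (hj : 1 ≤ j) :
    countWait (stretch N x c) j (t + N * P) =
      countWait (stretch N x fun s => c (s + (N - 1) * P)) j t := by
  rw [countWait_shift hj]
  simp only [stretch_add_period hx]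

/-- `N * P` slots of the output consist of `(N - 1) * P` original slots, a whole number of periods
of `S`, and `P` inserted ones. Moving on by them only renumbers the two families of draws. -/
lemma slotBound_add (hx : x < N) (hS : ∀ t k, S (t + P) k = S t k) :
    slotBound D N S A B Q x (t + N * P) d e = slotBound D N S A B Q x t
      (fun z => d (z.1 + (N - 1) * P, z.2)) (fun l => e (l + P)) := by
  have hS' := periodic_mul hS (N - 1)
  have hN : 1 ≤ N := by omega
  have h1 : ∀ i, (fun s => airs S i (s + (N - 1) * P)) = airs S i := by
    intro i
    funext s
    simp only [airs, hS']
  have h2 : ∀ G, (fun s => emptyDraws S G d (s + (N - 1) * P)) =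
      emptyDraws S G fun z => d (z.1 + (N - 1) * P, z.2) :=
    fun G => funext fun s => emptyDraws_add hS' G s
  have h3 : ∀ G, (fun s => insertedDraws N x G e (s + N * P)) =
      insertedDraws N x G fun l => e (l + P) :=
    fun G => funext fun s => insertedDraws_add hx G
  simp only [slotBound]
  congr 1
  · congr 1
    · congr 1
      · simp only [waitBound, countWait_stretch_add hx _ le_rfl, h1]
      · simp only [filledBound, countWait_stretch_add hx _ (Nat.succ_le_succ (Nat.zero_le _)), h2]
    · simp only [insertedBound, countWait_shift (Nat.succ_le_succ (Nat.zero_le _)), h3]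
  · simp only [bcBound, inserted_add_period hx]
    split_ifs with h
    · rw [show t + N * P - x = t - x + P * N by rw [mul_comm]; omega,
        Nat.add_mul_div_right _ _ (by omega)]
    · simp only [origIndex_add_period hN hx, sum_emptySlots, slotBc, hS']

lemma measurePreserving_shift {ι : Type*} (q : PMF (Option Label)) {f : ι → ι}
    (hf : Function.Injective f) :
    MeasurePreserving (fun (d : ι → Option Label) i => d (f i)) (drawsLaw ι q) (drawsLaw ι q) :=
  ⟨measurable_pi_lambda _ fun _ => measurable_pi_apply _,
    Measure.map_infinitePi_infinitePi_of_inj hf⟩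

/-- For a fixed offset `x`, renumbering independent identically distributed draws preserves their
law, so `lintegral_limsup_average_le` applies with period `N * P`. The summand `1 / 2` is the half
slot of `cost_add_half`. -/
theorem lintegral_cost_output_add_half_le (hW : 1 ≤ W) (hx : x < N)
    (hcov : A ∪ B ∪ Q = D.labels)
    (hAB : Disjoint A B) (hAQ : Disjoint A Q) (hBQ : Disjoint B Q)
    (hSA : ∀ t k i, S t k = some i → i ∈ D.messages A) (hP : 1 ≤ P)
    (hS : ∀ t k, S (t + P) k = S t k) (hp : ∀ i, 0 ≤ D.p i) (hc : ∀ i, 0 ≤ D.c i)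
    (hp1 : ∑ i, D.p i = 1) (qB qQ : PMF (Option Label)) :
    ∫⁻ z, cost D.p D.c Finset.univ (output D N S (x, z)) ∂(drawsLaw (ℕ × Fin W) qB).prod
        (drawsLaw ℕ qQ) + ENNReal.ofReal (1 / 2) ≤
      (∑ t ∈ Finset.range (N * P), ∫⁻ z, slotBound D N S A B Q x t z.1 z.2
        ∂(drawsLaw (ℕ × Fin W) qB).prod (drawsLaw ℕ qQ)) / (N * P : ℕ) := by
  set μ := (drawsLaw (ℕ × Fin W) qB).prod (drawsLaw ℕ qQ) with hμ
  have hT : MeasurePreserving (Prod.map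
      (fun (d : ℕ × Fin W → Option Label) z => d (z.1 + (N - 1) * P, z.2))
      (fun (e : ℕ → Option Label) l => e (l + P))) μ μ := by
    refine (measurePreserving_shift qB (f := fun z : ℕ × Fin W => (z.1 + (N - 1) * P, z.2))
      fun a b h => ?_).prod (measurePreserving_shift qQ (f := fun l => l + P) fun a b h => ?_)
    · simp only [Prod.mk.injEq] at h
      exact Prod.ext (by omega) h.2
    · simpa using h
  refine le_trans ?_ (lintegral_limsup_average_le hT (L := N * P) (Nat.mul_pos (by omega) hP)
    (fun t z => slotBound D N S A B Q x t z.1 z.2) (fun t => measurable_slotBound)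
    fun t z => slotBound_add hx hS)
  rw [show ENNReal.ofReal (1 / 2) = ∫⁻ _, ENNReal.ofReal (1 / 2) ∂μ by simp,
    ← lintegral_add_right _ measurable_const]
  refine lintegral_mono fun z => ?_
  have := cost_add_half_le hp hc (X := Finset.univ) (S := output D N S (x, z))
    (y := fun t => slotBound D N S A B Q x t z.1 z.2) fun n t _ =>
      slotCost_output_le hW (by omega) hcov hAB hAQ hBQ hSA n
  rwa [hp1] at this

end Shift

end SlotBound

/-! ### Expected slot costs, summed over a period and over all offsets -/

section Expectation

variable {W m : ℕ} {D : Grouped m} {N : ℕ} {S : Schedule W m} {A B Q : Finset Label} {P : ℕ}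

lemma sum_range_mul_of_periodic {M : Type*} [Semiring M] {f : ℕ → M}
    (hf : ∀ s, f (s + P) = f s) (k : ℕ) :
    ∑ s ∈ Finset.range (k * P), f s = k * ∑ s ∈ Finset.range P, f s := by
  rw [sum_range_mul_eq]
  have h : ∀ j, ∑ r ∈ Finset.range P, f (j * P + r) = ∑ s ∈ Finset.range P, f s :=
    fun j => sum_range_add_of_periodic hf (j * P)
  simp only [h, Finset.sum_const, Finset.card_range, nsmul_eq_mul]

lemma countWait_add_of_periodic {c : ℕ → ℕ} (hc : ∀ s, c (s + P) = c s) {j : ℕ} (hj : 1 ≤ j)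
    (t : ℕ) : countWait c j (t + P) = countWait c j t := by
  rw [countWait_shift hj]
  simp only [hc]

/-- No randomness besides the offset is involved: this is `sum_countWait_stretch_le` for each
message of `A`, over `N - 1` periods of `S`. -/
lemma sum_waitBound_le (hN : 2 ≤ N) (hS : ∀ t k, S (t + P) k = S t k) :
    ∑ x ∈ Finset.range (N - 1), ∑ t ∈ Finset.range (N * P), waitBound D N S A x t ≤
      (N - 1 : ℕ) * ((N + 2) * ∑ u ∈ Finset.range P,
          ∑ i ∈ D.messages A, ENNReal.ofReal (D.p i) * countWait (airs S i) 1 u +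
        P * ∑ i ∈ D.messages A, ENNReal.ofReal (D.p i)) := by
  have h1 : ∀ i, ∑ x ∈ Finset.range (N - 1), ∑ t ∈ Finset.range (N * P),
      countWait (stretch N x (airs S i)) 1 t ≤
        (N - 1 : ℕ) * ∑ u ∈ Finset.range P, ((N + 2) * countWait (airs S i) 1 u + 1) := by
    intro i
    rw [mul_comm N P]
    refine (sum_countWait_stretch_le hN (airs S i) 1 P le_rfl).trans_eq ?_
    rw [mul_comm P]
    refine sum_range_mul_of_periodic (fun s => ?_) (N - 1)
    rw [countWait_add_of_periodic (fun s => by simp only [airs, hS]) le_rfl]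
  calc ∑ x ∈ Finset.range (N - 1), ∑ t ∈ Finset.range (N * P), waitBound D N S A x t
      = ∑ i ∈ D.messages A, ENNReal.ofReal (D.p i) * ∑ x ∈ Finset.range (N - 1),
          ∑ t ∈ Finset.range (N * P), countWait (stretch N x (airs S i)) 1 t := by
        simp only [waitBound, Finset.mul_sum]
        rw [Finset.sum_congr rfl fun x _ => Finset.sum_comm, Finset.sum_comm]
    _ ≤ ∑ i ∈ D.messages A, ENNReal.ofReal (D.p i) *
          ((N - 1 : ℕ) * ∑ u ∈ Finset.range P, ((N + 2) * countWait (airs S i) 1 u + 1)) := by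
        gcongr with i _
        exact h1 i
    _ = _ := by
        rw [Finset.sum_comm, Finset.mul_sum, Finset.mul_sum, ← Finset.sum_add_distrib,
          Finset.mul_sum]
        refine Finset.sum_congr rfl fun i _ => ?_
        rw [Finset.sum_add_distrib, ← Finset.mul_sum, ← Finset.mul_sum]
        simp only [Finset.sum_const, Finset.card_range, nsmul_eq_mul]
        ring

lemma le_ofReal_div_of_mul_le {a b : ℝ} {I : ℝ≥0∞} (ha : 0 < a)
    (h : ENNReal.ofReal a * I ≤ ENNReal.ofReal b) : I ≤ ENNReal.ofReal (b / a) := by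
  rw [ENNReal.ofReal_div_of_pos ha, ENNReal.le_div_iff_mul_le
    (Or.inl (ENNReal.ofReal_pos.2 ha).ne') (Or.inl ENNReal.ofReal_ne_top), mul_comm]
  exact h

lemma drawCount_biUnion {ι κ : Type*} [DecidableEq ι] (G : Label) (d : ι → Option Label)
    (s : Finset κ) (I : κ → Finset ι) (h : (s : Set κ).PairwiseDisjoint I) :
    drawCount G (s.biUnion I) d = ∑ a ∈ s, drawCount G (I a) d := by
  simp only [drawCount_eq_sum]
  exact Finset.sum_biUnion h

lemma disjoint_emptySlots (S : Schedule W m) {a b : ℕ} (h : a ≠ b) :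
    Disjoint (emptySlots S a) (emptySlots S b) := by
  refine Finset.disjoint_left.2 fun z hz hz' => h ?_
  simp only [emptySlots, Finset.mem_filter, Finset.mem_product, Finset.mem_singleton] at hz hz'
  rw [← hz.1.1, ← hz'.1.1]

/-- Expected waiting time for the `j`-th draw of `G` for the empty positions. -/
lemma lintegral_countWait_emptyDraws_le (hP : 1 ≤ P) (hS : ∀ t k, S (t + P) k = S t k)
    {qB : PMF (Option Label)} {G : Label} {β τ : ℝ} (hβ : 0 < β) (hτ : 0 < τ) (hW : 1 ≤ W)
    (hE : ((∑ s ∈ Finset.range P, (emptySlots S s).card : ℕ) : ℝ) = β * W * P)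
    (hq : qB (some G) = ENNReal.ofReal (1 / (τ * β * W))) (j u : ℕ) :
    ∫⁻ d, countWait (emptyDraws S G d) (j + 1) u ∂drawsLaw (ℕ × Fin W) qB ≤
      ENNReal.ofReal ((j + β * W * P) * τ) := by
  classical
  have hW0 : (0 : ℝ) < W := by exact_mod_cast hW
  have hP0 : (0 : ℝ) < P := by exact_mod_cast hP
  set E := ∑ s ∈ Finset.range P, (emptySlots S s).card with hEdef
  -- A chunk consists of the empty positions of one full period following the slot `u`; it has `E =
  -- β * W * P` elements regardless of how they are distributed. A chunk contains `P / τ` draws of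
  -- `G` on average, so the bound is `τ` times the number of successes including the overshoot.
  set I : ℕ → Finset (ℕ × Fin W) := fun κ =>
    (Finset.range P).biUnion fun r => emptySlots S (u + κ * P + 1 + r) with hI
  have hIcard : ∀ κ, (I κ).card = E := by
    intro κ
    rw [hI, Finset.card_biUnion fun a _ b _ hab => disjoint_emptySlots S (by omega)]
    refine sum_range_add_of_periodic (f := fun s => (emptySlots S s).card) (fun s => ?_) _
    simp only [Finset.card_eq_sum_ones, sum_emptySlots, hS]
  have h := lintegral_countWait_le qB G (emptyDraws S G) u hP I (fun κ κ' hκ => ?_) hIcard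
    (j := j + 1) (by omega) (fun d κ => ?_)
  · have h2 : qB (some G) * (E : ℝ≥0∞) = ENNReal.ofReal (P / τ) := by
      rw [hq, ← ENNReal.ofReal_natCast E, ← ENNReal.ofReal_mul (by positivity), hE]
      congr 1
      field_simp
    have h3 : (P : ℝ≥0∞) * ((j + 1 - 1 + E : ℕ) : ℝ≥0∞) =
        ENNReal.ofReal (P * (j + β * W * P)) := by
      rw [ENNReal.ofReal_mul hP0.le, ENNReal.ofReal_natCast, ← hE, ← Nat.cast_add,
        ENNReal.ofReal_natCast, Nat.add_sub_cancel]
    rw [h2, h3] at h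
    refine (le_ofReal_div_of_mul_le (by positivity) h).trans_eq ?_
    congr 1
    field_simp
  · refine Finset.disjoint_left.2 fun z hz hz' => ?_
    obtain ⟨a, ha, hza⟩ := Finset.mem_biUnion.1 hz
    obtain ⟨b, hb, hzb⟩ := Finset.mem_biUnion.1 hz'
    have hle : κ' * P + P ≤ κ * P := by rw [← Nat.succ_mul]; exact Nat.mul_le_mul_right _ hκ
    rw [Finset.mem_range] at ha hb
    exact Finset.disjoint_left.1 (disjoint_emptySlots S (by omega)) hza hzb
  · induction κ with
    | zero => simp
    | succ κ ih =>
      rw [Finset.sum_range_succ (fun s => drawCount G (I s) d), ← add_assoc, ← ih, hI,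
        drawCount_biUnion G d _ _ fun a _ b _ hab => disjoint_emptySlots S (by omega),
        Nat.succ_mul, show u + (κ * P + P) + 1 = u + κ * P + 1 + P by omega,
        Finset.sum_range_add]
      rfl

/-- Expected waiting time for the `j`-th draw of `G` for the inserted slots. -/
lemma lintegral_countWait_insertedDraws_le {x : ℕ} (hx : x < N)
    {qQ : PMF (Option Label)} {G : Label} {σ : ℝ} (hσ : 0 < σ)
    (hq : qQ (some G) = ENNReal.ofReal (1 / (σ / N))) (j t : ℕ) :
    ∫⁻ e, countWait (insertedDraws N x G e) (j + 1) t ∂drawsLaw ℕ qQ ≤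
      ENNReal.ofReal ((j + 1) * σ) := by
  have hN : 1 ≤ N := by omega
  have hN0 : (0 : ℝ) < N := by exact_mod_cast hN
  -- Every `N` consecutive slots contain exactly one inserted slot, so each chunk is a single draw.
  have h := lintegral_countWait_le qQ G (insertedDraws N x G) t hN
    (fun κ => {insertedBefore N x (t + 1) + κ}) (fun κ κ' hκ => by simp; omega) (E := 1)
    (fun κ => Finset.card_singleton _) (j := j + 1) (by omega) (fun e κ => ?_)
  · have h3 : (N : ℝ≥0∞) * ((j + 1 - 1 + 1 : ℕ) : ℝ≥0∞) = ENNReal.ofReal (N * (j + 1)) := by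
      rw [ENNReal.ofReal_mul hN0.le, ENNReal.ofReal_natCast, Nat.add_sub_cancel]
      rw [← ENNReal.ofReal_natCast (j + 1)]
      push_cast
      rfl
    rw [Nat.cast_one, mul_one, hq, h3] at h
    refine (le_ofReal_div_of_mul_le (by positivity) h).trans_eq ?_
    congr 1
    field_simp
  · rw [sum_insertedDraws e hN, sum_insertedDraws e hN, add_right_comm,
      insertedBefore_add_period hx]
    simp only [drawCount_eq_sum, Finset.sum_range_add, Finset.sum_singleton]

end Expectation

section Expectation

variable {W m : ℕ} {D : Grouped m} {N : ℕ} {S : Schedule W m} {A B Q : Finset Label} {P : ℕ}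

lemma sum_stretch_countWait_le (hN : 2 ≤ N) (c : ℕ → ℕ) (j : ℕ) :
    ∑ x ∈ Finset.range (N - 1), ∑ t ∈ Finset.range (N * P),
      countWait (stretch N x c) (j + 1) t ≤
    ∑ u ∈ Finset.range ((N - 1) * P), ((N + 2) * countWait c (j + 1) u + 1) := by
  rw [mul_comm N P, mul_comm (N - 1) P]
  exact sum_countWait_stretch_le hN c (j + 1) P (by omega)

lemma sum_range_natCast (n : ℕ) :
    (∑ j ∈ Finset.range n, (j : ℝ)) = n * (n - 1) / 2 := by
  induction n with
  | zero => simp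
  | succ n ih => rw [Finset.sum_range_succ, ih]; push_cast; ring

/-- Summing `(j + E) * τ` over `j < g` gives `(g * (g - 1) / 2 + g * E) * τ`. The condition `2 * E ≤
ε * g` turns this into `(1 + ε) * g ^ 2 * τ / 2`; this is where groups must be large. -/
lemma sum_lintegral_stretch_le (hN : 2 ≤ N) {qB : PMF (Option Label)} {G : Label} {E τ ε : ℝ}
    (hE : 0 ≤ E) (hτ : 0 < τ) (g : ℕ)
    (h : ∀ j u, ∫⁻ d, countWait (emptyDraws S G d) (j + 1) u ∂drawsLaw (ℕ × Fin W) qB ≤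
      ENNReal.ofReal ((j + E) * τ)) (hg : 2 * E ≤ ε * g) :
    ∑ j ∈ Finset.range g, ∑ x ∈ Finset.range (N - 1), ∑ t ∈ Finset.range (N * P),
        ∫⁻ d, countWait (stretch N x (emptyDraws S G d)) (j + 1) t ∂drawsLaw (ℕ × Fin W) qB ≤
      ((N - 1) * P : ℕ) * ENNReal.ofReal ((N + 2) * (1 + ε) * (g ^ 2 * τ / 2) + g) := by
  set μ := drawsLaw (ℕ × Fin W) qB with hμ
  have hm : ∀ x j t, Measurable fun d : ℕ × Fin W → Option Label =>
      countWait (stretch N x (emptyDraws S G d)) j t := fun x j t =>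
    measurable_countWait (fun s => measurable_stretch_emptyDraws G s) _ _
  have hm2 : ∀ j t, Measurable fun d : ℕ × Fin W → Option Label =>
      countWait (emptyDraws S G d) j t := fun j t =>
    measurable_countWait (fun s => measurable_drawCount G _) _ _
  have h1 : ∀ j, ∑ x ∈ Finset.range (N - 1), ∑ t ∈ Finset.range (N * P),
        ∫⁻ d, countWait (stretch N x (emptyDraws S G d)) (j + 1) t ∂μ ≤
      ((N - 1) * P : ℕ) * ENNReal.ofReal ((N + 2) * ((j + E) * τ) + 1) := by
    intro j
    calc _ = ∫⁻ d, ∑ x ∈ Finset.range (N - 1), ∑ t ∈ Finset.range (N * P),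
            countWait (stretch N x (emptyDraws S G d)) (j + 1) t ∂μ := by
          rw [lintegral_finsetSum _ fun x _ => Finset.measurable_sum _ fun t _ => hm x _ t]
          exact Finset.sum_congr rfl fun x _ => (lintegral_finsetSum _ fun t _ => hm x _ t).symm
      _ ≤ ∫⁻ d, ∑ u ∈ Finset.range ((N - 1) * P),
            ((N + 2) * countWait (emptyDraws S G d) (j + 1) u + 1) ∂μ :=
          lintegral_mono fun d => sum_stretch_countWait_le hN _ j
      _ = ∑ u ∈ Finset.range ((N - 1) * P),
            ((N + 2) * ∫⁻ d, countWait (emptyDraws S G d) (j + 1) u ∂μ + 1) := by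
          rw [lintegral_finsetSum _ fun u _ => ((hm2 _ u).const_mul _).add_const 1]
          refine Finset.sum_congr rfl fun u _ => ?_
          rw [lintegral_add_right _ measurable_const, lintegral_const_mul _ (hm2 _ u)]
          simp
      _ ≤ ∑ u ∈ Finset.range ((N - 1) * P), ENNReal.ofReal ((N + 2) * ((j + E) * τ) + 1) := by
          refine Finset.sum_le_sum fun u _ => ?_
          rw [ENNReal.ofReal_add (by positivity) zero_le_one, ENNReal.ofReal_mul (by positivity),
            ENNReal.ofReal_one, ENNReal.ofReal_add (by positivity) (by norm_num),
            ENNReal.ofReal_natCast, ENNReal.ofReal_ofNat]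
          gcongr
          exact h j u
      _ = _ := by rw [Finset.sum_const, Finset.card_range, nsmul_eq_mul]
  refine (Finset.sum_le_sum fun j _ => h1 j).trans ?_
  rw [← Finset.mul_sum, ← ENNReal.ofReal_sum_of_nonneg fun j _ => by positivity]
  gcongr
  rw [Finset.sum_add_distrib, ← Finset.mul_sum, ← Finset.sum_mul, Finset.sum_add_distrib,
    sum_range_natCast]
  simp only [Finset.sum_const, Finset.card_range, nsmul_eq_mul, mul_one]
  have h2 : (g : ℝ) * (g - 1) / 2 + g * E ≤ (1 + ε) * (g ^ 2 / 2) := by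
    have hg0 : (0 : ℝ) ≤ g := Nat.cast_nonneg g
    nlinarith
  have h3 : ((N : ℝ) + 2) * ((g * (g - 1) / 2 + g * E) * τ) ≤
      (N + 2) * (((1 + ε) * (g ^ 2 / 2)) * τ) := by gcongr
  linarith

lemma sum_lintegral_filledBound_le (hN : 2 ≤ N) {qB : PMF (Option Label)} {τ : Label → ℝ}
    {E ε : ℝ} (hε : 0 ≤ ε) (hE : 0 ≤ E) (hp : ∀ G, 0 ≤ D.prob G) (hτ : ∀ G ∈ B, 0 < τ G)
    (h : ∀ G ∈ B, ∀ j u, ∫⁻ d, countWait (emptyDraws S G d) (j + 1) u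
      ∂drawsLaw (ℕ × Fin W) qB ≤ ENNReal.ofReal ((j + E) * τ G))
    (hg : ∀ G ∈ B, 2 * E ≤ ε * D.size G) :
    ∑ x ∈ Finset.range (N - 1), ∑ t ∈ Finset.range (N * P),
        ∫⁻ d, filledBound D N S B x t d ∂drawsLaw (ℕ × Fin W) qB ≤
      ((N - 1) * P : ℕ) * ENNReal.ofReal
        ((N + 2) * (1 + ε) * ∑ G ∈ B, D.prob G * (D.size G : ℝ) ^ 2 * τ G / 2 +
          ∑ G ∈ B, D.prob G * D.size G) := by
  have hm : ∀ G x j t, Measurable fun d : ℕ × Fin W → Option Label =>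
      countWait (stretch N x (emptyDraws S G d)) j t := fun G x j t =>
    measurable_countWait (fun s => measurable_stretch_emptyDraws G s) _ _
  calc _ = ∑ G ∈ B, ENNReal.ofReal (D.prob G) * ∑ j ∈ Finset.range (D.size G),
        ∑ x ∈ Finset.range (N - 1), ∑ t ∈ Finset.range (N * P),
          ∫⁻ d, countWait (stretch N x (emptyDraws S G d)) (j + 1) t
            ∂drawsLaw (ℕ × Fin W) qB := by
        have e1 : ∀ x t, ∫⁻ d, filledBound D N S B x t d ∂drawsLaw (ℕ × Fin W) qB =
            ∑ G ∈ B, ENNReal.ofReal (D.prob G) * ∑ j ∈ Finset.range (D.size G),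
              ∫⁻ d, countWait (stretch N x (emptyDraws S G d)) (j + 1) t
                ∂drawsLaw (ℕ × Fin W) qB := by
          intro x t
          simp only [filledBound]
          rw [lintegral_finsetSum _ fun G _ => (Finset.measurable_sum _ fun j _ =>
            hm G x _ t).const_mul _]
          refine Finset.sum_congr rfl fun G _ => ?_
          rw [lintegral_const_mul _ (Finset.measurable_sum _ fun j _ => hm G x _ t),
            lintegral_finsetSum _ fun j _ => hm G x _ t]
        simp only [e1, Finset.mul_sum]
        rw [Finset.sum_congr rfl fun x _ => Finset.sum_comm, Finset.sum_comm]
        refine Finset.sum_congr rfl fun G _ => ?_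
        rw [Finset.sum_congr rfl fun x _ => Finset.sum_comm, Finset.sum_comm]
    _ ≤ ∑ G ∈ B, ENNReal.ofReal (D.prob G) * (((N - 1) * P : ℕ) *
          ENNReal.ofReal ((N + 2) * (1 + ε) * ((D.size G : ℝ) ^ 2 * τ G / 2) + D.size G)) := by
        refine Finset.sum_le_sum fun G hG => ?_
        gcongr
        exact sum_lintegral_stretch_le hN hE (hτ G hG) _ (h G hG) (hg G hG)
    _ = _ := by
        have hnn : ∀ G ∈ B, 0 ≤ (N + 2 : ℝ) * (1 + ε) * ((D.size G : ℝ) ^ 2 * τ G / 2) +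
            D.size G := fun G hG => by have := hτ G hG; positivity
        have e2 : (N + 2 : ℝ) * (1 + ε) * ∑ G ∈ B, D.prob G * (D.size G : ℝ) ^ 2 * τ G / 2 +
            ∑ G ∈ B, D.prob G * D.size G = ∑ G ∈ B, D.prob G *
            ((N + 2) * (1 + ε) * ((D.size G : ℝ) ^ 2 * τ G / 2) + D.size G) := by
          rw [Finset.mul_sum, ← Finset.sum_add_distrib]
          exact Finset.sum_congr rfl fun G _ => by ring
        rw [e2, ENNReal.ofReal_sum_of_nonneg fun G hG => mul_nonneg (hp G) (hnn G hG),
          Finset.mul_sum]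
        refine Finset.sum_congr rfl fun G hG => ?_
        rw [ENNReal.ofReal_mul (hp G)]
        ring

/-- The sum of `j + 1` over `j < g` is `g * (g + 1) / 2 ≤ g ^ 2`. No lower bound on the group size
is available here, and the factor `2` against the relaxation is accepted. -/
lemma lintegral_insertedBound_le {qQ : PMF (Option Label)} {σ : Label → ℝ} {x : ℕ}
    (hp : ∀ G, 0 ≤ D.prob G) (hσ : ∀ G ∈ Q, 0 < σ G) (hs : ∀ G ∈ Q, 1 ≤ D.size G) {t : ℕ}
    (h : ∀ G ∈ Q, ∀ j, ∫⁻ e, countWait (insertedDraws N x G e) (j + 1) t ∂drawsLaw ℕ qQ ≤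
      ENNReal.ofReal ((j + 1) * σ G)) :
    ∫⁻ e, insertedBound D N Q x t e ∂drawsLaw ℕ qQ ≤
      ENNReal.ofReal (∑ G ∈ Q, D.prob G * (D.size G : ℝ) ^ 2 * σ G) := by
  have hm : ∀ G j, Measurable fun e : ℕ → Option Label =>
      countWait (insertedDraws N x G e) j t := fun G j =>
    measurable_countWait (fun s => measurable_insertedDraws G s) _ _
  simp only [insertedBound]
  rw [lintegral_finsetSum _ fun G _ => (Finset.measurable_sum _ fun j _ => hm G _).const_mul _,
    ENNReal.ofReal_sum_of_nonneg fun G hG => by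
      have := hp G; have := hσ G hG; positivity]
  refine Finset.sum_le_sum fun G hG => ?_
  rw [lintegral_const_mul _ (Finset.measurable_sum _ fun j _ => hm G _),
    lintegral_finsetSum _ fun j _ => hm G _, mul_assoc, ENNReal.ofReal_mul (hp G)]
  gcongr
  refine (Finset.sum_le_sum fun j _ => h G hG j).trans ?_
  have h0 := hσ G hG
  rw [← ENNReal.ofReal_sum_of_nonneg fun j _ => by positivity, ← Finset.sum_mul,
    Finset.sum_add_distrib, sum_range_natCast]
  refine ENNReal.ofReal_le_ofReal ?_
  simp only [Finset.sum_const, Finset.card_range, nsmul_eq_mul, mul_one]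
  have h1 : (1 : ℝ) ≤ D.size G := by exact_mod_cast hs G hG
  gcongr
  nlinarith

lemma lintegral_drawCost {ι : Type*} {q : PMF (Option Label)} {τ : Label → ℝ}
    (hq : IsDrawLaw Q τ q) (hτ : ∀ G ∈ Q, 0 < τ G) (hc : ∀ G, 0 ≤ D.cst G) (i : ι) :
    ∫⁻ d, drawCost D (d i) ∂drawsLaw ι q = ENNReal.ofReal (∑ G ∈ Q, D.cst G / τ G) := by
  classical
  rw [lintegral_draw q i (drawCost D), tsum_eq_sum (s := Finset.insertNone Q)]
  · rw [Finset.sum_insertNone, ENNReal.ofReal_sum_of_nonneg fun G hG =>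
      div_nonneg (hc G) (hτ G hG).le]
    simp only [drawCost, Option.elim, zero_mul, zero_add]
    refine Finset.sum_congr rfl fun G hG => ?_
    rw [hq G, if_pos hG, ← ENNReal.ofReal_mul (hc G), mul_one_div]
  · rintro (_ | G) hG
    · simp at hG
    · rw [Finset.some_mem_insertNone] at hG
      rw [hq G, if_neg hG, mul_zero]

/-- A period of the output contains `N - 1` periods of `S`, whose empty positions cost `bB` each in
expectation, and `P` inserted slots. -/
lemma sum_lintegral_bcBound {qB qQ : PMF (Option Label)} {x : ℕ} (hx : x < N - 1)
    (hS : ∀ t k, S (t + P) k = S t k) {bB bQ : ℝ≥0∞}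
    (hB : ∀ z, ∫⁻ d, drawCost D (d z) ∂drawsLaw (ℕ × Fin W) qB = bB)
    (hQ : ∀ k, ∫⁻ e, drawCost D (e k) ∂drawsLaw ℕ qQ = bQ) :
    ∑ t ∈ Finset.range (N * P), ∫⁻ z, bcBound D N S A x t z.1 z.2
        ∂(drawsLaw (ℕ × Fin W) qB).prod (drawsLaw ℕ qQ) =
      (N - 1 : ℕ) * (∑ u ∈ Finset.range P, slotBc D.c (D.messages A) S u +
        (∑ u ∈ Finset.range P, (emptySlots S u).card : ℕ) * bB) + P * bQ := by
  have hN : 0 < N := by omega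
  have hm : ∀ {ι : Type} (i : ι), Measurable fun d : ι → Option Label => drawCost D (d i) :=
    fun i => (measurable_of_countable (drawCost D)).comp (measurable_pi_apply i)
  have h1 : ∀ u, ∫⁻ z, bcBound D N S A x (newTime N x u) z.1 z.2
        ∂(drawsLaw (ℕ × Fin W) qB).prod (drawsLaw ℕ qQ) =
      slotBc D.c (D.messages A) S u + (emptySlots S u).card * bB := by
    intro u
    simp only [bcBound, if_neg (not_inserted_newTime hx u), origIndex_newTime hx u]
    rw [measurePreserving_fst.lintegral_comp (f := fun d : ℕ × Fin W → Option Label => slotBc D.c (D.messages A) S u +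
      ∑ z ∈ emptySlots S u, drawCost D (d z)) (measurable_const.add
        (Finset.measurable_sum _ fun z _ => hm z)), lintegral_add_left measurable_const,
      lintegral_finsetSum _ fun z _ => hm z]
    simp [hB]
  have h2 : ∀ k, ∫⁻ z, bcBound D N S A x (x + k * N) z.1 z.2
        ∂(drawsLaw (ℕ × Fin W) qB).prod (drawsLaw ℕ qQ) = bQ := by
    intro k
    simp only [bcBound, if_pos (inserted_add (N := N) (x := x) k)]
    simp only [Nat.add_sub_cancel_left, Nat.mul_div_cancel _ hN]
    rw [measurePreserving_snd.lintegral_comp (f := fun e : ℕ → Option Label => drawCost D (e k)) (hm k), hQ]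
  rw [mul_comm N P, sum_slots hx, Finset.sum_congr rfl fun u _ => h1 u,
    Finset.sum_congr rfl fun k _ => h2 k, mul_comm P, sum_range_mul_of_periodic fun s => by
      simp only [slotBc, Finset.card_eq_sum_ones, sum_emptySlots, hS]]
  rw [Finset.sum_add_distrib, ← Finset.sum_mul, ← Nat.cast_sum]
  simp

end Expectation

/-! ### Collecting the contributions of `A`, `B` and the negligible groups -/

section ExpectedCost

variable {W m : ℕ} {D : Grouped m} {N : ℕ} {S : Schedule W m} {A B Q : Finset Label} {P : ℕ}

lemma lintegral_slotBound (qB qQ : PMF (Option Label)) (x t : ℕ) :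
    ∫⁻ z, slotBound D N S A B Q x t z.1 z.2 ∂(drawsLaw (ℕ × Fin W) qB).prod (drawsLaw ℕ qQ) =
      waitBound D N S A x t + ∫⁻ d, filledBound D N S B x t d ∂drawsLaw (ℕ × Fin W) qB +
        ∫⁻ e, insertedBound D N Q x t e ∂drawsLaw ℕ qQ +
        ∫⁻ z, bcBound D N S A x t z.1 z.2
          ∂(drawsLaw (ℕ × Fin W) qB).prod (drawsLaw ℕ qQ) := by
  have hm : Measurable fun z : (ℕ × Fin W → Option Label) × (ℕ → Option Label) =>
      insertedBound D N Q x t z.2 := measurable_insertedBound.comp measurable_snd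
  simp only [slotBound]
  rw [lintegral_add_right _ measurable_bcBound, lintegral_add_right _ hm, lintegral_add_left measurable_const,
    measurePreserving_snd.lintegral_comp (f := fun e : ℕ → Option Label =>
      insertedBound D N Q x t e) measurable_insertedBound,
    measurePreserving_fst.lintegral_comp (f := fun d : ℕ × Fin W → Option Label =>
      filledBound D N S B x t d) measurable_filledBound]
  simp

/-- The sum extends over `(N - 1) * (N * P)` pairs of an offset and a slot, so division yields the
factor `(N + 2) / N` for `A` and for `B` (there together with `1 + ε`), and the factor `2` for `Q`.
The probabilities of the messages of `A` and `B` enter through the single slot that a stretch may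
add. -/
theorem sum_lintegral_slotBound_le (hN : 2 ≤ N) (hW : 1 ≤ W) (hP : 1 ≤ P)
    (hS : ∀ t k, S (t + P) k = S t k) (hp : ∀ G, 0 ≤ D.prob G) (hc : ∀ G, 0 ≤ D.cst G)
    {qB qQ : PMF (Option Label)} {τ σ : Label → ℝ} {β ε : ℝ} (hβ : 0 < β) (hε : 0 ≤ ε)
    (hτ : ∀ G ∈ B, 0 < τ G) (hσ : ∀ G ∈ Q, 0 < σ G) (hs : ∀ G ∈ Q, 1 ≤ D.size G)
    (hE : ((∑ s ∈ Finset.range P, (emptySlots S s).card : ℕ) : ℝ) = β * W * P)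
    (hg : ∀ G ∈ B, 2 * (β * W * P) ≤ ε * D.size G)
    (hqB : IsDrawLaw B (fun G => τ G * β * W) qB) (hqQ : IsDrawLaw Q (fun G => σ G / N) qQ)
    {Z : ℝ≥0∞} (hZ : ∑ u ∈ Finset.range P, slotCostInf D.p D.c (D.messages A) S u ≤ P * Z) :
    ∑ x ∈ Finset.range (N - 1), ∑ t ∈ Finset.range (N * P),
        ∫⁻ z, slotBound D N S A B Q x t z.1 z.2
          ∂(drawsLaw (ℕ × Fin W) qB).prod (drawsLaw ℕ qQ) ≤
      ((N - 1) * P : ℕ) * ((N + 2) * Z + ∑ i ∈ D.messages A, ENNReal.ofReal (D.p i) +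
        ENNReal.ofReal ((N + 2) * (1 + ε) * D.lbValue B τ + ∑ G ∈ B, D.prob G * D.size G +
          2 * N * D.lbValue Q σ)) := by
  have hW0 : (0 : ℝ) < W := by exact_mod_cast hW
  have hP0 : (0 : ℝ) < P := by exact_mod_cast hP
  have hN0 : (0 : ℝ) < N := by exact_mod_cast (by omega : 0 < N)
  set wB := ∑ G ∈ B, D.prob G * (D.size G : ℝ) ^ 2 * τ G / 2 with hwB
  set kB := ∑ G ∈ B, D.cst G / τ G with hkB
  set pB := ∑ G ∈ B, D.prob G * (D.size G : ℝ) with hpB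
  set wQ := ∑ G ∈ Q, D.prob G * (D.size G : ℝ) ^ 2 * σ G with hwQ
  set kQ := ∑ G ∈ Q, D.cst G / σ G with hkQ
  have hwB0 : 0 ≤ wB := Finset.sum_nonneg fun G hG => by
    have := hp G; have := hτ G hG; positivity
  have hkB0 : 0 ≤ kB := Finset.sum_nonneg fun G hG => div_nonneg (hc G) (hτ G hG).le
  have hpB0 : 0 ≤ pB := Finset.sum_nonneg fun G hG => by have := hp G; positivity
  have hwQ0 : 0 ≤ wQ := Finset.sum_nonneg fun G hG => by
    have := hp G; have := hσ G hG; positivity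
  have hkQ0 : 0 ≤ kQ := Finset.sum_nonneg fun G hG => div_nonneg (hc G) (hσ G hG).le
  have hlB : D.lbValue B τ = wB + kB := Finset.sum_add_distrib
  have hlQ : D.lbValue Q σ = wQ / 2 + kQ := by
    rw [hwQ, Finset.sum_div]
    exact Finset.sum_add_distrib
  set bB := ENNReal.ofReal (∑ G ∈ B, D.cst G / (τ G * β * W)) with hbB
  set bQ := ENNReal.ofReal (∑ G ∈ Q, D.cst G / (σ G / N)) with hbQ
  have hEbB : ((∑ s ∈ Finset.range P, (emptySlots S s).card : ℕ) : ℝ≥0∞) * bB =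
      P * ENNReal.ofReal kB := by
    rw [← ENNReal.ofReal_natCast, hE, hbB, ← ENNReal.ofReal_mul (by positivity),
      ← ENNReal.ofReal_natCast, ← ENNReal.ofReal_mul hP0.le, Finset.mul_sum, hkB, Finset.mul_sum]
    congr 1
    refine Finset.sum_congr rfl fun G hG => ?_
    have := (hτ G hG).ne'
    field_simp
  have hbQ' : bQ = ENNReal.ofReal (N * kQ) := by
    rw [hbQ, hkQ, Finset.mul_sum]
    congr 1
    refine Finset.sum_congr rfl fun G hG => ?_
    have := (hσ G hG).ne'
    field_simp
  have h1 := sum_waitBound_le (D := D) (A := A) hN hS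
  have h2 := sum_lintegral_filledBound_le (S := S) (P := P) hN (D := D) (B := B) (qB := qB)
    (E := β * W * P) hε (by positivity) hp hτ (fun G hG j u =>
      lintegral_countWait_emptyDraws_le hP hS hβ (hτ G hG) hW hE
        ((hqB G).trans (if_pos hG)) j u) hg
  have h3 : ∑ x ∈ Finset.range (N - 1), ∑ t ∈ Finset.range (N * P),
      ∫⁻ e, insertedBound D N Q x t e ∂drawsLaw ℕ qQ ≤
        ((N - 1) * P : ℕ) * (N * ENNReal.ofReal wQ) := by
    refine (Finset.sum_le_sum fun x hx => Finset.sum_le_sum fun t _ =>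
      lintegral_insertedBound_le hp hσ hs fun G hG j =>
        lintegral_countWait_insertedDraws_le (by rw [Finset.mem_range] at hx; omega)
          (hσ G hG) ((hqQ G).trans (if_pos hG)) j t).trans_eq ?_
    simp only [Finset.sum_const, Finset.card_range, nsmul_eq_mul]
    push_cast
    ring
  have h4 : ∑ x ∈ Finset.range (N - 1), ∑ t ∈ Finset.range (N * P),
      ∫⁻ z, bcBound D N S A x t z.1 z.2
          ∂(drawsLaw (ℕ × Fin W) qB).prod (drawsLaw ℕ qQ) =
      (N - 1 : ℕ) * ((N - 1 : ℕ) * (∑ u ∈ Finset.range P, slotBc D.c (D.messages A) S u +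
        P * ENNReal.ofReal kB) + P * ENNReal.ofReal (N * kQ)) := by
    rw [Finset.sum_congr rfl fun x hx => sum_lintegral_bcBound (A := A)
      (Finset.mem_range.1 hx) hS
      (fun z => lintegral_drawCost hqB (fun G hG => by have := hτ G hG; positivity) hc z)
      (fun k => lintegral_drawCost hqQ (fun G hG => by have := hσ G hG; positivity) hc k)]
    rw [Finset.sum_const, Finset.card_range, nsmul_eq_mul, ← hbB, ← hbQ, hEbB, hbQ']
  simp only [lintegral_slotBound, Finset.sum_add_distrib] at h1 h2 h3 h4 ⊢
  rw [h4]
  refine (add_le_add (add_le_add (add_le_add h1 h2) h3) le_rfl).trans ?_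
  set U := ∑ u ∈ Finset.range P,
    ∑ i ∈ D.messages A, ENNReal.ofReal (D.p i) * countWait (airs S i) 1 u with hU
  set V := ∑ u ∈ Finset.range P, slotBc D.c (D.messages A) S u with hV
  have hUV : U + V ≤ P * Z := by
    rw [hU, hV, ← Finset.sum_add_distrib]
    exact hZ
  set pA := ∑ i ∈ D.messages A, ENNReal.ofReal (D.p i) with hpA
  have hN1 : ((N - 1 : ℕ) : ℝ≥0∞) ≤ N + 2 := by
    have : N - 1 ≤ N + 2 := by omega
    exact_mod_cast (Nat.cast_le (α := ℝ≥0∞)).2 this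
  have hreal : ENNReal.ofReal ((N + 2) * (1 + ε) * wB + pB) + N * ENNReal.ofReal wQ +
      (N + 2) * ENNReal.ofReal kB + ENNReal.ofReal (N * kQ) ≤
      ENNReal.ofReal ((N + 2) * (1 + ε) * D.lbValue B τ + pB + 2 * N * D.lbValue Q σ) := by
    rw [show (N : ℝ≥0∞) + 2 = ENNReal.ofReal (N + 2) by
        rw [ENNReal.ofReal_add hN0.le (by norm_num), ENNReal.ofReal_natCast, ENNReal.ofReal_ofNat],
      ← ENNReal.ofReal_natCast N, ← ENNReal.ofReal_mul hN0.le,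
      ← ENNReal.ofReal_mul (by positivity), ← ENNReal.ofReal_add (by positivity) (by positivity),
      ← ENNReal.ofReal_add (by positivity) (by positivity),
      ← ENNReal.ofReal_add (by positivity) (by positivity), hlB, hlQ]
    refine ENNReal.ofReal_le_ofReal ?_
    have e1 : 0 ≤ (N + 2 : ℝ) * ε * kB := by positivity
    have e2 : 0 ≤ (N : ℝ) * kQ := by positivity
    linarith
  calc _ = (N - 1 : ℕ) * (((N + 2) * U + (N - 1 : ℕ) * V) + P * (pA +
        (ENNReal.ofReal ((N + 2) * (1 + ε) * wB + pB) + N * ENNReal.ofReal wQ +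
          (N - 1 : ℕ) * ENNReal.ofReal kB + ENNReal.ofReal (N * kQ)))) := by
        push_cast
        ring
    _ ≤ (N - 1 : ℕ) * (((N + 2) * U + (N + 2) * V) + P * (pA +
        (ENNReal.ofReal ((N + 2) * (1 + ε) * wB + pB) + N * ENNReal.ofReal wQ +
          (N + 2) * ENNReal.ofReal kB + ENNReal.ofReal (N * kQ)))) := by
        gcongr
    _ ≤ (N - 1 : ℕ) * ((N + 2) * (P * Z) + P * (pA + ENNReal.ofReal
        ((N + 2) * (1 + ε) * D.lbValue B τ + pB + 2 * N * D.lbValue Q σ))) := by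
        rw [← mul_add]
        gcongr
    _ = _ := by
        push_cast
        ring

lemma lintegral_choiceLaw (qB qQ : PMF (Option Label)) {f : Choices W → ℝ≥0∞}
    (hf : Measurable f) :
    ∫⁻ ω, f ω ∂choiceLaw W N qB qQ = (∑ x ∈ Finset.range (N - 1),
      ∫⁻ z, f (x, z) ∂(drawsLaw (ℕ × Fin W) qB).prod (drawsLaw ℕ qQ)) / (N - 1 : ℕ) := by
  rw [choiceLaw, lintegral_prod _ hf.aemeasurable, ProbabilityTheory.uniformOn,
    ProbabilityTheory.cond, lintegral_smul_measure]
  have h : Set.Iio (N - 1) = (Finset.range (N - 1) : Set ℕ) := by ext; simp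
  rw [h, lintegral_finset, Measure.count_apply_finset, Finset.card_range, ENNReal.div_eq_inv_mul]
  simp [drawsLaw]

end ExpectedCost

/-! ### The expected cost of the output and the final constants -/

section Conclusion

variable {W m : ℕ}

lemma sum_card_emptySlots (S : Schedule W m) (P : ℕ) :
    ∑ s ∈ Finset.range P, (emptySlots S s).card +
      ((Finset.range P ×ˢ (Finset.univ : Finset (Fin W))).filter fun s => S s.1 s.2 ≠ none).card =
      W * P := by
  have h : ∀ s, (emptySlots S s).card = (Finset.univ.filter fun k => S s k = none).card := by
    intro s
    rw [Finset.card_eq_sum_ones, sum_emptySlots, Finset.card_filter]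
  rw [Finset.card_filter, Finset.sum_product, ← Finset.sum_add_distrib]
  have h2 : ∀ s, (emptySlots S s).card + ∑ k, (if S s k ≠ none then 1 else 0) = W := by
    intro s
    rw [h, ← Finset.card_filter]
    exact (Finset.card_filter_add_card_filter_not _).trans (by simp)
  rw [Finset.sum_congr rfl fun s _ => h2 s]
  simp [mul_comm]

variable {ε C : ℝ} {p c : Fin m → ℝ} {A B Q : Finset Label} {x : ℕ} {S : Schedule W m}
  {τB τQ : Label → ℝ} {qB qQ : PMF (Option Label)}

theorem IsPlan.lintegral_cost_le (hI : IsInstance W ε C p c) (hε7 : ε < 1 / 7)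
    (hP : IsPartition (rounded W ε p c) W ε C A B Q)
    (h : IsPlan (rounded W ε p c) W ε C A B Q x S τB τQ qB qQ) :
    insertPeriod ε C * ∫⁻ ω, cost (rounded W ε p c).p (rounded W ε p c).c Finset.univ
        (output (rounded W ε p c) (insertPeriod ε C) S ω)
          ∂choiceLaw W (insertPeriod ε C) qB qQ ≤
      (insertPeriod ε C + 2) * (ENNReal.ofReal (1 + ε) *
        (cost (rounded W ε p c).p (rounded W ε p c).c ((rounded W ε p c).messages A) S +
          LB (rounded W ε p c) W B (1 - gridDensity (rounded W ε p c) W ε C A x))) + 2 +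
      2 * insertPeriod ε C * LB (rounded W ε p c) 1 Q (1 / insertPeriod ε C) := by
  have hps := hI.rounded_p_sum
  have hp0 : ∀ i, 0 ≤ (rounded W ε p c).p i := fun i => (hI.rounded_p_pos i).le
  have hc0 : ∀ i, 0 ≤ (rounded W ε p c).c i := hI.rounded_c_nonneg
  have hprob : ∀ G, 0 ≤ (rounded W ε p c).prob G := fun G => (hI.prob_pos G).le
  have hcst : ∀ G, 0 ≤ (rounded W ε p c).cst G := hI.cst_nonneg
  generalize rounded W ε p c = D at *
  have hW := hI.W_pos
  have hε := hI.eps_pos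
  have hWr : (0 : ℝ) < W := by exact_mod_cast hW
  have hN := two_le_insertPeriod (C := C) hε hε7
  set N := insertPeriod ε C with hNdef
  have hN0 : (0 : ℝ) < N := by exact_mod_cast (by omega : 0 < N)
  obtain ⟨⟨hxlt, hSA, P, hP1, hPL, hSP, hdens⟩, -⟩ := h.best
  have hβ : 0 < 1 - gridDensity D W ε C A x := sub_pos.2 (gridDensity_lt_one h.best.1)
  set β := 1 - gridDensity D W ε C A x with hβdef
  have hPr : (0 : ℝ) < P := by exact_mod_cast hP1
  have hE : ((∑ s ∈ Finset.range P, (emptySlots S s).card : ℕ) : ℝ) = β * W * P := by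
    have h1 : ((∑ s ∈ Finset.range P, (emptySlots S s).card : ℕ) : ℝ) +
        (((Finset.range P ×ˢ (Finset.univ : Finset (Fin W))).filter
          fun s => S s.1 s.2 ≠ none).card : ℝ) = W * P := by
      exact_mod_cast sum_card_emptySlots S P
    rw [div_eq_iff (by positivity)] at hdens
    rw [hdens] at h1
    rw [hβdef]
    linarith
  have hEle : β * W * P ≤ W * (periodConst ε C * (size1 D A : ℝ) ^ 2) := by
    have h1 : β ≤ 1 := by
      have : 0 ≤ gridDensity D W ε C A x := by unfold gridDensity; positivity
      linarith
    have h2 : (P : ℝ) ≤ periodConst ε C * (size1 D A : ℝ) ^ 2 := by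
      refine (Nat.cast_le.2 hPL).trans (Nat.floor_le ?_)
      have := periodConst_pos (C := C) hε hε7
      positivity
    calc β * W * P ≤ 1 * W * (periodConst ε C * (size1 D A : ℝ) ^ 2) := by gcongr
      _ = _ := by ring
  -- A period has at most `W * P` empty positions, and `P` is at most `periodConst` times the square
  -- of the size of `A`; `kappa` is chosen so that twice this is at most `ε` times the size of every
  -- group in `B`.
  have hg : ∀ G ∈ B, 2 * (β * W * P) ≤ ε * D.size G := by
    intro G hG
    have h1 := hP.large G hG
    calc 2 * (β * W * P) ≤ 2 * (W * (periodConst ε C * (size1 D A : ℝ) ^ 2)) := by gcongr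
      _ = ε * (kappa W ε C * (size1 D A : ℝ) ^ 2) := by
          rw [kappa]; field_simp
      _ ≤ ε * D.size G := by gcongr
  have hQs : ∀ G ∈ Q, 1 ≤ D.size G := fun G hG => Grouped.size_pos (by rw [← hP.cover]; simp [hG])
  set pA := ∑ i ∈ D.messages A, D.p i with hpA
  set cA := cost D.p D.c (D.messages A) S with hcA
  have hpA0 : 0 ≤ pA := Finset.sum_nonneg fun i _ => hp0 i
  have hpB : ∑ G ∈ B, D.prob G * (D.size G : ℝ) = ∑ i ∈ D.messages B, D.p i := by
    rw [sum_messages]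
    refine Finset.sum_congr rfl fun G _ => ?_
    rw [sum_group_p D G fun a _ _ => a, Finset.sum_const, nsmul_eq_mul, mul_comm]
    rfl
  have hpAB : pA + ∑ G ∈ B, D.prob G * (D.size G : ℝ) ≤ 1 := by
    rw [hpB, hpA, ← Finset.sum_union (disjoint_messages D hP.disj_AB), ← hps]
    exact Finset.sum_le_sum_of_subset_of_nonneg (Finset.subset_univ _) fun i _ _ => hp0 i
  have hpB0 : 0 ≤ ∑ G ∈ B, D.prob G * (D.size G : ℝ) :=
    Finset.sum_nonneg fun G _ => mul_nonneg (hprob G) (Nat.cast_nonneg _)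
  have hZ : ∑ u ∈ Finset.range P, slotCostInf D.p D.c (D.messages A) S u ≤
      P * (cA + ENNReal.ofReal (pA / 2)) := by
    have := slotCostInf_average_le hp0 hc0 hP1 hSP (X := D.messages A)
    rw [ENNReal.div_le_iff (by exact_mod_cast (by omega : P ≠ 0)) (ENNReal.natCast_ne_top P)] at this
    rwa [mul_comm]
  have hmain := sum_lintegral_slotBound_le hN hW hP1 hSP hprob hcst hβ hε.le h.solB.1.1 h.solQ.1.1
    hQs hE hg h.lawB h.lawQ hZ
  have hlB := h.solB.LB_eq
  have hlQ := h.solQ.LB_eq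
  have hlB0 : 0 ≤ D.lbValue B τB := lbValue_nonneg hprob hcst h.solB.1.1
  have hlQ0 : 0 ≤ D.lbValue Q τQ := lbValue_nonneg hprob hcst h.solQ.1.1
  set lB := D.lbValue B τB with hlBdef
  set lQ := D.lbValue Q τQ with hlQdef
  set pB := ∑ G ∈ B, D.prob G * (D.size G : ℝ) with hpBdef
  set F : ℕ → ℝ≥0∞ := fun x => ∫⁻ z, cost D.p D.c Finset.univ (output D N S (x, z))
    ∂(drawsLaw (ℕ × Fin W) qB).prod (drawsLaw ℕ qQ) with hF
  set R : ℝ≥0∞ := (N + 2) * (cA + ENNReal.ofReal (pA / 2)) +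
    ∑ i ∈ D.messages A, ENNReal.ofReal (D.p i) +
    ENNReal.ofReal ((N + 2) * (1 + ε) * lB + pB + 2 * N * lQ) with hR
  have hsum : ∑ x ∈ Finset.range (N - 1), (F x + ENNReal.ofReal (1 / 2)) ≤
      ((N - 1) * P : ℕ) * R / (N * P : ℕ) := by
    refine le_trans (Finset.sum_le_sum fun y hy => lintegral_cost_output_add_half_le hW
      (by rw [Finset.mem_range] at hy; omega) hP.cover hP.disj_AB hP.disj_AQ hP.disj_BQ hSA hP1 hSP
      hp0 hc0 hps qB qQ) ?_
    simp only [ENNReal.div_eq_inv_mul]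
    rw [← Finset.mul_sum]
    gcongr
  have hN1 : ((N - 1 : ℕ) : ℝ≥0∞) ≠ 0 := by exact_mod_cast (by omega : N - 1 ≠ 0)
  have hN1' : ((N - 1 : ℕ) : ℝ≥0∞) ≠ ⊤ := ENNReal.natCast_ne_top _
  have hNe : (N : ℝ≥0∞) ≠ 0 := by exact_mod_cast (by omega : N ≠ 0)
  have hNe' : (N : ℝ≥0∞) ≠ ⊤ := ENNReal.natCast_ne_top _
  have hPe : (P : ℝ≥0∞) ≠ 0 := by exact_mod_cast (by omega : P ≠ 0)
  have hPe' : (P : ℝ≥0∞) ≠ ⊤ := ENNReal.natCast_ne_top _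
  have hsum2 : N * ((∑ x ∈ Finset.range (N - 1), F x) / (N - 1 : ℕ)) + ENNReal.ofReal (N / 2) ≤
      R := by
    rw [Finset.sum_add_distrib, Finset.sum_const, Finset.card_range, nsmul_eq_mul,
      ENNReal.le_div_iff_mul_le (Or.inl (by simp [hNe, hPe]))
        (Or.inl (ENNReal.natCast_ne_top _))] at hsum
    have h1 : ((N - 1 : ℕ) : ℝ≥0∞) * P *
        (N * ((∑ x ∈ Finset.range (N - 1), F x) / (N - 1 : ℕ)) + ENNReal.ofReal (N / 2)) ≤
        ((N - 1 : ℕ) : ℝ≥0∞) * P * R := by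
      refine le_of_eq_of_le ?_ (hsum.trans_eq (by push_cast; rfl))
      have h2 : ((N - 1 : ℕ) : ℝ≥0∞) * ((∑ x ∈ Finset.range (N - 1), F x) / (N - 1 : ℕ)) =
          ∑ x ∈ Finset.range (N - 1), F x := ENNReal.mul_div_cancel hN1 hN1'
      have h3 : ENNReal.ofReal ((N : ℝ) / 2) = N * ENNReal.ofReal (1 / 2) := by
        rw [← ENNReal.ofReal_natCast, ← ENNReal.ofReal_mul hN0.le]
        congr 1
        ring
      rw [h3]
      calc _ = P * N * (((N - 1 : ℕ) : ℝ≥0∞) *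
            ((∑ x ∈ Finset.range (N - 1), F x) / (N - 1 : ℕ)) +
              ((N - 1 : ℕ) : ℝ≥0∞) * ENNReal.ofReal (1 / 2)) := by ring
        _ = _ := by
          rw [h2, Nat.cast_mul]
          ring
    exact (ENNReal.mul_le_mul_iff_right (mul_ne_zero hN1 hPe) (ENNReal.mul_ne_top hN1' hPe')).1 h1
  rw [lintegral_choiceLaw qB qQ (measurable_cost_output D N S D.p D.c Finset.univ), hlB, hlQ]
  have hfin : R ≤ ((N + 2) * (ENNReal.ofReal (1 + ε) * (cA + ENNReal.ofReal lB)) + 2 +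
      2 * N * ENNReal.ofReal lQ) + ENNReal.ofReal (N / 2) := by
    have h1 : R = (N + 2) * cA + ENNReal.ofReal ((N + 2) * (pA / 2) + pA +
        ((N + 2) * (1 + ε) * lB + pB + 2 * N * lQ)) := by
      have e2 : (N : ℝ≥0∞) + 2 = ENNReal.ofReal (N + 2) := by
        rw [ENNReal.ofReal_add hN0.le (by norm_num), ENNReal.ofReal_natCast, ENNReal.ofReal_ofNat]
      rw [hR, ← ENNReal.ofReal_sum_of_nonneg fun i _ => hp0 i, mul_add, add_assoc, add_assoc,
        ← hpA, e2, ← ENNReal.ofReal_mul (by positivity), ← ENNReal.ofReal_add (by positivity)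
        (by positivity), ← ENNReal.ofReal_add (by positivity) (by positivity)]
      congr 2
      ring
    -- The probabilities contribute at most `(N + 2) / 2 + 1 = N / 2 + 2`. The part `N / 2` cancels
    -- against the half slots on the left, which leaves the constant `2` of the statement.
    have h2 : ENNReal.ofReal ((N + 2) * (pA / 2) + pA +
        ((N + 2) * (1 + ε) * lB + pB + 2 * N * lQ)) ≤
        ENNReal.ofReal ((N + 2) * ((1 + ε) * lB) + 2 + 2 * N * lQ + N / 2) := by
      refine ENNReal.ofReal_le_ofReal ?_
      have : (N + 2 : ℝ) * (pA / 2) ≤ (N + 2) * (1 / 2) := by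
        gcongr
        linarith
      linarith
    have h3 : ENNReal.ofReal ((N + 2) * ((1 + ε) * lB) + 2 + 2 * N * lQ + N / 2) =
        (N + 2) * (ENNReal.ofReal (1 + ε) * ENNReal.ofReal lB) + 2 +
          2 * N * ENNReal.ofReal lQ + ENNReal.ofReal (N / 2) := by
      rw [ENNReal.ofReal_add (by positivity) (by positivity),
        ENNReal.ofReal_add (by positivity) (by positivity),
        ENNReal.ofReal_add (by positivity) (by positivity),
        ENNReal.ofReal_mul (by positivity), ENNReal.ofReal_mul (by positivity),
        ENNReal.ofReal_mul (by positivity), ENNReal.ofReal_mul (by norm_num),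
        ENNReal.ofReal_add hN0.le (by norm_num), ENNReal.ofReal_natCast, ENNReal.ofReal_ofNat]
    have h4 : cA ≤ ENNReal.ofReal (1 + ε) * cA :=
      le_mul_of_one_le_left zero_le (by rw [ENNReal.one_le_ofReal]; linarith)
    rw [h1]
    calc _ ≤ (N + 2) * (ENNReal.ofReal (1 + ε) * cA) +
          ((N + 2) * (ENNReal.ofReal (1 + ε) * ENNReal.ofReal lB) + 2 +
          2 * N * ENNReal.ofReal lQ + ENNReal.ofReal (N / 2)) := by
          rw [← h3]
          gcongr
      _ = _ := by ring
  exact (ENNReal.add_le_add_iff_right ENNReal.ofReal_ne_top).1 (hsum2.trans hfin)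

lemma final_constant (hε : 0 < ε) (hε7 : ε < 1 / 7) :
    (1 + ε) * ((1 + ε) * ((1 + ε / 5) * (1 + ε) * (1 + 3 / 2 * ε) + ε)) + 2 * ε ≤ 1 + 10 * ε := by
  have h2 : ε * ε ≤ 1 / 7 * ε := by gcongr
  have h3 : (1 + ε / 5) * (1 + ε) ≤ 1 + 5 / 4 * ε := by nlinarith
  have h4 : (1 + ε / 5) * (1 + ε) * (1 + 3 / 2 * ε) ≤ 1 + 31 / 10 * ε := by
    calc _ ≤ (1 + 5 / 4 * ε) * (1 + 3 / 2 * ε) := by gcongr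
      _ ≤ _ := by nlinarith
  have h5 : (1 + ε) * ((1 + ε / 5) * (1 + ε) * (1 + 3 / 2 * ε) + ε) ≤ 1 + 57 / 10 * ε := by
    calc _ ≤ (1 + ε) * (1 + 31 / 10 * ε + ε) := by gcongr
      _ ≤ _ := by nlinarith
  calc _ ≤ (1 + ε) * (1 + 57 / 10 * ε) + 2 * ε := by gcongr
    _ ≤ _ := by nlinarith

/-- Undoing the rounding costs a factor `1 + ε` and an additive `ε`, the optimum of the rounded
instance costs another factor `1 + ε`, and the additive `ε` is at most `2 * ε * o`. -/
theorem add_le_ofReal_mul_of_le {ε o w : ℝ} {I : ENNReal} (hε : 0 < ε) (hε7 : ε < 1 / 7)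
    (ho : 1 / 2 ≤ o) (hw : 0 ≤ w) (hwo : w ≤ (1 + ε) * o)
    (hI : I ≤ ENNReal.ofReal (((1 + ε / 5) * (1 + ε) * (1 + 3 / 2 * ε) + ε) * w)) :
    ENNReal.ofReal (1 + ε) * I + ENNReal.ofReal ε ≤
      ENNReal.ofReal (1 + 10 * ε) * ENNReal.ofReal o := by
  set k := (1 + ε / 5) * (1 + ε) * (1 + 3 / 2 * ε) + ε with hk
  have hk0 : 0 ≤ k := by positivity
  have ho0 : 0 ≤ o := by linarith
  calc ENNReal.ofReal (1 + ε) * I + ENNReal.ofReal ε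
      ≤ ENNReal.ofReal (1 + ε) * ENNReal.ofReal (k * w) + ENNReal.ofReal ε :=
        add_le_add_left (mul_le_mul_right hI _) _
    _ = ENNReal.ofReal ((1 + ε) * (k * w) + ε) := by
        rw [← ENNReal.ofReal_mul (by positivity),
          ← ENNReal.ofReal_add (by positivity) hε.le]
    _ ≤ ENNReal.ofReal ((1 + 10 * ε) * o) := by
        refine ENNReal.ofReal_le_ofReal ?_
        have h1 : (1 + ε) * (k * w) ≤ (1 + ε) * (k * ((1 + ε) * o)) := by gcongr
        have h2 : ε * (1 / 2) ≤ ε * o := mul_le_mul_of_nonneg_left ho hε.le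
        have h3 := mul_le_mul_of_nonneg_right (final_constant hε hε7) ho0
        rw [← hk] at h3
        linarith
    _ = ENNReal.ofReal (1 + 10 * ε) * ENNReal.ofReal o := ENNReal.ofReal_mul (by positivity)

theorem IsPlan.lintegral_original_cost_le (hI : IsInstance W ε C p c) (hε7 : ε < 1 / 7)
    (hP : IsPartition (rounded W ε p c) W ε C A B Q)
    (h : IsPlan (rounded W ε p c) W ε C A B Q x S τB τQ qB qQ) :
    ∫⁻ ω, cost p c Finset.univ (output (rounded W ε p c) (insertPeriod ε C) S ω)
        ∂choiceLaw W (insertPeriod ε C) qB qQ ≤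
      ENNReal.ofReal (1 + 10 * ε) * opt W p c := by
  have hε := hI.eps_pos
  have hN := two_le_insertPeriod (C := C) hε hε7
  have hN0 : (0 : ℝ) < insertPeriod ε C := by
    exact_mod_cast (by omega : 0 < insertPeriod ε C)
  rcases eq_or_ne (opt W p c) ⊤ with htop | hne
  -- Only a finite optimum needs an argument, and then all quantities can be treated as real
  -- numbers.
  · rw [htop, ENNReal.mul_top (by simp; linarith)]
    exact le_top
  have hΩle := hI.rounded_opt_le
  have hΩne : opt W (rounded W ε p c).p (rounded W ε p c).c ≠ ⊤ :=
    ne_top_of_le_ne_top (ENNReal.mul_ne_top ENNReal.ofReal_ne_top hne) hΩle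
  set o := (opt W p c).toReal with ho
  set w := (opt W (rounded W ε p c).p (rounded W ε p c).c).toReal with hw
  have hoE : opt W p c = ENNReal.ofReal o := (ENNReal.ofReal_toReal hne).symm
  have hwE : opt W (rounded W ε p c).p (rounded W ε p c).c = ENNReal.ofReal w :=
    (ENNReal.ofReal_toReal hΩne).symm
  have ho0 : 0 ≤ o := ENNReal.toReal_nonneg
  have hw0 : 0 ≤ w := ENNReal.toReal_nonneg
  have ho2 : 1 / 2 ≤ o := by
    have := half_le_opt (W := W) (fun i => (hI.p_pos i).le) hI.p_sum hI.c_nonneg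
    rw [hoE] at this
    exact (ENNReal.ofReal_le_ofReal_iff ho0).1 this
  have hw2 : 1 / 2 ≤ w := by
    have := half_le_opt (W := W) (fun i => (hI.rounded_p_pos i).le) hI.rounded_p_sum
      hI.rounded_c_nonneg
    rw [hwE] at this
    exact (ENNReal.ofReal_le_ofReal_iff hw0).1 this
  have hwo : w ≤ (1 + ε) * o := by
    rw [hwE, hoE, ← ENNReal.ofReal_mul (by positivity)] at hΩle
    exact (ENNReal.ofReal_le_ofReal_iff (by positivity)).1 hΩle
  have hmain := h.lintegral_cost_le hI hε7 hP
  have hbest := hI.best_le hε7 hP h.best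
  have hneg := hP.negligible
  have h10 := ten_div_le_insertPeriod (C := C) hε
  have hmeas := measurable_cost_output (rounded W ε p c) (insertPeriod ε C) S
    (rounded W ε p c).p (rounded W ε p c).c Finset.univ
  set I := ∫⁻ ω, cost (rounded W ε p c).p (rounded W ε p c).c Finset.univ
        (output (rounded W ε p c) (insertPeriod ε C) S ω)
          ∂choiceLaw W (insertPeriod ε C) qB qQ with hIdef
  set N := insertPeriod ε C with hNdef
  have hIle : I ≤ ENNReal.ofReal (((1 + ε / 5) * (1 + ε) * (1 + 3 / 2 * ε) + ε) * w) := by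
    have e1 : ENNReal.ofReal N * I ≤ ENNReal.ofReal ((N + 2) * ((1 + ε) * ((1 + 3 / 2 * ε) * w)) +
        2 + 2 * N * (3 * ε / 10 * w)) := by
      have e0 : ENNReal.ofReal ((N + 2) * ((1 + ε) * ((1 + 3 / 2 * ε) * w)) +
          2 + 2 * N * (3 * ε / 10 * w)) =
          (N + 2) * (ENNReal.ofReal (1 + ε) * (ENNReal.ofReal (1 + 3 / 2 * ε) *
            ENNReal.ofReal w)) + 2 + 2 * N * (ENNReal.ofReal (3 * ε / 10) * ENNReal.ofReal w) := by
        rw [← ENNReal.ofReal_mul (by positivity), ← ENNReal.ofReal_mul (by positivity),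
          ← ENNReal.ofReal_mul (by positivity), ENNReal.ofReal_add (by positivity) (by positivity),
          ENNReal.ofReal_add (by positivity) (by positivity),
          ENNReal.ofReal_mul (p := (N : ℝ) + 2) (by positivity),
          ENNReal.ofReal_mul (p := 2 * (N : ℝ)) (by positivity),
          ENNReal.ofReal_mul (p := 2) (by norm_num),
          ENNReal.ofReal_add (p := (N : ℝ)) hN0.le (by norm_num), ENNReal.ofReal_natCast,
          ENNReal.ofReal_ofNat]
      rw [ENNReal.ofReal_natCast, e0, ← hwE]
      refine hmain.trans ?_
      gcongr
    refine (le_ofReal_div_of_mul_le hN0 e1).trans (ENNReal.ofReal_le_ofReal ?_)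
    rw [div_le_iff₀ hN0]
    -- After division by `N`, the stretch gives `1 + ε / 5`, the constant `2` becomes at most `2 / 5
    -- * ε * w` because `1 / 2 ≤ w`, and the negligible groups contribute `2 * (3 / 10) * ε * w`.
    -- The last two terms add up to `ε * w`.
    have e2 : 10 ≤ ε * N := by
      rw [div_le_iff₀ hε] at h10
      linarith
    have e3 : (N + 2 : ℝ) ≤ (1 + ε / 5) * N := by linarith
    have e4 : (N + 2 : ℝ) * ((1 + ε) * ((1 + 3 / 2 * ε) * w)) ≤
        (1 + ε / 5) * N * ((1 + ε) * ((1 + 3 / 2 * ε) * w)) := by gcongr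
    have e5 : 2 ≤ ε * N * (2 / 5 * w) := by
      calc (2 : ℝ) = 10 * (2 / 5 * (1 / 2)) := by norm_num
        _ ≤ ε * N * (2 / 5 * w) := by gcongr
    linarith
  calc ∫⁻ ω, cost p c Finset.univ (output (rounded W ε p c) N S ω) ∂choiceLaw W N qB qQ
      ≤ ∫⁻ ω, (ENNReal.ofReal (1 + ε) * cost (rounded W ε p c).p (rounded W ε p c).c Finset.univ
        (output (rounded W ε p c) N S ω) + ENNReal.ofReal ε) ∂choiceLaw W N qB qQ :=
        lintegral_mono fun ω => hI.cost_le_rounded _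
    _ ≤ ENNReal.ofReal (1 + ε) * I + ENNReal.ofReal ε := by
        rw [lintegral_add_right _ measurable_const, lintegral_const_mul _ hmeas]
        gcongr
        have : (choiceLaw W N qB qQ) Set.univ ≤ 1 := by
          have hfin : IsProbabilityMeasure (choiceLaw W N qB qQ) := by
            have : IsProbabilityMeasure (ProbabilityTheory.uniformOn (Set.Iio (N - 1))) :=
              ProbabilityTheory.isProbabilityMeasure_uniformOn (Set.finite_Iio _)
                ⟨0, by simp; omega⟩
            unfold choiceLaw
            infer_instance
          exact prob_le_one
        rw [lintegral_const]
        exact mul_le_of_le_one_right zero_le this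
    _ ≤ ENNReal.ofReal (1 + 10 * ε) * opt W p c := by
        rw [hoE]
        exact add_le_ofReal_mul_of_le hε hε7 ho2 hw0 hwo hIle

end Conclusion

end DataBroadcast

end

/-! ### Assembly of the main theorem -/

theorem mainTheorem2 (W : ℕ) (hW : 1 ≤ W) (ε C : ℝ) (hε : 0 < ε) (hε7 : ε < 1 / 7) (hC : 0 ≤ C) :
    ∃ K : ℕ, ∀ (m : ℕ) (p c : Fin m → ℝ), (∀ i, 0 < p i) → (∑ i, p i = 1) →
      (∀ i, 0 ≤ c i ∧ c i ≤ C) →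
      -- the partition step can be carried out, with a number of messages in `A` bounded by `K`
      (∃ A B Q : Finset DataBroadcast.Label,
        DataBroadcast.IsPartition (DataBroadcast.rounded W ε p c) W ε C A B Q ∧
        ((DataBroadcast.rounded W ε p c).messages A).card ≤ K) ∧
      ∀ A B Q : Finset DataBroadcast.Label,
        DataBroadcast.IsPartition (DataBroadcast.rounded W ε p c) W ε C A B Q →
        -- the remaining steps can be carried out
        (∃ x S τB τQ qB qQ,
          DataBroadcast.IsPlan (DataBroadcast.rounded W ε p c) W ε C A B Q x S τB τQ qB qQ) ∧
        -- and whichever way they are, the expected cost for the original messages is near-optimal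
        ∀ x S τB τQ qB qQ,
          DataBroadcast.IsPlan (DataBroadcast.rounded W ε p c) W ε C A B Q x S τB τQ qB qQ →
          Measurable (fun ω : DataBroadcast.Choices W =>
            DataBroadcast.cost p c Finset.univ
              (DataBroadcast.output (DataBroadcast.rounded W ε p c)
                (DataBroadcast.insertPeriod ε C) S ω)) ∧
          ∫⁻ ω, DataBroadcast.cost p c Finset.univ
              (DataBroadcast.output (DataBroadcast.rounded W ε p c)
                (DataBroadcast.insertPeriod ε C) S ω)
            ∂(DataBroadcast.choiceLaw W (DataBroadcast.insertPeriod ε C) qB qQ) ≤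
          ENNReal.ofReal (1 + 10 * ε) * DataBroadcast.opt W p c := by
  obtain ⟨K, hK⟩ := DataBroadcast.exists_isPartition hW hε hε7 hC
  refine ⟨K, fun m p c hp hp1 hc => ?_⟩
  have hI : DataBroadcast.IsInstance W ε C p c :=
    ⟨hW, hε, hp, hp1, fun i => (hc i).1, fun i => (hc i).2⟩
  exact ⟨hK m p c hI, fun A B Q hP => ⟨hI.exists_isPlan hε7 hP, fun x S τB τQ qB qQ h =>
    ⟨DataBroadcast.measurable_cost_output _ _ _ _ _ _,
      h.lintegral_original_cost_le hI hε7 hP⟩⟩⟩
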